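/- Let $p$ be a prime, $k$ an algebraically closed field of characteristic $p$, $G=\mathrm{SL}_2(\mathbb F_p)$, and let $n$ be an integer with $2\le n\le p-2$. For $i\ge 1$ let $V_i$ be the $i$-dimensional $kG$-module of homogeneous polynomials of degree $i-1$ in $k[X,Y]$, on which $\begin{pmatrix}a&b\\c&d\end{pmatrix}$ acts by $f(X,Y)\mapsto f(aX+cY,bX+dY)$. Write $[U:M]$ for the multiplicity of an indecomposable module $M$ as a direct summand of a finite-dimensional $kG$-module $U$. Let $w$ assign a positive weight $w(M)$ to every (isomorphism class of) finite-dimensional non-projective indecomposable $kG$-module $M$; put $w(i)=w(V_i)$ and assume $w(i)=w(p-i)$ for $1\le i\le p-1$. For $m\in\{n,p-n\}$ and $1\le i,j\le p-1$ let $$Q^{(m)}_{i,j}=\frac{w(V_j)\,[V_i\otimes V_m:V_j]}{\sum_M w(M)\,[V_i\otimes V_m:M]},$$ where $M$ runs over the isomorphism classes of non-projective indecomposable modules. The walk on $\{1,\dots,p-1\}$ with transition matrix $Q=Q^{(n)}$ is the non-projective summand random walk. Let $T_{i,j}=1$ if $i+j=p$ and $0$ otherwise. Let $\bar Q^{(m)}$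 be the $\frac{p-1}2\times\frac{p-1}2$ matrix with $\bar Q^{(m)}_{i,j}=Q^{(m)}_{2i-1,2j-1}$ if $m$ is odd and $\bar Q^{(m)}_{i,j}=Q^{(m)}_{2i-1,p+1-2j}$ if $m$ is even, and $\bar Q=\bar Q^{(n)}$. Finally let $$\pi_i=\frac{w(i)\sum_l w(l)[V_i\otimes V_n:V_l]}{\sum_x w(x)\sum_y w(y)[V_x\otimes V_n:V_y]}\qquad(1\le i\le p-1).$$ Then $Q$ is a stochastic matrix with stationary distribution $\pi$, and: 1. $Q^{(n)}=TQ^{(p-n)}=Q^{(p-n)}T$. 2. $TQT=Q$. 3. The walk is invariant under the relabelling $i\mapsto p-i$, that is, $Q_{p-i,p-j}=Q_{i,j}$. 4. If $n$ is odd, then $Q_{i,j}=0$ whenever $i+j$ is odd, the restrictions of the walk to the odd states and to the even states are irreducible, and these two subchains are isomorphic. 5. $\bar Q^{(p-n)}=\bar Q^{(n)}$. 6. With the states ordered as $1,3,\dots,p-2,p-1,p-3,\dots,4,2$, $$Q=\bar Q\otimes\begin{pmatrix}0&1\\1&0\end{pmatrix}^{n+1},$$ where the index $(i,a)$ of the Kronecker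 product is the $i$-th state of the first half of this order for $a=0$ and of the second half for $a=1$. 7. If $n$ is odd, every complex eigenvalue of $Q$ has even multiplicity (algebraic and geometric). If $n$ is even, the eigenvalues of $Q$ come in signed pairs: the multiset of complex eigenvalues with algebraic multiplicity has the form $S\sqcup(-S)$, and $\mu$ and $-\mu$ have equal geometric multiplicity for every $\mu\in\mathbb C$. 8. Let $\lambda_\star=\max\{|\lambda| : \lambda\ne1\text{ an eigenvalue of }\bar Q\}$. This maximum exists and $\lambda_\star<1$. For $0<\varepsilon\le1$ and a chain $P$ with stationary distribution $\rho$, let $t_{\mathrm{mix}}(\varepsilon)$ be the least $t\ge0$ with $\lVert P^t(i,\cdot)-\rho\rVert_{\mathrm{TV}}\le\varepsilon$ for all $i$. The mixing time satisfies $$t_{\mathrm{mix}}(\varepsilon)\le\frac1{1-\lambda_\star}\log\Bigl(\frac1{\varepsilon\min_i\pi_i}\Bigr)$$ in each of the following senses. * For every $n$: for the least $t$ such that $\lVert\nu Q^t-\pi\rVert_{\mathrm{TV}}\le\varepsilon$ for all initial distributions $\nu$ that give probability $\frac12$ to the odd states and $\frac12$ to the even states. * For odd $n$ (where $Q$ is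 reducible): for the mixing time of each of the two irreducible subchains, whose stationary distribution is $2\pi$ restricted to its states; here even with $\min_i 2\pi_i$ over those states in place of $\min_i\pi_i$. * For even $n$ (where $Q$ has period $2$): for half the mixing time of the lazy walk $\frac12(Q+I)$ with stationary distribution $\pi$. In each case the least time exists. -/

import Mathlib

noncomputable section

open MvPolynomial

universe u

/-! ### Modules for `SL₂(𝔽_p)` over a field `k` of characteristic `p` -/

/-- The group `SL₂(𝔽_p)`. -/
abbrev SL2 (p : ℕ) : Type := Matrix.SpecialLinearGroup (Fin 2) (ZMod p)

/-- The group algebra `k SL₂(𝔽_p)`. -/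
abbrev SL2Alg (k : Type u) [Field k] (p : ℕ) : Type u := MonoidAlgebra k (SL2 p)

/-- The linear substitution `X ↦ aX + cY`, `Y ↦ bX + dY` attached to `g = (a b; c d)`. -/
def linSubst (k : Type u) [Field k] (p : ℕ) [CharP k p] (g : SL2 p) :
    MvPolynomial (Fin 2) k →ₐ[k] MvPolynomial (Fin 2) k :=
  aeval ![C (ZMod.castHom (dvd_refl p) k (g 0 0)) * X 0
            + C (ZMod.castHom (dvd_refl p) k (g 1 0)) * X 1,
          C (ZMod.castHom (dvd_refl p) k (g 0 1)) * X 0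
            + C (ZMod.castHom (dvd_refl p) k (g 1 1)) * X 1]

theorem linSubst_one (k : Type u) [Field k] (p : ℕ) [CharP k p] :
    linSubst k p 1 = AlgHom.id k _ := by
  apply MvPolynomial.algHom_ext
  intro i
  fin_cases i <;> simp [linSubst]

theorem linSubst_mul (k : Type u) [Field k] (p : ℕ) [CharP k p] (g h : SL2 p) :
    linSubst k p (g * h) = (linSubst k p g).comp (linSubst k p h) := by
  apply MvPolynomial.algHom_ext
  intro i
  fin_cases i <;>
    simp [linSubst, Matrix.mul_apply, Fin.sum_univ_two, algHom_C] <;> ring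

theorem linSubst_mem (k : Type u) [Field k] (p : ℕ) [CharP k p] (g : SL2 p) (d : ℕ)
    (f : MvPolynomial (Fin 2) k) (hf : f ∈ homogeneousSubmodule (Fin 2) k d) :
    linSubst k p g f ∈ homogeneousSubmodule (Fin 2) k d := by
  rw [mem_homogeneousSubmodule] at hf ⊢
  have h := hf.aeval (![C (ZMod.castHom (dvd_refl p) k (g 0 0)) * X 0
            + C (ZMod.castHom (dvd_refl p) k (g 1 0)) * X 1,
          C (ZMod.castHom (dvd_refl p) k (g 0 1)) * X 0
            + C (ZMod.castHom (dvd_refl p) k (g 1 1)) * X 1] :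
      Fin 2 → MvPolynomial (Fin 2) k) (n := 1) (by
    intro i
    fin_cases i
    · exact (isHomogeneous_C_mul_X _ _).add (isHomogeneous_C_mul_X _ _)
    · exact (isHomogeneous_C_mul_X _ _).add (isHomogeneous_C_mul_X _ _))
  simpa [linSubst] using h

/-- The underlying space of `V_n`, for `n ≥ 1`: homogeneous polynomials of degree `n - 1` in two
variables. -/
abbrev VSpace (k : Type u) [Field k] (n : ℕ) : Type u :=
  ↥(homogeneousSubmodule (Fin 2) k (n - 1))

/-- The representation of `SL₂(𝔽_p)` on `V_n` by linear substitutions. -/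
def VRep (k : Type u) [Field k] (p : ℕ) [CharP k p] (n : ℕ) :
    Representation k (SL2 p) (VSpace k n) where
  toFun g := (linSubst k p g).toLinearMap.restrict (linSubst_mem k p g (n - 1))
  map_one' := by
    ext1 f
    apply Subtype.ext
    simp [linSubst_one, LinearMap.restrict_apply]
  map_mul' g h := by
    ext1 f
    apply Subtype.ext
    change linSubst k p (g * h) f = linSubst k p g (linSubst k p h f)
    rw [linSubst_mul]
    rfl

/-- The `k SL₂(𝔽_p)`-module of a representation. -/
abbrev repModule {k : Type u} [Field k] {p : ℕ} {V : Type u} [AddCommGroup V] [Module k V]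
    (ρ : Representation k (SL2 p) V) : ModuleCat.{u} (SL2Alg k p) :=
  ModuleCat.of (SL2Alg k p) ρ.asModule

/-- The module `V_n`. -/
abbrev VMod (k : Type u) [Field k] (p : ℕ) [CharP k p] (n : ℕ) : ModuleCat.{u} (SL2Alg k p) :=
  repModule (VRep k p n)

/-- The module `V_i ⊗ V_n` (tensor product over `k`, diagonal action). -/
abbrev VTensor (k : Type u) [Field k] (p : ℕ) [CharP k p] (i n : ℕ) :
    ModuleCat.{u} (SL2Alg k p) :=
  repModule (V := TensorProduct k (VSpace k i) (VSpace k n)) ((VRep k p i).tprod (VRep k p n))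

/-- A module is indecomposable if it is nonzero and is not the internal direct sum of two nonzero
submodules. -/
def IsIndecomposableModule (R : Type u) [Ring R] (M : Type u) [AddCommGroup M] [Module R M] :
    Prop :=
  Nontrivial M ∧ ∀ N₁ N₂ : Submodule R M, IsCompl N₁ N₂ → N₁ = ⊥ ∨ N₂ = ⊥

/-- Finite-dimensional non-projective indecomposable modules. (The group algebra is
finite-dimensional over `k`, so finitely generated means finite-dimensional.) -/
structure IsNonProjIndec {k : Type u} [Field k] {p : ℕ} (M : ModuleCat.{u} (SL2Alg k p)) :
    Prop where
  finite : Module.Finite (SL2Alg k p) M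
  indecomposable : IsIndecomposableModule (SL2Alg k p) M
  not_projective : ¬ Module.Projective (SL2Alg k p) M

/-- The multiplicity of `M` as a direct summand of `U`: the largest `m` for which
`U ≅ M^m ⊕ W` for some module `W`. For `M` indecomposable and `U` finite-dimensional this is the
number of summands isomorphic to `M` in a decomposition of `U` into indecomposable modules. -/
def summandMult {k : Type u} [Field k] {p : ℕ} (M U : ModuleCat.{u} (SL2Alg k p)) : ℕ :=
  sSup {m : ℕ | ∃ W : ModuleCat.{u} (SL2Alg k p),
    Nonempty (U ≃ₗ[SL2Alg k p] (Fin m → M) × W)}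

/-- Isomorphism classes of `k SL₂(𝔽_p)`-modules. -/
abbrev ModClass (k : Type u) [Field k] (p : ℕ) : Type (u + 1) :=
  Quotient (CategoryTheory.isIsomorphicSetoid (ModuleCat.{u} (SL2Alg k p)))

/-- The isomorphism class of a module. -/
def modClass {k : Type u} [Field k] {p : ℕ} (M : ModuleCat.{u} (SL2Alg k p)) : ModClass k p :=
  Quotient.mk _ M

/-- `w` assigns a positive weight to each (isomorphism class of a) non-projective indecomposable
module. Its values on other classes are never used. -/
def IsWeight {k : Type u} [Field k] {p : ℕ} (w : ModClass k p → ℝ) : Prop :=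
  ∀ M : ModuleCat.{u} (SL2Alg k p), IsNonProjIndec M → 0 < w (modClass M)

/-- The weight `w(i)` of the module `V_i`. -/
def weightOf {k : Type u} [Field k] {p : ℕ} [CharP k p] (w : ModClass k p → ℝ) (i : ℕ) : ℝ :=
  w (modClass (VMod k p i))

/-- `∑_M w(M) [U : M]`, the sum over all isomorphism classes of non-projective indecomposable
modules `M`. -/
def totalWeight {k : Type u} [Field k] {p : ℕ} (w : ModClass k p → ℝ)
    (U : ModuleCat.{u} (SL2Alg k p)) : ℝ :=
  ∑ᶠ (c : ModClass k p) (_ : IsNonProjIndec c.out), w c * (summandMult c.out U : ℝ)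

/-! ### The walk on the states `1, …, p - 1` -/

/-- The states `1, …, p - 1`; the state `i` stands for the module `V_i`. -/
abbrev State (p : ℕ) : Type := ↥(Finset.Icc 1 (p - 1))

/-- The indices `1, …, (p - 1) / 2`. -/
abbrev HalfIdx (p : ℕ) : Type := ↥(Finset.Icc 1 ((p - 1) / 2))

/-- The matrix of multiplicities of `V_j` in `V_i ⊗ V_n`. -/
def multMatrix (k : Type u) [Field k] (p : ℕ) [CharP k p] (n : ℕ) :
    Matrix (State p) (State p) ℝ :=
  Matrix.of fun i j => (summandMult (VMod k p j) (VTensor k p i n) : ℝ)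

/-- The transition matrix `Q^(n)` of the non-projective summand random walk: from `V_i` the walk
steps to a non-projective indecomposable summand of `V_i ⊗ V_n`, chosen with probability
proportional to weight. -/
def transMatrix {k : Type u} [Field k] {p : ℕ} [CharP k p] (w : ModClass k p → ℝ) (n : ℕ) :
    Matrix (State p) (State p) ℝ :=
  Matrix.of fun i j => weightOf w j * (summandMult (VMod k p j) (VTensor k p i n) : ℝ)
    / totalWeight w (VTensor k p i n)

/-- The matrix `T` with `T i j = 1` if `i + j = p` and `0` otherwise. -/
def flipMatrix (p : ℕ) : Matrix (State p) (State p) ℝ :=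
  Matrix.of fun i j => if (i : ℕ) + (j : ℕ) = p then 1 else 0

/-- The relabelling `i ↦ p - i` of the states. -/
def flipState (p : ℕ) : Equiv.Perm (State p) :=
  Function.Involutive.toPerm
    (fun i => ⟨p - i, by have := Finset.mem_Icc.mp i.2; rw [Finset.mem_Icc]; omega⟩)
    (fun i => by have := Finset.mem_Icc.mp i.2; apply Subtype.ext; simp only; omega)

/-- The state `2i - 1`. -/
def oddState {p : ℕ} (i : HalfIdx p) : State p :=
  ⟨2 * i - 1, by have := Finset.mem_Icc.mp i.2; rw [Finset.mem_Icc]; omega⟩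

/-- The state `p + 1 - 2i`. -/
def coState {p : ℕ} (i : HalfIdx p) : State p :=
  ⟨p + 1 - 2 * i, by have := Finset.mem_Icc.mp i.2; rw [Finset.mem_Icc]; omega⟩

/-- The matrix `Q̄^(n)`: the block of `Q^(n)` with rows `1, 3, …, p - 2` and with columns
`1, 3, …, p - 2` if `n` is odd, `p - 1, p - 3, …, 2` if `n` is even. -/
def transBar {k : Type u} [Field k] {p : ℕ} [CharP k p] (w : ModClass k p → ℝ) (n : ℕ) :
    Matrix (HalfIdx p) (HalfIdx p) ℝ :=
  Matrix.of fun i j =>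
    if Odd n then transMatrix w n (oddState i) (oddState j)
    else transMatrix w n (oddState i) (coState j)

/-- The ordering `1, 3, …, p - 2, p - 1, p - 3, …, 4, 2` of the states, split into two halves:
`(i, 0)` is the `i`-th state of the first half, `(i, 1)` the `i`-th state of the second half. -/
def stateOrder (p : ℕ) (x : HalfIdx p × Fin 2) : State p :=
  if x.2 = 0 then oddState x.1 else coState x.1

/-- The states of odd label. -/
abbrev OddStates (p : ℕ) : Type := {i : State p // Odd (i : ℕ)}

/-- The states of even label. -/
abbrev EvenStates (p : ℕ) : Type := {i : State p // Even (i : ℕ)}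

/-- The walk restricted to the odd states. -/
def oddChain {p : ℕ} (Q : Matrix (State p) (State p) ℝ) : Matrix (OddStates p) (OddStates p) ℝ :=
  Q.submatrix Subtype.val Subtype.val

/-- The walk restricted to the even states. -/
def evenChain {p : ℕ} (Q : Matrix (State p) (State p) ℝ) :
    Matrix (EvenStates p) (EvenStates p) ℝ :=
  Q.submatrix Subtype.val Subtype.val

/-- The distribution `π_i` proportional to `w(i) ∑_l w(l) [V_i ⊗ V_n : V_l]`. -/
def walkDist {k : Type u} [Field k] {p : ℕ} [CharP k p] (w : ModClass k p → ℝ) (n : ℕ)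
    (i : State p) : ℝ :=
  weightOf w i * (∑ l : State p, weightOf w l * multMatrix k p n i l)
    / ∑ x : State p, weightOf w x * ∑ y : State p, weightOf w y * multMatrix k p n x y

/-! ### Finite Markov chains -/

/-- Probability distributions on a finite set. -/
def IsDist {S : Type} [Fintype S] (ν : S → ℝ) : Prop :=
  (∀ i, 0 ≤ ν i) ∧ ∑ i, ν i = 1

/-- Stationary distributions of a transition matrix. -/
def IsStationaryDist {S : Type} [Fintype S] (P : Matrix S S ℝ) (π : S → ℝ) : Prop :=
  IsDist π ∧ Matrix.vecMul π P = π

/-- A bijection of state spaces is an isomorphism of Markov chains if it preserves transition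
probabilities. -/
def IsChainIso {S S' : Type} (P : Matrix S S ℝ) (R : Matrix S' S' ℝ) (e : S ≃ S') : Prop :=
  ∀ i j, R (e i) (e j) = P i j

/-- Total variation distance. -/
def tvDist {S : Type} [Fintype S] (μ ν : S → ℝ) : ℝ :=
  (1 / 2) * ∑ i, |μ i - ν i|

/-- `t` is the mixing time `t_mix(ε)` of the chain `P` with stationary distribution `π`: the least
time at which the law of the chain is within `ε` of `π` in total variation, whatever the starting
state. -/
def IsMixingTime {S : Type} [Fintype S] [DecidableEq S] (P : Matrix S S ℝ) (π : S → ℝ) (ε : ℝ)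
    (t : ℕ) : Prop :=
  IsLeast {t : ℕ | ∀ i, tvDist (fun j => (P ^ t) i j) π ≤ ε} t

/-- Initial distributions that give probability `1/2` to the odd states, and hence to the even
ones. -/
def IsBalanced {p : ℕ} (ν : State p → ℝ) : Prop :=
  IsDist ν ∧ ∑ i : OddStates p, ν i = 1 / 2

/-- `t` is the mixing time of the walk `Q` over balanced initial distributions: the least time at
which its law is within `ε` of `π` in total variation, whatever the balanced initial
distribution. -/
def IsBalancedMixingTime {p : ℕ} (Q : Matrix (State p) (State p) ℝ) (π : State p → ℝ) (ε : ℝ)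
    (t : ℕ) : Prop :=
  IsLeast {t : ℕ | ∀ ν, IsBalanced ν → tvDist (Matrix.vecMul ν (Q ^ t)) π ≤ ε} t

/-- The lazy version `(P + I) / 2` of a chain. -/
def lazyChain {S : Type} [DecidableEq S] (P : Matrix S S ℝ) : Matrix S S ℝ :=
  (1 / 2 : ℝ) • (P + 1)

/-- A real matrix, as an endomorphism of the complex vector space of column vectors. -/
def complexEnd {S : Type} [Fintype S] [DecidableEq S] (P : Matrix S S ℝ) :
    Module.End ℂ (S → ℂ) :=
  Matrix.toLin' (P.map (algebraMap ℝ ℂ))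

/-- The multiset of complex eigenvalues of a real matrix, with algebraic multiplicities. -/
def complexEigenvalues {S : Type} [Fintype S] [DecidableEq S] (P : Matrix S S ℝ) : Multiset ℂ :=
  (P.map (algebraMap ℝ ℂ)).charpoly.roots

/-- The absolute values of the eigenvalues different from `1`. -/
def nontrivialModuli {S : Type} [Fintype S] [DecidableEq S] (P : Matrix S S ℝ) : Set ℝ :=
  {r | ∃ μ : ℂ, (complexEnd P).HasEigenvalue μ ∧ μ ≠ 1 ∧ r = ‖μ‖}

/-- `(1 / (1 - lam)) log (1 / (ε m))`. -/
def mixBound (lam ε m : ℝ) : ℝ := 1 / (1 - lam) * Real.log (1 / (ε * m))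

end

/-! Everything rests on the truncated Clebsch–Gordan rule `repStableType_tensor`: for 1 ≤ i, n < p
the module V_i ⊗ V_n is a projective module plus one copy of each V_j with i + n + j odd, |i - n| <
j < i + n and i + n + j < 2p. The inputs are that V_j is simple and non-projective for j < p, that
the Steinberg module V_p is projective, and that V_i ⊗ V_2 ≅ V_{i-1} ⊕ V_{i+1} for 2 ≤ i < p, by the
Jacobian bracket and multiplication. Tensoring V_{n-1} ⊗ V_2 ≅ V_{n-2} ⊕ V_n with V_i gives a
recursion in n. It needs cancellation modulo projectives, but not the full Krull–Schmidt theorem: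
the sums of copies of the V_j and a projective (`StableType`) are closed under summands because
indecomposables have local endomorphism rings (`exists_of_summand`), and they determine their
multiplicities (`le_of_summand`, `exists_equiv`). Projectivity is handled by Higman's criterion
(`HasTraceOne`). The only non-projective indecomposable summands of V_i ⊗ V_n are thus V_j with j <
p, and Q is an explicit matrix on the states.

The rule is symmetric in i and j, which gives detailed balance with respect to π. It is unchanged
when two of i, n, j are replaced by their complements to p, which together with w(i) = w(p - i)
gives the identities with T. As p is odd, i ↦ p - i exchanges odd and even labels. With the parity
condition this makes Q block diagonal (n odd) or block antidiagonal (n even), both blocks being Q̄.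
The eigenvalue statements follow, since the antidiagonal matrix with blocks A is similar to diag(A,
-A).

For mixing, two-step paths of Q̄ join consecutive odd states (`fusionBar_connected`). So the
Dirichlet form of Q̄² vanishes only on constants, the eigenfunctions with eigenvalue of modulus 1
are constant, and λ⋆ < 1. By the spectral theorem a reversible chain contracts ℓ²(π) by r on the
orthogonal complement of the eigenvectors with eigenvalue of modulus above r. For Q and r = λ⋆ these
eigenvectors are constant on each half of the states, so they do not distinguish a balanced
distribution from π; the lazy walk has half the gap. Rounding the time down costs a factor e² < 8 in
the squared bound. It is absorbed by the 1/2 in the total variation distance and by min π ≤ 1/2. -/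

noncomputable section

open MvPolynomial

universe u

/-! ### Direct summands of sums of simple modules and projective modules -/

section StableType

variable {R : Type u} [Ring R]

/-- A form of Fitting's lemma: the endomorphism ring of an indecomposable module of finite length
is local. -/
theorem IsIndecomposableModule.bijective_or_bijective_of_add {X : Type u} [AddCommGroup X]
    [Module R X] [IsNoetherian R X] [IsArtinian R X] (hX : IsIndecomposableModule R X)
    (f g : Module.End R X) (h : Function.Bijective (f + g)) :
    Function.Bijective f ∨ Function.Bijective g := by
  have key : ∀ a : Module.End R X, IsUnit a ∨ IsNilpotent a := by
    intro a
    obtain ⟨n, hn⟩ := Filter.eventually_atTop.mp a.eventually_isCompl_ker_pow_range_pow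
    have hc := hn (n + 1) (Nat.le_succ n)
    rcases hX.2 _ _ hc with h0 | h0
    · left
      rw [Module.End.isUnit_iff]
      have hinj : Function.Injective (a ^ (n + 1)) := LinearMap.ker_eq_bot.mp h0
      have hsurj : Function.Surjective (a ^ (n + 1)) := by
        rw [← LinearMap.range_eq_top]
        have := hc.sup_eq_top
        rwa [h0, bot_sup_eq] at this
      refine (Module.End.isUnit_iff _).mp ?_
      exact (isUnit_pow_iff (Nat.succ_ne_zero n)).mp
        ((Module.End.isUnit_iff _).mpr ⟨hinj, hsurj⟩)
    · right
      exact ⟨n + 1, LinearMap.range_eq_bot.mp h0⟩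
  have hu : IsUnit (f + g) := (Module.End.isUnit_iff _).mpr h
  obtain ⟨v, hv⟩ := hu
  have h1 : (↑v⁻¹ : Module.End R X) * f + ↑v⁻¹ * g = 1 := by
    rw [← mul_add, ← hv, Units.inv_mul]
  rcases key (↑v⁻¹ * f) with hf | hf
  · left
    rw [← Module.End.isUnit_iff]
    exact (Units.isUnit_units_mul v⁻¹ f).mp hf
  · right
    rw [← Module.End.isUnit_iff, ← Units.isUnit_units_mul v⁻¹ g, eq_sub_of_add_eq' h1]
    exact hf.isUnit_one_sub

variable {ι : Type} [DecidableEq ι]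

/-- `StableType S M s` says that `M` is isomorphic to the direct sum of `s j` copies of `S j` for
all `j` and of a finitely generated projective module. -/
inductive StableType (S : ι → Type u) [∀ j, AddCommGroup (S j)] [∀ j, Module R (S j)] :
    ∀ (M : Type u) [AddCommGroup M] [Module R M], (ι → ℕ) → Prop
  | projective (M : Type u) [AddCommGroup M] [Module R M] [Module.Finite R M]
      [Module.Projective R M] : StableType S M 0
  | simple (j : ι) : StableType S (S j) (Pi.single j 1)
  | prod (M N : Type u) [AddCommGroup M] [Module R M] [AddCommGroup N] [Module R N]
      (s t : ι → ℕ) : StableType S M s → StableType S N t → StableType S (M × N) (s + t)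
  | equiv (M N : Type u) [AddCommGroup M] [Module R M] [AddCommGroup N] [Module R N]
      (s : ι → ℕ) : (M ≃ₗ[R] N) → StableType S M s → StableType S N s

namespace StableType

variable {S : ι → Type u} [∀ j, AddCommGroup (S j)] [∀ j, Module R (S j)]

theorem module_finite [∀ j, IsSimpleModule R (S j)] {M : Type u} [AddCommGroup M] [Module R M]
    {s : ι → ℕ} (h : StableType (R := R) S M s) : Module.Finite R M := by
  induction h with
  | projective M => infer_instance
  | simple j => infer_instance
  | prod M N s t _ _ h1 h2 => infer_instance
  | equiv M N s e _ h => exact Module.Finite.equiv e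

theorem projective_of_bijective_comp {X P : Type u} [AddCommGroup X] [Module R X]
    [AddCommGroup P] [Module R P] [Module.Projective R P] (a : X →ₗ[R] P) (b : P →ₗ[R] X)
    (h : Function.Bijective (b ∘ₗ a)) : Module.Projective R X := by
  let e := LinearEquiv.ofBijective (b ∘ₗ a) h
  refine Module.Projective.of_split (a ∘ₗ e.symm.toLinearMap) b ?_
  ext x
  exact e.apply_symm_apply x

/-- An indecomposable summand of a module of stable type `s` is projective or one of the `S j`
that occur in `s`. -/
theorem projective_or_equiv [IsArtinianRing R] [∀ j, IsSimpleModule R (S j)]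
    {X : Type u} [AddCommGroup X] [Module R X] [Module.Finite R X]
    (hX : IsIndecomposableModule R X) {M : Type u} [AddCommGroup M] [Module R M] {s : ι → ℕ}
    (h : StableType (R := R) S M s) (a : X →ₗ[R] M) (b : M →ₗ[R] X)
    (hab : Function.Bijective (b ∘ₗ a)) :
    Module.Projective R X ∨ ∃ j, 0 < s j ∧ Nonempty (X ≃ₗ[R] S j) := by
  induction h with
  | projective M => exact Or.inl (projective_of_bijective_comp a b hab)
  | simple j =>
    refine Or.inr ⟨j, by simp, ?_⟩
    have ha : Function.Injective a := Function.Injective.of_comp hab.1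
    have : Nontrivial X := hX.1
    refine ⟨LinearEquiv.ofBijective a ⟨ha, ?_⟩⟩
    refine (LinearMap.surjective_or_eq_zero a).resolve_right ?_
    rintro rfl
    obtain ⟨x, y, hxy⟩ := exists_pair_ne X
    exact hxy (ha rfl)
  | prod M N s t _ _ hM hN =>
    -- The isomorphism `b ∘ₗ a` is a sum of an endomorphism through `M` and one through `N`.
    -- Locality makes one of them bijective, so `X` is already a retract of that factor.
    have hsum : b ∘ₗ a = (b ∘ₗ LinearMap.inl R M N) ∘ₗ (LinearMap.fst R M N ∘ₗ a)
        + (b ∘ₗ LinearMap.inr R M N) ∘ₗ (LinearMap.snd R M N ∘ₗ a) := by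
      ext x
      simp [← map_add]
    rw [hsum] at hab
    rcases hX.bijective_or_bijective_of_add _ _ hab with h | h
    · refine (hM _ _ h).imp_right ?_
      rintro ⟨j, hj, e⟩
      exact ⟨j, by simp; omega, e⟩
    · refine (hN _ _ h).imp_right ?_
      rintro ⟨j, hj, e⟩
      exact ⟨j, by simp; omega, e⟩
  | equiv M N s e _ ih =>
    refine ih (e.symm.toLinearMap ∘ₗ a) (b ∘ₗ e.toLinearMap) ?_
    convert hab using 2
    ext x
    simp

theorem isIndecomposable_of_isSimple (X : Type u) [AddCommGroup X] [Module R X]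
    [IsSimpleModule R X] : IsIndecomposableModule R X := by
  refine ⟨IsSimpleModule.nontrivial R X, fun N₁ N₂ h => ?_⟩
  rcases eq_bot_or_eq_top N₁ with h1 | h1
  · exact Or.inl h1
  · right
    have := h.inf_eq_bot
    rwa [h1, top_inf_eq] at this

/-- The class of modules that have a stable type is closed under direct summands. -/
theorem exists_of_summand [IsArtinianRing R] [∀ j, IsSimpleModule R (S j)]
    {M : Type u} [AddCommGroup M] [Module R M] {s : ι → ℕ} (h : StableType (R := R) S M s)
    {X : Type u} [AddCommGroup X] [Module R X] (a : X →ₗ[R] M) (b : M →ₗ[R] X)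
    (hab : b ∘ₗ a = LinearMap.id) : ∃ t, StableType (R := R) S X t := by
  have hfin : Module.Finite R M := h.module_finite
  have hbs : Function.Surjective b := fun x => ⟨a x, by
    simpa using LinearMap.congr_fun hab x⟩
  have hXfin : Module.Finite R X := Module.Finite.of_surjective b hbs
  obtain ⟨n, hn⟩ : ∃ n : ℕ, Module.length R X = n :=
    ⟨_, (ENat.natCast_toNat (Module.length_ne_top (R := R) (M := X))).symm⟩
  -- A decomposable `X` splits into two nonzero parts of smaller length, each again a retract of
  -- `M`.
  induction n using Nat.strong_induction_on generalizing X with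
  | _ n ih =>
  by_cases hX : IsIndecomposableModule R X
  · have hbij : Function.Bijective (b ∘ₗ a) := by rw [hab]; exact Function.bijective_id
    rcases h.projective_or_equiv hX a b hbij with hp | ⟨j, -, ⟨e⟩⟩
    · exact ⟨0, .projective X⟩
    · exact ⟨_, .equiv _ _ _ e.symm (.simple j)⟩
  · by_cases hnt : Nontrivial X
    · obtain ⟨N₁, N₂, hN, h1, h2⟩ : ∃ N₁ N₂ : Submodule R X, IsCompl N₁ N₂ ∧ N₁ ≠ ⊥ ∧ N₂ ≠ ⊥ := by
        by_contra hcon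
        apply hX
        refine ⟨hnt, fun N₁ N₂ hN => ?_⟩
        by_contra h3
        push Not at h3
        exact hcon ⟨N₁, N₂, hN, h3⟩
      let e := Submodule.prodEquivOfIsCompl N₁ N₂ hN
      have hl : Module.length R N₁ + Module.length R N₂ = n := by
        rw [← Module.length_prod, e.length_eq, hn]
      have hp1 : 0 < Module.length R N₁ := by
        have : Nontrivial N₁ := Submodule.nontrivial_iff_ne_bot.mpr h1
        exact Module.length_pos
      have hp2 : 0 < Module.length R N₂ := by
        have : Nontrivial N₂ := Submodule.nontrivial_iff_ne_bot.mpr h2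
        exact Module.length_pos
      obtain ⟨m₁, hm₁⟩ : ∃ n : ℕ, Module.length R N₁ = n :=
        ⟨_, (ENat.natCast_toNat (Module.length_ne_top (R := R) (M := N₁))).symm⟩
      obtain ⟨m₂, hm₂⟩ : ∃ n : ℕ, Module.length R N₂ = n :=
        ⟨_, (ENat.natCast_toNat (Module.length_ne_top (R := R) (M := N₂))).symm⟩
      rw [hm₁, hm₂] at hl
      rw [hm₁] at hp1
      rw [hm₂] at hp2
      norm_cast at hl hp1 hp2
      have hba : ∀ x, b (a x) = x := fun x => by simpa using LinearMap.congr_fun hab x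
      obtain ⟨t₁, ht₁⟩ := ih m₁ (by omega) (a ∘ₗ e.toLinearMap ∘ₗ LinearMap.inl R N₁ N₂)
        (LinearMap.fst R N₁ N₂ ∘ₗ e.symm.toLinearMap ∘ₗ b)
        (by ext x; simp [hba])
        (fun x => ⟨a (e (x, 0)), by simp [hba]⟩) inferInstance hm₁
      obtain ⟨t₂, ht₂⟩ := ih m₂ (by omega) (a ∘ₗ e.toLinearMap ∘ₗ LinearMap.inr R N₁ N₂)
        (LinearMap.snd R N₁ N₂ ∘ₗ e.symm.toLinearMap ∘ₗ b)
        (by ext x; simp [hba])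
        (fun x => ⟨a (e (0, x)), by simp [hba]⟩) inferInstance hm₂
      exact ⟨t₁ + t₂, .equiv _ _ _ e (.prod _ _ _ _ ht₁ ht₂)⟩
    · have : Subsingleton X := not_nontrivial_iff_subsingleton.mp hnt
      exact ⟨0, .projective X⟩

/-- Composites `S j → M → S j` factor, uniformly, through a module of length at most `s j`. -/
theorem exists_factorization [∀ j, IsSimpleModule R (S j)]
    (hproj : ∀ j, ¬ Module.Projective R (S j))
    (hS : ∀ i j, Nonempty (S i ≃ₗ[R] S j) → i = j)
    {M : Type u} [AddCommGroup M] [Module R M] {s : ι → ℕ} (h : StableType (R := R) S M s)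
    (j : ι) :
    ∃ (T : Type u) (_ : AddCommGroup T) (_ : Module R T) (A : M →ₗ[R] T) (B : T →ₗ[R] M),
      Module.length R T ≤ s j ∧
      ∀ (f : S j →ₗ[R] M) (g : M →ₗ[R] S j), g ∘ₗ f = g ∘ₗ B ∘ₗ A ∘ₗ f := by
  induction h with
  | projective M =>
    refine ⟨PUnit.{u + 1}, inferInstance, inferInstance, 0, 0, by simp, fun f g => ?_⟩
    -- By Schur's lemma `g ∘ₗ f` is zero or bijective. In the second case `S j` would be a retract
    -- of a projective module, so the zero module serves as `T`.
    rcases LinearMap.bijective_or_eq_zero (g ∘ₗ f) with hb | hb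
    · exact absurd (projective_of_bijective_comp f g hb) (hproj j)
    · simp [hb]
  | simple l =>
    by_cases hl : l = j
    · subst hl
      exact ⟨S l, inferInstance, inferInstance, LinearMap.id, LinearMap.id, by simp,
        fun f g => rfl⟩
    · refine ⟨PUnit.{u + 1}, inferInstance, inferInstance, 0, 0, by simp, fun f g => ?_⟩
      rcases LinearMap.bijective_or_eq_zero f with hb | hb
      · exact absurd (hS _ _ ⟨LinearEquiv.ofBijective f hb⟩) (Ne.symm hl)
      · simp [hb]
  | prod M N s t _ _ hM hN =>
    obtain ⟨T₁, _, _, A₁, B₁, hl₁, h₁⟩ := hM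
    obtain ⟨T₂, _, _, A₂, B₂, hl₂, h₂⟩ := hN
    refine ⟨T₁ × T₂, inferInstance, inferInstance, A₁.prodMap A₂, B₁.prodMap B₂, ?_, ?_⟩
    · rw [Module.length_prod]
      simpa using add_le_add hl₁ hl₂
    · intro f g
      have e1 := h₁ (LinearMap.fst R M N ∘ₗ f) (g ∘ₗ LinearMap.inl R M N)
      have e2 := h₂ (LinearMap.snd R M N ∘ₗ f) (g ∘ₗ LinearMap.inr R M N)
      ext x
      have e1 := LinearMap.congr_fun e1 x
      have e2 := LinearMap.congr_fun e2 x
      simp only [LinearMap.comp_apply, LinearMap.fst_apply, LinearMap.snd_apply,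
        LinearMap.inl_apply, LinearMap.inr_apply, LinearMap.prodMap_apply] at e1 e2 ⊢
      have hsplit : ∀ (y : M) (z : N), g (y, z) = g (y, 0) + g (0, z) := fun y z => by
        rw [← map_add]; simp
      rw [hsplit, e1, e2, ← hsplit]
  | equiv M N s e _ ih =>
    obtain ⟨T, _, _, A, B, hl, h⟩ := ih
    refine ⟨T, inferInstance, inferInstance, A ∘ₗ e.symm.toLinearMap, e.toLinearMap ∘ₗ B, hl,
      fun f g => ?_⟩
    have := h (e.symm.toLinearMap ∘ₗ f) (g ∘ₗ e.toLinearMap)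
    ext x
    simpa using LinearMap.congr_fun this x

/-- The matrix entries of the identity of `S j ^ m` are composites `S j → M → S j`, so the identity
factors through a module of length at most `s j`. As `S j ^ m` has length `m`, the bound follows.
This is the uniqueness half of Krull–Schmidt that is needed. -/
theorem le_of_summand [∀ j, IsSimpleModule R (S j)]
    (hproj : ∀ j, ¬ Module.Projective R (S j))
    (hS : ∀ i j, Nonempty (S i ≃ₗ[R] S j) → i = j)
    {M : Type u} [AddCommGroup M] [Module R M] {s : ι → ℕ} (h : StableType (R := R) S M s)
    (j : ι) {m : ℕ} {W : Type u} [AddCommGroup W] [Module R W]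
    (e : M ≃ₗ[R] (Fin m → S j) × W) : m ≤ s j := by
  obtain ⟨T, _, _, A, B, hl, h⟩ := h.exists_factorization hproj hS j
  let a : (Fin m → S j) →ₗ[R] M := e.symm.toLinearMap ∘ₗ LinearMap.inl R _ _
  let b : M →ₗ[R] (Fin m → S j) := LinearMap.fst R _ _ ∘ₗ e.toLinearMap
  have hba : ∀ x, b (a x) = x := fun x => by simp [a, b]
  have hfac : ∀ x, b (B (A (a x))) = x := by
    intro x
    have hx : x = ∑ q, Pi.single q (x q) := (Finset.univ_sum_single x).symm
    have h2 : ∀ q, b (B (A (a (Pi.single q (x q))))) = Pi.single q (x q) := by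
      intro q
      conv_rhs => rw [← hba (Pi.single q (x q))]
      ext r
      have := LinearMap.congr_fun (h (a ∘ₗ LinearMap.single R (fun _ => S j) q)
        (LinearMap.proj r ∘ₗ b)) (x q)
      simpa using this.symm
    rw [hx]
    simp only [map_sum, h2]
  have hinj : Function.Injective (A ∘ₗ a) := by
    intro x y hxy
    have hxy' : A (a x) = A (a y) := hxy
    rw [← hfac x, ← hfac y, hxy']
  have h3 := Module.length_le_of_injective (A ∘ₗ a) hinj
  rw [Module.length_pi_of_fintype] at h3
  simp only [Module.length_eq_one, Finset.sum_const, Finset.card_univ, Fintype.card_fin,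
    nsmul_eq_mul, mul_one] at h3
  exact_mod_cast h3.trans hl

/-- Shows that the bound of `le_of_summand` is attained, so that `s j` is the multiplicity of `S j`.
-/
theorem exists_equiv {M : Type u} [AddCommGroup M] [Module R M] {s : ι → ℕ}
    (h : StableType (R := R) S M s) (j : ι) :
    ∃ (W : Type u) (_ : AddCommGroup W) (_ : Module R W),
      Nonempty (M ≃ₗ[R] (Fin (s j) → S j) × W) := by
  have triv : ∀ (M : Type u) [AddCommGroup M] [Module R M],
      Nonempty (M ≃ₗ[R] (Fin 0 → S j) × M) := fun M _ _ =>
    ⟨(LinearEquiv.uniqueProd (R := R) (M := M) (M₂ := Fin 0 → S j)).symm⟩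
  induction h with
  | projective M => exact ⟨M, inferInstance, inferInstance, triv M⟩
  | simple l =>
    by_cases hl : j = l
    · subst hl
      refine ⟨PUnit.{u + 1}, inferInstance, inferInstance, ?_⟩
      rw [Pi.single_eq_same]
      exact ⟨((LinearEquiv.funUnique (Fin 1) R (S j)).symm).trans
        (LinearEquiv.prodUnique (R := R) (M := Fin 1 → S j) (M₂ := PUnit.{u + 1})).symm⟩
    · refine ⟨S l, inferInstance, inferInstance, ?_⟩
      rw [Pi.single_eq_of_ne hl]
      exact triv (S l)
  | prod M N s t _ _ hM hN =>
    obtain ⟨W₁, _, _, ⟨e₁⟩⟩ := hM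
    obtain ⟨W₂, _, _, ⟨e₂⟩⟩ := hN
    refine ⟨W₁ × W₂, inferInstance, inferInstance, ⟨?_⟩⟩
    refine ((e₁.prodCongr e₂).trans (LinearEquiv.prodProdProdComm R _ _ _ _)).trans
      (LinearEquiv.prodCongr (M := (Fin (s j) → S j) × (Fin (t j) → S j)) ?_
        (LinearEquiv.refl R _))
    exact (LinearEquiv.sumArrowLequivProdArrow (Fin (s j)) (Fin (t j)) R (S j)).symm.trans
      (LinearEquiv.funCongrLeft R (S j) finSumFinEquiv.symm)
  | equiv M N s e _ ih =>
    obtain ⟨W, _, _, ⟨e'⟩⟩ := ih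
    exact ⟨W, inferInstance, inferInstance, ⟨e.symm.trans e'⟩⟩

end StableType

end StableType

/-! ### Representations and modules over the group algebra -/

section Rep

open scoped TensorProduct

variable {k : Type u} [Field k] {G : Type} [Group G]
variable {V W U : Type u} [AddCommGroup V] [Module k V] [AddCommGroup W] [Module k W]
  [AddCommGroup U] [Module k U]

namespace Representation

/-- An equivalence of representations is an isomorphism of modules over the group algebra. -/
def Equiv.asModuleEquiv {ρ : Representation k G V} {σ : Representation k G W} (e : ρ.Equiv σ) :
    ρ.asModule ≃ₗ[MonoidAlgebra k G] σ.asModule :=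
  LinearEquiv.ofBijective (IntertwiningMap.equivLinearMapAsModule ρ σ e.toIntertwiningMap)
    e.toLinearEquiv.bijective

/-- An isomorphism of modules over the group algebra is an equivalence of representations. -/
def equivOfAsModuleEquiv {ρ : Representation k G V} {σ : Representation k G W}
    (e : ρ.asModule ≃ₗ[MonoidAlgebra k G] σ.asModule) : ρ.Equiv σ :=
  IntertwiningMap.ofBijective
    ((IntertwiningMap.equivLinearMapAsModule ρ σ).symm e.toLinearMap) e.bijective

/-- The module of a direct sum of representations. -/
def prodAsModuleEquiv (ρ : Representation k G V) (σ : Representation k G W) :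
    (ρ.prod σ).asModule ≃ₗ[MonoidAlgebra k G] ρ.asModule × σ.asModule :=
  LinearEquiv.ofBijective
    ((IntertwiningMap.equivLinearMapAsModule _ _ (IntertwiningMap.fst k ρ σ)).prod
      (IntertwiningMap.equivLinearMapAsModule _ _ (IntertwiningMap.snd k ρ σ)))
    Function.bijective_id

/-- Stable types are built from modules over the group algebra, whereas tensor products are formed
from representations. This is the passage back from the former to the latter. -/
theorem exists_asModule_equiv (M : Type u) [AddCommGroup M] [Module (MonoidAlgebra k G) M] :
    ∃ (V : Type u) (_ : AddCommGroup V) (_ : Module k V) (ρ : Representation k G V),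
      Nonempty (ρ.asModule ≃ₗ[MonoidAlgebra k G] M) := by
  let _ : Module k M := Module.compHom M (algebraMap k (MonoidAlgebra k G))
  have : IsScalarTower k (MonoidAlgebra k G) M := ⟨fun a r m => by
    rw [Algebra.smul_def, mul_smul]
    rfl⟩
  refine ⟨M, inferInstance, inferInstance, ofModule' M, ⟨?_⟩⟩
  refine { (ofModule' (k := k) (G := G) M).asModuleEquiv with map_smul' := fun r m => ?_ }
  change (ofModule' (k := k) (G := G) M).asAlgebraHom r
    ((ofModule' (k := k) (G := G) M).asModuleEquiv m)
      = r • (ofModule' (k := k) (G := G) M).asModuleEquiv m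
  rw [asAlgebraHom_def, ofModule', _root_.Equiv.apply_symm_apply]
  rfl

/-- Tensoring equivalences with a fixed representation. -/
def Equiv.tprodCongr {ρ : Representation k G V} {σ : Representation k G W} (e : ρ.Equiv σ)
    (τ : Representation k G U) : (ρ.tprod τ).Equiv (σ.tprod τ) :=
  Equiv.mk (TensorProduct.congr e.toLinearEquiv (LinearEquiv.refl k U)) fun g => by
    ext x y
    have := LinearMap.congr_fun (e.isIntertwining' g) x
    simp only [LinearMap.comp_apply] at this
    simp at this ⊢
    rw [this]

/-- The tensor product distributes over direct sums. -/
def prodTprodEquiv (ρ : Representation k G V) (σ : Representation k G W)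
    (τ : Representation k G U) :
    ((ρ.prod σ).tprod τ).Equiv ((ρ.tprod τ).prod (σ.tprod τ)) :=
  Equiv.mk (TensorProduct.prodLeft k k V W U) fun g => by
    ext x y <;> simp

variable [Fintype G]

/-- The identity of `V` is a trace from the trivial subgroup. -/
def HasTraceOne (ρ : Representation k G V) : Prop :=
  ∃ θ : V →ₗ[k] V, ∀ v, ∑ g, ρ g (θ (ρ g⁻¹ v)) = v

/-- Since ρ ⊗ σ is diagonal, the trace of θ ⊗ id is the trace of θ tensored with id. Thus projective
⊗ anything is projective. -/
theorem HasTraceOne.tprod {ρ : Representation k G V} (h : ρ.HasTraceOne)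
    (σ : Representation k G W) : (ρ.tprod σ).HasTraceOne := by
  obtain ⟨θ, hθ⟩ := h
  refine ⟨TensorProduct.map θ LinearMap.id, fun v => ?_⟩
  induction v using TensorProduct.induction_on with
  | zero => simp
  | add x y hx hy =>
    simp only [map_add, Finset.sum_add_distrib, hx, hy]
  | tmul x y =>
    simp only [tprod_apply, TensorProduct.map_tmul, LinearMap.id_apply, self_inv_apply]
    rw [← TensorProduct.sum_tmul, hθ]

/-- One direction of Higman's criterion. A free cover `q` has a `k`-linear section `s`; the trace of
`s ∘ θ` is equivariant, and it is again a section because `q` commutes with the group and θ has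
trace the identity. -/
theorem HasTraceOne.projective {ρ : Representation k G V} (h : ρ.HasTraceOne) :
    Module.Projective (MonoidAlgebra k G) ρ.asModule := by
  obtain ⟨θ, hθ⟩ := h
  let F := ρ.asModule →₀ MonoidAlgebra k G
  let q : F →ₗ[MonoidAlgebra k G] ρ.asModule := Finsupp.linearCombination _ id
  have hq : Function.Surjective q := Finsupp.linearCombination_id_surjective _ _
  obtain ⟨s, hs⟩ := (q.restrictScalars k).exists_rightInverse_of_surjective
    (LinearMap.range_eq_top.mpr hq)
  let θ' : ρ.asModule →ₗ[k] ρ.asModule := θ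
  refine Module.Projective.of_split ((s ∘ₗ θ').sumOfConjugatesEquivariant G) q ?_
  ext v
  rw [LinearMap.comp_apply, LinearMap.sumOfConjugatesEquivariant_apply, map_sum]
  have hs' : ∀ x, q (s x) = x := fun x => LinearMap.congr_fun hs x
  simp only [LinearMap.conjugate_apply, map_smul, LinearMap.comp_apply, hs']
  rw [← Equiv.sum_comp (Equiv.inv G)]
  simp only [_root_.Equiv.inv_apply, inv_inv, single_smul, one_smul]
  exact hθ v

/-- The other direction. On a free module, keeping only the coefficient at `1` of each coordinate is
a linear map with trace the identity; an equivariant splitting carries it over to the summand. -/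
theorem hasTraceOne_of_projective (ρ : Representation k G V)
    [Module.Projective (MonoidAlgebra k G) ρ.asModule] : ρ.HasTraceOne := by
  classical
  obtain ⟨s, hs⟩ := Module.projective_def'.mp
    (inferInstance : Module.Projective (MonoidAlgebra k G) ρ.asModule)
  let τ : MonoidAlgebra k G →ₗ[k] MonoidAlgebra k G :=
    { toFun := fun x => MonoidAlgebra.single 1 (x.coeff 1)
      map_add' := fun x y => by simp
      map_smul' := fun r x => by simp }
  let T : (ρ.asModule →₀ MonoidAlgebra k G) →ₗ[k] (ρ.asModule →₀ MonoidAlgebra k G) :=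
    Finsupp.mapRange.linearMap τ
  let q : (ρ.asModule →₀ MonoidAlgebra k G) →ₗ[MonoidAlgebra k G] ρ.asModule :=
    Finsupp.linearCombination _ id
  have hT : ∀ x, ∑ g : G, MonoidAlgebra.single g (1 : k) •
      T (MonoidAlgebra.single g⁻¹ (1 : k) • x) = x := by
    intro x
    ext v h
    have hτ : ∀ y : MonoidAlgebra k G, τ y = MonoidAlgebra.single 1 (y.coeff 1) := fun y => rfl
    have hl : ∀ g, (MonoidAlgebra.single g (1 : k) •
        T (MonoidAlgebra.single g⁻¹ (1 : k) • x)) v = MonoidAlgebra.single g ((x v).coeff g) := by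
      intro g
      simp [T, hτ, MonoidAlgebra.single_mul_single]
    rw [Finsupp.finsetSum_apply, Finset.sum_congr rfl fun g _ => hl g,
      MonoidAlgebra.coeff_sum, Finsupp.finsetSum_apply]
    simp [Finsupp.single_apply]
  have hq : ∀ v, q (s v) = v := fun v => LinearMap.congr_fun hs v
  let θ' : ρ.asModule →ₗ[k] ρ.asModule := (q.restrictScalars k) ∘ₗ T ∘ₗ (s.restrictScalars k)
  refine ⟨θ', fun v => ?_⟩
  let v' : ρ.asModule := v
  have h1 := congrArg q (hT (s v'))
  rw [map_sum] at h1
  refine Eq.trans ?_ (h1.trans (hq v'))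
  refine Finset.sum_congr rfl fun g _ => ?_
  have h2 : MonoidAlgebra.single g⁻¹ (1 : k) • v' = ρ g⁻¹ v :=
    (single_smul ρ _ _ _).trans (one_smul _ _)
  rw [map_smul, ← map_smul s, h2]
  exact ((single_smul ρ _ _ _).trans (one_smul _ _)).symm

/-- A representation on which the norm of a subgroup vanishes, while the subgroup has a nonzero
fixed vector, is not projective. -/
theorem not_hasTraceOne (ρ : Representation k G V) (H : Subgroup G) [Fintype H] {v : V}
    (hv : v ≠ 0) (hfix : ∀ h : H, ρ (h : G) v = v) (hN : ∀ x, ∑ h : H, ρ (h : G) x = 0) :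
    ¬ ρ.HasTraceOne := by
  classical
  rintro ⟨θ, hθ⟩
  apply hv
  -- Every group element is uniquely a coset representative times an element of `H`. As `H` fixes
  -- `v`, the sum over `g⁻¹ θ g` groups into norms of `H`, all zero, so `v = 0`.
  have hbij : Function.Bijective
      (fun x : (G ⧸ H) × H => x.1.out * (x.2 : G)) := by
    constructor
    · rintro ⟨q, h⟩ ⟨q', h'⟩ hqq
      have hq : q = q' := by
        have := congrArg (QuotientGroup.mk (s := H)) hqq
        simpa using this
      subst hq
      exact congrArg (Prod.mk q) (Subtype.ext (mul_left_cancel hqq))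
    · intro g
      refine ⟨(g, ⟨(g : G ⧸ H).out⁻¹ * g, ?_⟩), by simp⟩
      rw [← QuotientGroup.eq]
      simp
  rw [← hθ v, ← Equiv.sum_comp (Equiv.inv G), ← hbij.sum_comp, Fintype.sum_prod_type]
  refine Finset.sum_eq_zero fun q _ => ?_
  simp only [_root_.Equiv.inv_apply, mul_inv_rev, inv_inv, map_mul, Module.End.mul_apply, hfix]
  have := hN (ρ q.out⁻¹ (θ (ρ q.out v)))
  rw [← Equiv.sum_comp (Equiv.inv _)] at this
  simpa using this

end Representation

end Rep

/-! ### The modules `V_n` -/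

section VModules

variable {k : Type u} [Field k]

/-- The monomials `X ^ (d - i) Y ^ i` span the homogeneous polynomials of degree `d`. -/
theorem homogeneous_eq_sum {d : ℕ} {f : MvPolynomial (Fin 2) k} (hf : f.IsHomogeneous d) :
    f = ∑ i ∈ Finset.range (d + 1),
      coeff (Finsupp.single 0 (d - i) + Finsupp.single 1 i) f •
        (X 0 ^ (d - i) * X 1 ^ i : MvPolynomial (Fin 2) k) := by
  have hmon : ∀ a b : ℕ, (X 0 ^ a * X 1 ^ b : MvPolynomial (Fin 2) k)
      = monomial (Finsupp.single 0 a + Finsupp.single 1 b) 1 := by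
    intro a b
    rw [X_pow_eq_monomial, X_pow_eq_monomial, monomial_mul, mul_one]
  have hm : ∀ m : Fin 2 →₀ ℕ, m = Finsupp.single 0 (m 0) + Finsupp.single 1 (m 1) := by
    intro m
    ext i
    fin_cases i <;> simp
  ext m
  rw [coeff_sum]
  simp only [coeff_smul, hmon, coeff_monomial, smul_eq_mul, mul_ite, mul_one, mul_zero]
  by_cases hd : m 0 + m 1 = d
  · rw [Finset.sum_eq_single_of_mem (m 1) (by simp; omega)]
    · have : Finsupp.single 0 (d - m 1) + Finsupp.single 1 (m 1) = m := by
        conv_rhs => rw [hm m]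
        congr 2
        omega
      rw [this, if_pos rfl]
    · intro i hi hne
      rw [if_neg]
      rintro rfl
      simp at hne
  · have h0 : coeff m f = 0 := by
      apply hf.coeff_eq_zero
      rw [Finsupp.degree_eq_sum]
      simpa using hd
    rw [h0, Finset.sum_eq_zero]
    intro i hi
    rw [if_neg]
    rintro rfl
    apply hd
    simp at hi ⊢
    omega

theorem isHomogeneous_mono {d i : ℕ} (hi : i ≤ d) :
    (X 0 ^ (d - i) * X 1 ^ i : MvPolynomial (Fin 2) k).IsHomogeneous d := by
  have := (isHomogeneous_X_pow (R := k) (0 : Fin 2) (d - i)).mul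
    (isHomogeneous_X_pow (R := k) (1 : Fin 2) i)
  rwa [Nat.sub_add_cancel hi] at this

/-- The basis of the homogeneous polynomials of degree `d` given by the monomials. -/
def homogeneousCoeffEquiv (k : Type u) [Field k] (d : ℕ) :
    homogeneousSubmodule (Fin 2) k d ≃ₗ[k] (Fin (d + 1) → k) :=
  LinearEquiv.ofBijective
    (LinearMap.pi fun i : Fin (d + 1) =>
      (lcoeff k (Finsupp.single 0 (d - (i : ℕ)) + Finsupp.single 1 (i : ℕ))) ∘ₗ
        (homogeneousSubmodule (Fin 2) k d).subtype) (by
    constructor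
    · rw [injective_iff_map_eq_zero]
      intro f hf
      apply Subtype.ext
      rw [homogeneous_eq_sum ((mem_homogeneousSubmodule _ _).mp f.2)]
      refine Finset.sum_eq_zero fun i hi => ?_
      have := congrFun hf ⟨i, Finset.mem_range.mp hi⟩
      simp only [LinearMap.pi_apply, LinearMap.comp_apply, lcoeff_apply,
        Submodule.subtype_apply, Pi.zero_apply] at this
      rw [this, zero_smul]
    · intro c
      refine ⟨⟨∑ i : Fin (d + 1), c i • (X 0 ^ (d - (i : ℕ)) * X 1 ^ (i : ℕ)), ?_⟩, ?_⟩
      · exact Submodule.sum_mem _ fun i _ => Submodule.smul_mem _ _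
          ((mem_homogeneousSubmodule _ _).mpr (isHomogeneous_mono (by omega)))
      · ext j
        simp only [LinearMap.pi_apply, LinearMap.comp_apply, lcoeff_apply,
          Submodule.subtype_apply, coeff_sum, coeff_smul, smul_eq_mul]
        rw [Finset.sum_eq_single j]
        · rw [X_pow_eq_monomial, X_pow_eq_monomial, monomial_mul, mul_one, coeff_monomial,
            if_pos rfl, mul_one]
        · intro i _ hij
          rw [X_pow_eq_monomial, X_pow_eq_monomial, monomial_mul, mul_one, coeff_monomial,
            if_neg, mul_zero]
          intro h
          apply hij
          have := DFunLike.congr_fun h 1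
          simp at this
          exact Fin.ext this
        · simp)

instance homogeneousSubmodule_finite (d : ℕ) :
    Module.Finite k (homogeneousSubmodule (Fin 2) k d) :=
  Module.Finite.equiv (homogeneousCoeffEquiv k d).symm

theorem finrank_homogeneousSubmodule (d : ℕ) :
    Module.finrank k (homogeneousSubmodule (Fin 2) k d) = d + 1 := by
  rw [(homogeneousCoeffEquiv k d).finrank_eq, Module.finrank_fin_fun]

variable {p : ℕ} [Fact p.Prime] [CharP k p]

/-- The upper unitriangular matrices. -/
def upperUni (p : ℕ) : Multiplicative (ZMod p) →* SL2 p where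
  toFun b := ⟨!![1, b.toAdd; 0, 1], by simp [Matrix.det_fin_two]⟩
  map_one' := by
    apply Subtype.ext
    ext i j
    fin_cases i <;> fin_cases j <;> simp
  map_mul' a b := by
    apply Subtype.ext
    ext i j
    change (!![1, a.toAdd + b.toAdd; 0, 1] : Matrix (Fin 2) (Fin 2) (ZMod p)) i j =
      (!![1, a.toAdd; 0, 1] * !![1, b.toAdd; 0, 1] : Matrix (Fin 2) (Fin 2) (ZMod p)) i j
    fin_cases i <;> fin_cases j <;> simp [Matrix.mul_apply, Fin.sum_univ_two, add_comm]

/-- The lower unitriangular matrices. -/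
def lowerUni (c : ZMod p) : SL2 p := ⟨!![1, 0; c, 1], by simp [Matrix.det_fin_two]⟩

theorem coe_upperUni (b : Multiplicative (ZMod p)) :
    (upperUni p b : Matrix (Fin 2) (Fin 2) (ZMod p)) = !![1, b.toAdd; 0, 1] := rfl

theorem linSubst_upperUni (b : Multiplicative (ZMod p)) (i j : ℕ) :
    linSubst k p (upperUni p b) (X 0 ^ i * X 1 ^ j) =
      X 0 ^ i * (C (ZMod.castHom (dvd_refl p) k b.toAdd) * X 0 + X 1) ^ j := by
  simp [linSubst, coe_upperUni]

theorem linSubst_lowerUni (c : ZMod p) (i : ℕ) :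
    linSubst k p (lowerUni c) (X 0 ^ i) =
      (X 0 + C (ZMod.castHom (dvd_refl p) k c) * X 1) ^ i := by
  simp [linSubst, lowerUni]

/-- If a subspace contains all values at `𝔽_p` of a vector-valued polynomial of degree less
than `p`, then it contains its coefficients. -/
theorem coeff_mem_of_forall_eval_mem {V : Type u} [AddCommGroup V] [Module k V]
    (W : Submodule k V) {d : ℕ} (hd : d < p) (w : ℕ → V)
    (h : ∀ b : ZMod p, ∑ m ∈ Finset.range (d + 1),
      (ZMod.castHom (dvd_refl p) k b) ^ m • w m ∈ W) {m : ℕ} (hm : m ≤ d) : w m ∈ W := by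
  by_contra hw
  obtain ⟨φ, hφ, hW⟩ := Submodule.exists_le_ker_of_notMem hw
  -- If `w m` were outside `W`, a functional φ vanishing on `W` would detect it. Applied to the
  -- given values, φ yields a polynomial of degree less than `p` with `p` roots.
  let P : Polynomial k := ∑ l ∈ Finset.range (d + 1), Polynomial.C (φ (w l)) * Polynomial.X ^ l
  have hP : P = 0 := by
    refine Polynomial.eq_zero_of_degree_lt_of_eval_index_eq_zero (s := Finset.univ)
      (v := fun b : ZMod p => ZMod.castHom (dvd_refl p) k b) ?_ ?_ ?_
    · exact fun a _ b _ hab => (ZMod.castHom (dvd_refl p) k).injective hab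
    · rw [Finset.card_univ, ZMod.card]
      refine lt_of_le_of_lt (Polynomial.degree_sum_le _ _) ?_
      rw [Finset.sup_lt_iff (by exact_mod_cast WithBot.bot_lt_coe p)]
      intro l hl
      refine lt_of_le_of_lt (Polynomial.degree_C_mul_X_pow_le _ _) ?_
      have := Finset.mem_range.mp hl
      exact_mod_cast (by omega : l < p)
    · intro b _
      have := hW (h b)
      rw [LinearMap.mem_ker, map_sum] at this
      simp only [map_smul, smul_eq_mul] at this
      rw [Polynomial.eval_finsetSum, ← this]
      exact Finset.sum_congr rfl fun l _ => by
        rw [Polynomial.eval_mul, Polynomial.eval_C, Polynomial.eval_pow, Polynomial.eval_X, mul_comm]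
  apply hφ
  have hc := congrArg (fun Q : Polynomial k => Q.coeff m) hP
  simp only [P, Polynomial.finsetSum_coeff, Polynomial.coeff_C_mul_X_pow,
    Polynomial.coeff_zero] at hc
  rw [Finset.sum_eq_single_of_mem m (by simp; omega)] at hc
  · simpa using hc
  · intro l _ hl
    rw [if_neg (Ne.symm hl)]

/-- The action of an upper unitriangular matrix, expanded in powers of its entry. -/
theorem linSubst_upperUni_eq_sum {d : ℕ} {f : MvPolynomial (Fin 2) k} (hf : f.IsHomogeneous d)
    (b : Multiplicative (ZMod p)) :
    linSubst k p (upperUni p b) f = ∑ m ∈ Finset.range (d + 1),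
      (ZMod.castHom (dvd_refl p) k b.toAdd) ^ m •
        ∑ i ∈ Finset.range (d + 1),
          (coeff (Finsupp.single 0 (d - i) + Finsupp.single 1 i) f * (i.choose m : k)) •
            (X 0 ^ (d - i + m) * X 1 ^ (i - m) : MvPolynomial (Fin 2) k) := by
  conv_lhs => rw [homogeneous_eq_sum hf]
  simp only [map_sum, map_smul, linSubst_upperUni, Finset.smul_sum]
  rw [Finset.sum_comm]
  refine Finset.sum_congr rfl fun i hi => ?_
  have hi' := Finset.mem_range.mp hi
  rw [add_pow, Finset.mul_sum, Finset.smul_sum]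
  rw [← Finset.sum_subset (Finset.range_mono hi')]
  · refine Finset.sum_congr rfl fun m _ => ?_
    simp only [smul_eq_C_mul, map_mul, map_pow, map_natCast, pow_add, mul_pow]
    ring
  · intro m _ hm
    rw [Nat.choose_eq_zero_of_lt (by simpa using hm)]
    simp

/-- An invariant subspace that contains a nonzero homogeneous polynomial of degree `d < p` contains
all of them. -/
theorem homogeneousSubmodule_le_of_invariant (W : Submodule k (MvPolynomial (Fin 2) k))
    (hW : ∀ (g : SL2 p), ∀ f ∈ W, linSubst k p g f ∈ W) {d : ℕ} (hd : d < p)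
    {f : MvPolynomial (Fin 2) k} (hf : f.IsHomogeneous d) (hf0 : f ≠ 0) (hfW : f ∈ W) :
    homogeneousSubmodule (Fin 2) k d ≤ W := by
  classical
  set c : ℕ → k := fun i => coeff (Finsupp.single 0 (d - i) + Finsupp.single 1 i) f with hc
  have hX : (X 0 ^ d : MvPolynomial (Fin 2) k) ∈ W := by
    have hne : ((Finset.range (d + 1)).filter fun i => c i ≠ 0).Nonempty := by
      by_contra hcon
      rw [Finset.not_nonempty_iff_eq_empty, Finset.filter_eq_empty_iff] at hcon
      apply hf0
      rw [homogeneous_eq_sum hf]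
      refine Finset.sum_eq_zero fun i hi => ?_
      have := hcon hi
      rw [not_not] at this
      change c i • _ = 0
      rw [this, zero_smul]
    -- `M` is the highest power of `Y` that occurs. In the coefficient of `b ^ M` the terms with `i
    -- < M` die by `i.choose M = 0`, which leaves a nonzero multiple of `X ^ d`.
    obtain ⟨M, hM, hmax⟩ := Finset.exists_max_image _ id hne
    rw [Finset.mem_filter, Finset.mem_range] at hM
    have hmem := coeff_mem_of_forall_eval_mem W hd
      (fun m => ∑ i ∈ Finset.range (d + 1), (c i * (i.choose m : k)) •
            (X 0 ^ (d - i + m) * X 1 ^ (i - m) : MvPolynomial (Fin 2) k))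
      (fun b => by
        have := hW (upperUni p (Multiplicative.ofAdd b)) f hfW
        rwa [linSubst_upperUni_eq_sum hf] at this) (Nat.lt_succ_iff.mp hM.1)
    rw [Finset.sum_eq_single_of_mem M (by simp; omega)] at hmem
    · rw [Nat.choose_self, Nat.cast_one, mul_one, Nat.sub_self, pow_zero, mul_one,
        Nat.sub_add_cancel (by omega)] at hmem
      exact (Submodule.smul_mem_iff _ hM.2).mp hmem
    · intro i hi hiM
      rcases lt_or_gt_of_ne hiM with h | h
      · rw [Nat.choose_eq_zero_of_lt h]
        simp
      · have : c i = 0 := by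
          by_contra h0
          have := hmax i (Finset.mem_filter.mpr ⟨hi, h0⟩)
          simp at this
          omega
        rw [this, zero_mul, zero_smul]
  intro q hq
  rw [homogeneous_eq_sum ((mem_homogeneousSubmodule _ _).mp hq)]
  refine Submodule.sum_mem _ fun i hi => Submodule.smul_mem _ _ ?_
  -- Conversely the lower unitriangular translates of `X ^ d` yield every monomial, since the
  -- binomial coefficients `d.choose i` are prime to `p` for `d < p`.
  have hid : i ≤ d := by simpa [Nat.lt_succ_iff] using hi
  have hmem := coeff_mem_of_forall_eval_mem W hd
    (fun m => (d.choose m : k) • (X 0 ^ (d - m) * X 1 ^ m : MvPolynomial (Fin 2) k))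
    (fun b => by
      have := hW (lowerUni b) _ hX
      rw [linSubst_lowerUni, add_comm, add_pow] at this
      convert this using 2 with m
      simp only [smul_eq_C_mul, map_pow, map_natCast, mul_pow]
      ring) hid
  refine (Submodule.smul_mem_iff _ ?_).mp hmem
  rw [Ne, CharP.cast_eq_zero_iff k p]
  intro hdvd
  have h1 : p ∣ d.factorial := by
    rw [← Nat.choose_mul_factorial_mul_factorial hid]
    exact (hdvd.mul_right _).mul_right _
  have := (Fact.out : p.Prime).dvd_factorial.mp h1
  omega

end VModules

/-! ### Simplicity and non-projectivity of the modules `V_n` -/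

section VModules

variable {k : Type u} [Field k] {p : ℕ} [CharP k p]

theorem linSubst_X_zero (g : SL2 p) : linSubst k p g (X 0) =
    C (ZMod.castHom (dvd_refl p) k (g 0 0)) * X 0
      + C (ZMod.castHom (dvd_refl p) k (g 1 0)) * X 1 := by
  rw [linSubst, aeval_X]
  rfl

theorem linSubst_X_one (g : SL2 p) : linSubst k p g (X 1) =
    C (ZMod.castHom (dvd_refl p) k (g 0 1)) * X 0
      + C (ZMod.castHom (dvd_refl p) k (g 1 1)) * X 1 := by
  rw [linSubst, aeval_X]
  rfl

theorem VRep_apply_coe (n : ℕ) (g : SL2 p) (f : VSpace k n) :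
    (VRep k p n g f : MvPolynomial (Fin 2) k) = linSubst k p g f := rfl

instance VSpace_finite (n : ℕ) : Module.Finite k (VSpace k n) :=
  homogeneousSubmodule_finite (n - 1)

theorem finrank_VSpace {n : ℕ} (hn : 1 ≤ n) : Module.finrank k (VSpace k n) = n := by
  rw [finrank_homogeneousSubmodule, Nat.sub_add_cancel hn]

instance VSpace_nontrivial (n : ℕ) : Nontrivial (VSpace k n) :=
  Module.nontrivial_of_finrank_pos (R := k) (by rw [finrank_homogeneousSubmodule]; omega)

theorem VMod_equiv_eq {i j : ℕ} (hi : 1 ≤ i) (hj : 1 ≤ j)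
    (e : (VRep k p i).asModule ≃ₗ[SL2Alg k p] (VRep k p j).asModule) : i = j := by
  have := (Representation.equivOfAsModuleEquiv e).toLinearEquiv.finrank_eq
  rwa [finrank_VSpace hi, finrank_VSpace hj] at this

variable [Fact p.Prime]

/-- `V_n` is irreducible for `n ≤ p`. -/
theorem VRep_eq_top_of_invariant {n : ℕ} (hnp : n ≤ p) (W : Submodule k (VSpace k n))
    (hW : ∀ g : SL2 p, ∀ f ∈ W, VRep k p n g f ∈ W) (h0 : W ≠ ⊥) : W = ⊤ := by
  have hp := (Fact.out : p.Prime).pos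
  obtain ⟨f, hf, hf0⟩ := Submodule.exists_mem_ne_zero_of_ne_bot h0
  have hle := homogeneousSubmodule_le_of_invariant (p := p) (W.map (Submodule.subtype _))
    (by
      rintro g _ ⟨q, hq, rfl⟩
      exact ⟨VRep k p n g q, hW g q hq, rfl⟩)
    (by omega : n - 1 < p) ((mem_homogeneousSubmodule _ _).mp f.2)
    (by simpa using hf0) ⟨f, hf, rfl⟩
  rw [eq_top_iff]
  rintro q -
  obtain ⟨q', hq', h⟩ := hle q.2
  rwa [← Subtype.ext h]

theorem VMod_isSimple {n : ℕ} (hnp : n ≤ p) :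
    IsSimpleModule (SL2Alg k p) (VRep k p n).asModule := by
  have : Nontrivial (VRep k p n).asModule := VSpace_nontrivial (k := k) n
  rw [isSimpleModule_iff]
  refine { eq_bot_or_eq_top := fun N => ?_ }
  by_cases hN : N = ⊥
  · exact Or.inl hN
  right
  have htop := VRep_eq_top_of_invariant (p := p) hnp (N.restrictScalars k : Submodule k (VSpace k n))
    (by
      intro g f hf
      have h1 := N.smul_mem (MonoidAlgebra.single g (1 : k)) hf
      have h2 : MonoidAlgebra.single g (1 : k) • (show (VRep k p n).asModule from f) = VRep k p n g f :=
        (Representation.single_smul _ _ _ _).trans (one_smul _ _)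
      exact h2 ▸ h1)
    (fun h => hN ((Submodule.restrictScalars_eq_bot_iff k _ _).mp h))
  exact (Submodule.restrictScalars_eq_top_iff k _ _).mp htop

/-- `V_n` is not projective for `n < p`. -/
theorem VRep_not_hasTraceOne {n : ℕ} (hn : 1 ≤ n) (hnp : n < p) :
    ¬ (VRep k p n).HasTraceOne := by
  classical
  have hinj : Function.Injective (upperUni p) := by
    intro a b hab
    have := congrArg (fun g : SL2 p => (g : Matrix (Fin 2) (Fin 2) (ZMod p)) 0 1) hab
    simpa [coe_upperUni] using this
  let e : Multiplicative (ZMod p) ≃* (upperUni p).range := MonoidHom.ofInjective hinj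
  have he : ∀ b, ((e b : (upperUni p).range) : SL2 p) = upperUni p b := fun b => rfl
  let v : VSpace k n := ⟨X 0 ^ (n - 1), (mem_homogeneousSubmodule _ _).mpr
    (isHomogeneous_X_pow _ _)⟩
  refine Representation.not_hasTraceOne (VRep k p n) (upperUni p).range (v := v) ?_ ?_ ?_
  · intro h
    have := congrArg Subtype.val h
    exact pow_ne_zero _ (X_ne_zero 0) this
  · intro h
    obtain ⟨b, rfl⟩ := e.surjective h
    apply Subtype.ext
    rw [he, VRep_apply_coe]
    have := linSubst_upperUni (k := k) b (n - 1) 0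
    rwa [pow_zero, pow_zero, mul_one] at this
  · intro f
    rw [← e.toEquiv.sum_comp]
    apply Subtype.ext
    simp only [MulEquiv.toEquiv_eq_coe, EquivLike.coe_coe, he]
    rw [AddSubmonoidClass.coe_finsetSum]
    simp only [VRep_apply_coe,
      linSubst_upperUni_eq_sum ((mem_homogeneousSubmodule _ _).mp f.2)]
    rw [Finset.sum_comm]
    refine Finset.sum_eq_zero fun m hm => ?_
    rw [← Finset.sum_smul]
    -- The norm of the unipotent subgroup involves only power sums of exponent `m ≤ n - 1 ≤ p - 2`
    -- over 𝔽_p, and these vanish. At `n = p` the exponent `p - 1` would occur, whose power sum is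
    -- `-1`.
    have hlt : m < Fintype.card (ZMod p) - 1 := by
      rw [ZMod.card]
      have := Finset.mem_range.mp hm
      omega
    have hs := FiniteField.sum_pow_lt_card_sub_one (ZMod p) m hlt
    have hs' := congrArg (ZMod.castHom (dvd_refl p) k) hs
    rw [map_sum, map_zero] at hs'
    rw [show (∑ b : Multiplicative (ZMod p), (ZMod.castHom (dvd_refl p) k) b.toAdd ^ m) = 0 from ?_,
      zero_smul]
    rw [← hs']
    simp only [map_pow]
    exact Multiplicative.toAdd.sum_comp (fun b => (ZMod.castHom (dvd_refl p) k b) ^ m)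

theorem VMod_not_projective {n : ℕ} (hn : 1 ≤ n) (hnp : n < p) :
    ¬ Module.Projective (SL2Alg k p) (VRep k p n).asModule := fun _ =>
  VRep_not_hasTraceOne hn hnp (VRep k p n).hasTraceOne_of_projective

/-! ### The Steinberg module `V_p` -/

/-- In the binomial expansion the power sum of `b ^ m` over 𝔽_p vanishes for `m < p - 1` and equals
`-1` for `m = p - 1`. -/
theorem sum_line_pow (e : ZMod p) :
    ∑ b : ZMod p, (C (ZMod.castHom (dvd_refl p) k b) * X 0 +
      C (ZMod.castHom (dvd_refl p) k e) * X 1 : MvPolynomial (Fin 2) k) ^ (p - 1)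
      = - X 0 ^ (p - 1) := by
  have hp := (Fact.out : p.Prime).one_lt
  simp only [add_pow]
  rw [Finset.sum_comm]
  have hterm : ∀ m ∈ Finset.range (p - 1 + 1), ∑ b : ZMod p,
      (C (ZMod.castHom (dvd_refl p) k b) * X 0 : MvPolynomial (Fin 2) k) ^ m *
        (C (ZMod.castHom (dvd_refl p) k e) * X 1) ^ (p - 1 - m) * (((p - 1).choose m : ℕ) : MvPolynomial (Fin 2) k)
      = C (ZMod.castHom (dvd_refl p) k (∑ b : ZMod p, b ^ m)) * (X 0 ^ m *
        (C (ZMod.castHom (dvd_refl p) k e) * X 1) ^ (p - 1 - m) * (((p - 1).choose m : ℕ) : MvPolynomial (Fin 2) k)) := by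
    intro m _
    rw [map_sum, map_sum, Finset.sum_mul]
    refine Finset.sum_congr rfl fun b _ => ?_
    rw [mul_pow, map_pow, map_pow]
    ring
  rw [Finset.sum_congr rfl hterm, Finset.sum_eq_single_of_mem (p - 1) (by simp)]
  · have hs : ∑ b : ZMod p, b ^ (p - 1) = -1 := by
      have := FiniteField.sum_pow_units (ZMod p) (p - 1)
      rw [ZMod.card, if_pos dvd_rfl] at this
      rw [← this, ← Finset.sum_subset (Finset.subset_univ (Finset.univ.image
        (Units.val : (ZMod p)ˣ → ZMod p)))]
      · rw [Finset.sum_image (fun a _ b _ h => Units.ext h)]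
      · intro b _ hb
        have : b = 0 := by
          by_contra h
          exact hb (Finset.mem_image.mpr ⟨Units.mk0 b h, Finset.mem_univ _, rfl⟩)
        rw [this, zero_pow (by omega)]
    rw [hs]
    simp
  · intro m hm hne
    rw [FiniteField.sum_pow_lt_card_sub_one (ZMod p) m (by
      rw [ZMod.card]; have := Finset.mem_range.mp hm; omega)]
    simp

/-- The elements of `SL₂(𝔽_p)` with nonzero lower left entry. -/
def bigCellElt (x : (ZMod p)ˣ × ZMod p × ZMod p) : SL2 p :=
  ⟨!![x.2.2, (x.2.2 * x.2.1 - 1) * ((x.1⁻¹ : (ZMod p)ˣ) : ZMod p); (x.1 : ZMod p), x.2.1], by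
    rw [Matrix.det_fin_two_of, mul_assoc, Units.inv_mul]
    ring⟩

/-- In the Steinberg trace every term carries a factor `(g 1 0) ^ (p - 1)`, so only the big cell
contributes. There the entries `c ≠ 0`, `d` and `a` are free and the determinant fixes the last one.
-/
theorem sum_bigCell {A : Type*} [AddCommMonoid A] (F : SL2 p → A)
    (hF : ∀ g : SL2 p, g 1 0 = 0 → F g = 0) :
    ∑ g, F g = ∑ c : (ZMod p)ˣ, ∑ d : ZMod p, ∑ a : ZMod p, F (bigCellElt (c, d, a)) := by
  classical
  have hinj : Function.Injective (bigCellElt (p := p)) := by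
    rintro ⟨c, d, a⟩ ⟨c', d', a'⟩ h
    have h1 := congrArg (fun g : SL2 p => (g : Matrix (Fin 2) (Fin 2) (ZMod p)) 1 0) h
    have h2 := congrArg (fun g : SL2 p => (g : Matrix (Fin 2) (Fin 2) (ZMod p)) 1 1) h
    have h3 := congrArg (fun g : SL2 p => (g : Matrix (Fin 2) (Fin 2) (ZMod p)) 0 0) h
    simp only [bigCellElt, Matrix.of_apply, Matrix.cons_val', Matrix.cons_val_zero,
      Matrix.cons_val_one, Matrix.cons_val_fin_one] at h1 h2 h3
    rw [Units.ext h1, h2, h3]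
  have hmem : ∀ g : SL2 p, g 1 0 ≠ 0 → g ∈ Finset.univ.image (bigCellElt (p := p)) := by
    intro g hg
    refine Finset.mem_image.mpr ⟨(Units.mk0 _ hg, g 1 1, g 0 0), Finset.mem_univ _, ?_⟩
    have hdet := g.det_coe
    rw [Matrix.det_fin_two] at hdet
    apply Matrix.SpecialLinearGroup.ext
    intro i j
    fin_cases i <;> fin_cases j <;> simp [bigCellElt]
    have : (g 0 0 * g 1 1 - 1 : ZMod p) = g 0 1 * g 1 0 := by linear_combination hdet
    rw [this, mul_assoc, mul_inv_cancel₀ hg, mul_one]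
  rw [← Finset.sum_subset (Finset.subset_univ (Finset.univ.image (bigCellElt (p := p))))]
  · rw [Finset.sum_image (fun a _ b _ h => hinj h), Fintype.sum_prod_type]
    refine Finset.sum_congr rfl fun c _ => ?_
    rw [Fintype.sum_prod_type]
  · intro g _ hg
    refine hF g ?_
    by_contra h
    exact hg (hmem g h)

/-- The map `f ↦ -[Y ^ (p - 1)] f • Y ^ (p - 1)`, whose trace is the identity of `V_p`. -/
def steinbergSplitting (k : Type u) [Field k] (p : ℕ) : VSpace k p →ₗ[k] VSpace k p :=
  LinearMap.toSpanSingleton k (VSpace k p) ⟨-X 1 ^ (p - 1), Submodule.neg_mem _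
    ((mem_homogeneousSubmodule _ _).mpr (isHomogeneous_X_pow _ _))⟩ ∘ₗ
    (lcoeff k (Finsupp.single 1 (p - 1))) ∘ₗ (homogeneousSubmodule (Fin 2) k (p - 1)).subtype

theorem coeff_linearForm_pow (a b : k) (d : ℕ) :
    coeff (Finsupp.single 1 d) ((C a * X 0 + C b * X 1 : MvPolynomial (Fin 2) k) ^ d) = b ^ d := by
  rw [add_pow, coeff_sum, Finset.sum_eq_single_of_mem 0 (by simp)]
  · simp only [pow_zero, Nat.sub_zero, one_mul, Nat.choose_zero_right, Nat.cast_one, mul_one,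
      mul_pow, ← map_pow, coeff_C_mul]
    rw [X_pow_eq_monomial, coeff_monomial, if_pos rfl, mul_one]
  · intro m _ hm
    rw [mul_pow, mul_pow, ← map_pow, ← map_pow,
      show (C (a ^ m) * X 0 ^ m * (C (b ^ (d - m)) * X 1 ^ (d - m)) * ((d.choose m : ℕ) :
        MvPolynomial (Fin 2) k)) = C (a ^ m * b ^ (d - m) * (d.choose m : k)) *
          (X 0 ^ m * X 1 ^ (d - m)) by
        rw [map_mul, map_mul, map_natCast]; ring, coeff_C_mul, X_pow_eq_monomial,
      X_pow_eq_monomial, monomial_mul, coeff_monomial, if_neg, mul_zero]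
    intro h
    have := DFunLike.congr_fun h 0
    simp at this
    exact hm this

/-- The trace `E` of the rank-one map θ commutes with the group, so its fixed vectors form an
invariant subspace. A computation over the big cell shows that this subspace contains `X ^ (p - 1)`,
and irreducibility of `V_p` does the rest. -/
theorem VRep_p_hasTraceOne : (VRep k p p).HasTraceOne := by
  classical
  have hp := (Fact.out : p.Prime).two_le
  let θ := steinbergSplitting k p
  let E : VSpace k p →ₗ[k] VSpace k p :=
    ∑ g : SL2 p, VRep k p p g ∘ₗ θ ∘ₗ VRep k p p g⁻¹
  have hE : ∀ v, E v = ∑ g : SL2 p, VRep k p p g (θ (VRep k p p g⁻¹ v)) := by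
    intro v
    simp [E]
  refine ⟨θ, fun v => ?_⟩
  rw [← hE]
  let W : Submodule k (VSpace k p) := LinearMap.eqLocus E LinearMap.id
  suffices h : W = ⊤ by
    have : v ∈ W := by rw [h]; trivial
    exact this
  let x : VSpace k p := ⟨X 0 ^ (p - 1), (mem_homogeneousSubmodule _ _).mpr
    (isHomogeneous_X_pow _ _)⟩
  have hx : E x = x := by
    apply Subtype.ext
    rw [hE, AddSubmonoidClass.coe_finsetSum]
    have hval : ∀ g : SL2 p, (VRep k p p g (θ (VRep k p p g⁻¹ x)) : MvPolynomial (Fin 2) k) =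
        - (C (ZMod.castHom (dvd_refl p) k ((g 1 0) ^ (p - 1))) *
        (C (ZMod.castHom (dvd_refl p) k (g 0 1)) * X 0 +
          C (ZMod.castHom (dvd_refl p) k (g 1 1)) * X 1) ^ (p - 1)) := by
      intro g
      have h1 : coeff (Finsupp.single 1 (p - 1)) (linSubst k p g⁻¹ (X 0 ^ (p - 1))) =
          ZMod.castHom (dvd_refl p) k ((g 1 0) ^ (p - 1)) := by
        have hinv : (g⁻¹ : SL2 p) 1 0 = - g 1 0 := by
          rw [Matrix.SpecialLinearGroup.coe_inv, Matrix.adjugate_fin_two]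
          rfl
        rw [map_pow, linSubst_X_zero, coeff_linearForm_pow, hinv, map_neg, map_pow, neg_pow]
        rcases (Fact.out : p.Prime).eq_two_or_odd' with h2 | h2
        · subst h2
          simp [CharTwo.neg_eq]
        · rw [Even.neg_one_pow (Nat.Odd.sub_odd h2 odd_one), one_mul]
      rw [VRep_apply_coe]
      have h2 : (θ (VRep k p p g⁻¹ x) : MvPolynomial (Fin 2) k) =
          C (ZMod.castHom (dvd_refl p) k ((g 1 0) ^ (p - 1))) * (- X 1 ^ (p - 1)) := by
        rw [← h1, ← smul_eq_C_mul]
        rfl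
      rw [h2, neg_eq_neg_one_mul (X 1 ^ (p - 1) : MvPolynomial (Fin 2) k), map_mul, map_mul, algHom_C, map_neg, map_one,
          map_pow (linSubst k p g), linSubst_X_one, neg_one_mul, mul_neg]
      rfl
    rw [Finset.sum_congr rfl fun g _ => hval g, sum_bigCell]
    · set Y : MvPolynomial (Fin 2) k := X 0 ^ (p - 1) with hY
      have hpY : (p : ℕ) • Y = 0 := by
        rw [nsmul_eq_mul, CharP.cast_eq_zero, zero_mul]
      have hd : ∀ (c : (ZMod p)ˣ) (d : ZMod p), ∑ a : ZMod p,
          -(C (ZMod.castHom (dvd_refl p) k (bigCellElt (c, d, a) 1 0 ^ (p - 1))) *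
            (C (ZMod.castHom (dvd_refl p) k (bigCellElt (c, d, a) 0 1)) * X 0 +
            C (ZMod.castHom (dvd_refl p) k (bigCellElt (c, d, a) 1 1)) * X 1) ^ (p - 1)) =
          Y - if d = 0 then Y else 0 := by
        intro c d
        have h10 : ∀ a, bigCellElt (c, d, a) 1 0 = (c : ZMod p) := fun a => rfl
        have h11 : ∀ a, bigCellElt (c, d, a) 1 1 = d := fun a => rfl
        have h01 : ∀ a, bigCellElt (c, d, a) 0 1 = (a * d - 1) * ((c⁻¹ : (ZMod p)ˣ) : ZMod p) :=
          fun a => rfl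
        simp only [h10, h11, h01]
        rw [ZMod.pow_card_sub_one_eq_one c.ne_zero, map_one, map_one]
        simp only [one_mul]
        rw [Finset.sum_neg_distrib]
        -- For `d = 0` the summand does not depend on `a` and is counted `p` times. For `d ≠ 0` the
        -- upper right entry runs through 𝔽_p and `sum_line_pow` applies.
        by_cases h : d = 0
        · subst h
          simp only [mul_zero, zero_sub, if_true, sub_self]
          rw [Finset.sum_const, Finset.card_univ, ZMod.card, nsmul_eq_mul, CharP.cast_eq_zero,
            zero_mul, neg_zero]
        · have hb : Function.Bijective
              (fun a : ZMod p => (a * d - 1) * ((c⁻¹ : (ZMod p)ˣ) : ZMod p)) := by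
            rw [← Finite.injective_iff_bijective]
            intro a a' haa
            have h3 := mul_right_cancel₀ (c⁻¹).ne_zero haa
            exact mul_right_cancel₀ h (by linear_combination h3)
          rw [hb.sum_comp (fun b : ZMod p => (C (ZMod.castHom (dvd_refl p) k b) * X 0 +
            C (ZMod.castHom (dvd_refl p) k d) * X 1 : MvPolynomial (Fin 2) k) ^ (p - 1)),
            sum_line_pow, if_neg h, neg_neg, sub_zero]
      simp only [hd]
      -- The sum over `d` is `p • Y - Y = -Y`, and the sum over the `p - 1` units `c` is `-(p - 1) •
      -- Y = Y` in characteristic `p`.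
      rw [Finset.sum_const, Finset.sum_sub_distrib, Finset.sum_ite_eq', if_pos (Finset.mem_univ _),
        Finset.sum_const, Finset.card_univ, Finset.card_univ, ZMod.card, ZMod.card_units_eq_totient,
        Nat.totient_prime Fact.out, hpY, zero_sub, smul_neg, ← sub_eq_zero, ← neg_eq_zero,
        neg_sub, sub_neg_eq_add, ← succ_nsmul', Nat.sub_add_cancel (by omega), hpY]
    · intro g hg
      rw [hg, zero_pow (by omega)]
      simp
  have hcomm : ∀ (h : SL2 p) (v : VSpace k p), E (VRep k p p h v) = VRep k p p h (E v) := by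
    intro h v
    rw [hE, hE, map_sum, ← Equiv.sum_comp (Equiv.mulLeft h)]
    refine Finset.sum_congr rfl fun g _ => ?_
    simp only [Equiv.coe_mulLeft, mul_inv_rev, map_mul, Module.End.mul_apply,
      Representation.inv_self_apply]
  refine VRep_eq_top_of_invariant (p := p) le_rfl W ?_ ?_
  · intro g f hf
    change E (VRep k p p g f) = VRep k p p g f
    rw [hcomm, show E f = f from hf]
  · intro h
    have hxW : x ∈ W := hx
    rw [h, Submodule.mem_bot] at hxW
    have := congrArg Subtype.val hxW
    exact pow_ne_zero _ (X_ne_zero 0) this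

end VModules

/-! ### Tensor products with `V_2` -/

section TensorVTwo

open scoped TensorProduct

variable {k : Type u} [Field k] {p : ℕ} [CharP k p]

/-- A surjective intertwining map between representations of the same dimension is an
equivalence. -/
theorem nonempty_equiv_of_surjective {G : Type} [Group G] {V W : Type u} [AddCommGroup V]
    [Module k V] [AddCommGroup W] [Module k W] [Module.Finite k V] [Module.Finite k W]
    {ρ : Representation k G V} {σ : Representation k G W} (F : ρ.IntertwiningMap σ)
    (hF : Function.Surjective F) (h : Module.finrank k V = Module.finrank k W) :
    Nonempty (ρ.Equiv σ) :=
  ⟨Representation.IntertwiningMap.ofBijective F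
    ⟨(LinearMap.injective_iff_surjective_of_finrank_eq_finrank (K := k) (V := V) (V₂ := W) h
      (f := F.toLinearMap)).mpr hF, hF⟩⟩

/-- Multiplication `V_i ⊗ V_j → V_{i+j-1}`. -/
def mulIntertwiner (k : Type u) [Field k] (p : ℕ) [CharP k p] {i j l : ℕ}
    (h : i - 1 + (j - 1) = l - 1) :
    ((VRep k p i).tprod (VRep k p j)).IntertwiningMap (VRep k p l) where
  toLinearMap := TensorProduct.lift <| LinearMap.mk₂ k
    (fun (f : VSpace k i) (q : VSpace k j) => (⟨f * q, by
      have := ((mem_homogeneousSubmodule _ _).mp f.2).mul ((mem_homogeneousSubmodule _ _).mp q.2)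
      rw [h] at this
      exact (mem_homogeneousSubmodule _ _).mpr this⟩ : VSpace k l))
    (fun _ _ _ => Subtype.ext (add_mul _ _ _)) (fun _ _ _ => Subtype.ext (smul_mul_assoc _ _ _))
    (fun _ _ _ => Subtype.ext (mul_add _ _ _)) (fun _ _ _ => Subtype.ext (mul_smul_comm _ _ _))
  isIntertwining' g := by
    ext f q
    simp [VRep_apply_coe]

theorem mulIntertwiner_tmul {i j l : ℕ} (h : i - 1 + (j - 1) = l - 1) (f : VSpace k i)
    (q : VSpace k j) : (mulIntertwiner k p h (f ⊗ₜ q) : MvPolynomial (Fin 2) k) = f * q := rfl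

/-- The chain rule for linear substitutions. -/
theorem pderiv_linSubst (g : SL2 p) (i : Fin 2) (f : MvPolynomial (Fin 2) k) :
    pderiv i (linSubst k p g f) =
      C (ZMod.castHom (dvd_refl p) k (g i 0)) * linSubst k p g (pderiv 0 f) +
      C (ZMod.castHom (dvd_refl p) k (g i 1)) * linSubst k p g (pderiv 1 f) := by
  induction f using MvPolynomial.induction_on with
  | C a => simp [algHom_C]
  | add f q hf hq =>
    simp only [map_add, hf, hq]
    ring
  | mul_X f j hf =>
    have hX : pderiv i (linSubst k p g (X j)) = C (ZMod.castHom (dvd_refl p) k (g i j)) := by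
      fin_cases j
      · rw [show ((⟨0, by norm_num⟩ : Fin 2)) = 0 from rfl, linSubst_X_zero]
        fin_cases i <;> simp [pderiv_X]
      · rw [show ((⟨1, by norm_num⟩ : Fin 2)) = 1 from rfl, linSubst_X_one]
        fin_cases i <;> simp [pderiv_X]
    rw [map_mul, Derivation.leibniz, hX, hf]
    simp only [Derivation.leibniz, smul_eq_mul, map_add, map_mul, pderiv_X]
    fin_cases j <;> simp <;> ring

theorem isHomogeneous_pderiv_mul {a b : ℕ} {f q : MvPolynomial (Fin 2) k}
    (hf : f.IsHomogeneous a) (hq : q.IsHomogeneous b) (s t : Fin 2) :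
    (pderiv s f * pderiv t q).IsHomogeneous (a - 1 + (b - 1)) :=
  hf.pderiv.mul hq.pderiv

theorem pderiv_comm (s t : Fin 2) (f : MvPolynomial (Fin 2) k) :
    pderiv s (pderiv t f) = pderiv t (pderiv s f) := by
  have h : ⁅pderiv (R := k) s, pderiv (R := k) t⁆ = 0 := by
    apply MvPolynomial.derivation_ext
    intro i
    rw [Derivation.commutator_apply]
    simp only [pderiv_X]
    fin_cases s <;> fin_cases t <;> fin_cases i <;> simp
  rw [← sub_eq_zero, ← Derivation.commutator_apply, h, Derivation.zero_apply]

/-- The Jacobian bracket `V_i ⊗ V_j → V_{i+j-3}`. -/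
def jacobianIntertwiner (k : Type u) [Field k] (p : ℕ) [CharP k p] {i j l : ℕ}
    (h : i - 1 - 1 + (j - 1 - 1) = l - 1) :
    ((VRep k p i).tprod (VRep k p j)).IntertwiningMap (VRep k p l) where
  toLinearMap := TensorProduct.lift <| LinearMap.mk₂ k
    (fun (f : VSpace k i) (q : VSpace k j) =>
      (⟨pderiv 1 (f : MvPolynomial (Fin 2) k) * pderiv 0 (q : MvPolynomial (Fin 2) k) -
        pderiv 0 (f : MvPolynomial (Fin 2) k) * pderiv 1 (q : MvPolynomial (Fin 2) k), by
      have h1 := ((mem_homogeneousSubmodule _ _).mp f.2)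
      have h2 := ((mem_homogeneousSubmodule _ _).mp q.2)
      have := (isHomogeneous_pderiv_mul h1 h2 1 0).sub (isHomogeneous_pderiv_mul h1 h2 0 1)
      rw [h] at this
      exact (mem_homogeneousSubmodule _ _).mpr this⟩ : VSpace k l))
    (fun _ _ _ => Subtype.ext (by simp; ring)) (fun _ _ _ => Subtype.ext (by simp [smul_sub]))
    (fun _ _ _ => Subtype.ext (by simp; ring)) (fun _ _ _ => Subtype.ext (by simp [smul_sub]))
  isIntertwining' g := by
    ext f q : 4
    have hdet := congrArg (ZMod.castHom (dvd_refl p) k) g.det_coe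
    rw [Matrix.det_fin_two, map_sub, map_mul, map_mul, map_one] at hdet
    have hC := congrArg (C (σ := Fin 2)) hdet
    rw [map_sub, map_mul, map_mul, map_one] at hC
    simp only [ZMod.castHom_apply] at hC
    simp [VRep_apply_coe, pderiv_linSubst]
    -- By the chain rule a substitution multiplies the bracket by its determinant, which is 1.
    linear_combination (linSubst k p g (pderiv 1 (f : MvPolynomial (Fin 2) k)) *
      linSubst k p g (pderiv 0 (q : MvPolynomial (Fin 2) k)) -
      linSubst k p g (pderiv 0 (f : MvPolynomial (Fin 2) k)) *
      linSubst k p g (pderiv 1 (q : MvPolynomial (Fin 2) k))) * hC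

theorem jacobianIntertwiner_tmul {i j l : ℕ} (h : i - 1 - 1 + (j - 1 - 1) = l - 1)
    (f : VSpace k i) (q : VSpace k j) :
    (jacobianIntertwiner k p h (f ⊗ₜ q) : MvPolynomial (Fin 2) k) =
      pderiv 1 (f : MvPolynomial (Fin 2) k) * pderiv 0 (q : MvPolynomial (Fin 2) k) -
        pderiv 0 (f : MvPolynomial (Fin 2) k) * pderiv 1 (q : MvPolynomial (Fin 2) k) := rfl

/-- `V_i ⊗ V_2 ≅ V_{i-1} ⊕ V_{i+1}` for `2 ≤ i ≤ p - 1`. -/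
theorem nonempty_tprod_two_equiv {d : ℕ} (hd : d + 2 < p) :
    Nonempty (((VRep k p (d + 2)).tprod (VRep k p 2)).Equiv
      ((VRep k p (d + 1)).prod (VRep k p (d + 3)))) := by
  have hdk : ((d + 2 : ℕ) : k) ≠ 0 := by
    rw [Ne, CharP.cast_eq_zero_iff k p]
    intro h
    have := Nat.le_of_dvd (by omega) h
    omega
  let F := (jacobianIntertwiner k p (i := d + 2) (j := 2) (l := d + 1) rfl).prod
    (mulIntertwiner k p (i := d + 2) (j := 2) (l := d + 3) rfl)
  have hF : ∀ x, F x = (jacobianIntertwiner k p (i := d + 2) (j := 2) (l := d + 1) rfl x,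
    mulIntertwiner k p (i := d + 2) (j := 2) (l := d + 3) rfl x) := fun x => rfl
  let x0 : VSpace k 2 := ⟨X 0, (mem_homogeneousSubmodule _ _).mpr (isHomogeneous_X _ _)⟩
  let x1 : VSpace k 2 := ⟨X 1, (mem_homogeneousSubmodule _ _).mpr (isHomogeneous_X _ _)⟩
  have hsurj : Function.Surjective F := by
    rintro ⟨h, f⟩
    have hh : (h : MvPolynomial (Fin 2) k).IsHomogeneous d := (mem_homogeneousSubmodule _ _).mp h.2
    have hf : (f : MvPolynomial (Fin 2) k).IsHomogeneous (d + 2) :=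
      (mem_homogeneousSubmodule _ _).mp f.2
    let f0 : VSpace k (d + 2) := ⟨pderiv 0 (f : MvPolynomial (Fin 2) k),
      (mem_homogeneousSubmodule _ _).mpr hf.pderiv⟩
    let f1 : VSpace k (d + 2) := ⟨pderiv 1 (f : MvPolynomial (Fin 2) k),
      (mem_homogeneousSubmodule _ _).mpr hf.pderiv⟩
    let h0 : VSpace k (d + 2) := ⟨(h : MvPolynomial (Fin 2) k) * X 0,
      (mem_homogeneousSubmodule _ _).mpr (hh.mul (isHomogeneous_X _ _))⟩
    let h1 : VSpace k (d + 2) := ⟨(h : MvPolynomial (Fin 2) k) * X 1,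
      (mem_homogeneousSubmodule _ _).mpr (hh.mul (isHomogeneous_X _ _))⟩
    -- By Euler's identity `f0 ⊗ x0 + f1 ⊗ x1` has product `(d + 2) f`, and its bracket vanishes
    -- because partial derivatives commute. The product of `h1 ⊗ x0 - h0 ⊗ x1` is zero, and its
    -- bracket is the divergence of `(hX, hY)`, that is `(d + 2) h`.
    refine ⟨((d + 2 : ℕ) : k)⁻¹ • ((f0 ⊗ₜ x0 + f1 ⊗ₜ x1) + (h1 ⊗ₜ x0 - h0 ⊗ₜ x1)), ?_⟩
    rw [map_smul, inv_smul_eq_iff₀ hdk, hF]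
    have e1 := hf.sum_X_mul_pderiv
    have e2 := hh.sum_X_mul_pderiv
    have comm := pderiv_comm (0 : Fin 2) 1 (f : MvPolynomial (Fin 2) k)
    rw [Fin.sum_univ_two, nsmul_eq_mul] at e1 e2
    push_cast at e1
    have hC2 : (C (2 : k) : MvPolynomial (Fin 2) k) = 2 := map_ofNat C 2
    refine Prod.ext (Subtype.ext ?_) (Subtype.ext ?_)
    · simp only [map_add, map_sub]
      simp [jacobianIntertwiner_tmul, f0, f1, h0, h1, x0, x1, pderiv_X, smul_eq_C_mul]
      linear_combination e2 - comm - h * hC2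
    · simp only [map_add, map_sub]
      simp [mulIntertwiner_tmul, f0, f1, h0, h1, x0, x1, smul_eq_C_mul]
      linear_combination e1 - f * hC2
  have hdim : Module.finrank k (VSpace k (d + 2) ⊗[k] VSpace k 2) =
      Module.finrank k (VSpace k (d + 1) × VSpace k (d + 3)) := by
    rw [Module.finrank_tensorProduct, Module.finrank_prod, finrank_VSpace (by omega),
      finrank_VSpace (by omega), finrank_VSpace (by omega), finrank_VSpace (by omega)]
    ring
  exact nonempty_equiv_of_surjective (V := VSpace k (d + 2) ⊗[k] VSpace k 2)
    (W := VSpace k (d + 1) × VSpace k (d + 3)) F hsurj hdim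

/-- `V_i ⊗ V_1 ≅ V_i`. -/
theorem nonempty_tprod_one_equiv {i : ℕ} (hi : 1 ≤ i) :
    Nonempty (((VRep k p i).tprod (VRep k p 1)).Equiv (VRep k p i)) := by
  let F := mulIntertwiner k p (i := i) (j := 1) (l := i) (by omega)
  have hsurj : Function.Surjective F := fun f => by
    refine ⟨f ⊗ₜ ⟨1, (mem_homogeneousSubmodule _ _).mpr (isHomogeneous_one _ _)⟩, Subtype.ext ?_⟩
    rw [mulIntertwiner_tmul, mul_one]
  have hdim : Module.finrank k (VSpace k i ⊗[k] VSpace k 1) = Module.finrank k (VSpace k i) := by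
    rw [Module.finrank_tensorProduct, finrank_VSpace hi, finrank_VSpace le_rfl, mul_one]
  exact nonempty_equiv_of_surjective (V := VSpace k i ⊗[k] VSpace k 1) F hsurj hdim

end TensorVTwo

/-! ### The decomposition of `V_i ⊗ V_n` modulo projective modules -/

section Fusion

open scoped TensorProduct

/-- The stable type of `M ⊗ V_2` in terms of that of `M`. -/
def stepType {p : ℕ} (s : State p → ℕ) (j : State p) : ℕ :=
  ∑ i : State p, s i * ((if (j : ℕ) + 1 = i then 1 else 0) + if (i : ℕ) + 1 = j then 1 else 0)

/-- The multiplicity of `V_j` in `V_i ⊗ V_n`. -/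
def fusion (p i n j : ℕ) : ℕ :=
  if (i + n + j) % 2 = 1 ∧ i < n + j ∧ n < i + j ∧ j < i + n ∧ i + n + j < 2 * p then 1 else 0

/-- The neighbours `j - 1 = 0` and `j + 1 = p` of the extreme states are not states. The formula
survives because the fusion rule gives zero there, by the triangle inequalities and the cutoff at
`2p` respectively. -/
theorem stepType_fusion {p : ℕ} (i n : ℕ) (hn : n < p) (j : State p) :
    stepType (p := p) (fun l => fusion p i n l) j = fusion p i n (j - 1) + fusion p i n (j + 1) := by
  have hj := Finset.mem_Icc.mp j.2
  have h1 : ∀ m : ℕ, fusion p i n m =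
      ∑ l : State p, fusion p i n l * (if m = (l : ℕ) then 1 else 0) := by
    intro m
    by_cases hm : m ∈ Finset.Icc 1 (p - 1)
    · rw [Finset.sum_eq_single_of_mem ⟨m, hm⟩ (Finset.mem_univ _)]
      · simp
      · intro l _ hl
        rw [if_neg, mul_zero]
        rintro rfl
        exact hl rfl
    · rw [Finset.sum_eq_zero]
      · rw [Finset.mem_Icc] at hm
        rw [fusion, if_neg]
        omega
      · intro l _
        rw [if_neg, mul_zero]
        rintro rfl
        exact hm l.2
  rw [h1 (j - 1), h1 (j + 1), ← Finset.sum_add_distrib, stepType]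
  refine Finset.sum_congr rfl fun l _ => ?_
  have hl := Finset.mem_Icc.mp l.2
  rw [mul_add, add_comm]
  congr 2
  refine if_congr ?_ rfl rfl
  omega

variable (k : Type u) [Field k] (p : ℕ) [CharP k p]

/-- The modules `V_j` for `1 ≤ j ≤ p - 1`. -/
abbrev stateModule (j : State p) : Type u := (VRep k p j).asModule

theorem stateModule_equiv_eq (i j : State p)
    (h : Nonempty (stateModule k p i ≃ₗ[SL2Alg k p] stateModule k p j)) : i = j :=
  Subtype.ext (VMod_equiv_eq (Finset.mem_Icc.mp i.2).1 (Finset.mem_Icc.mp j.2).1 h.some)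

variable {k p}

/-- Stable types with respect to the modules `V_j`. -/
abbrev VStableType (k : Type u) [Field k] (p : ℕ) [CharP k p] (M : Type u) [AddCommGroup M] [Module (SL2Alg k p) M] (s : State p → ℕ) :
    Prop :=
  StableType (R := SL2Alg k p) (stateModule k p) M s

/-- Stable types of representations. -/
def RepStableType {V : Type u} [AddCommGroup V] [Module k V] (ρ : Representation k (SL2 p) V)
    (s : State p → ℕ) : Prop :=
  VStableType k p ρ.asModule s

namespace RepStableType

variable {V W : Type u} [AddCommGroup V] [Module k V] [AddCommGroup W] [Module k W]
  {ρ : Representation k (SL2 p) V} {σ : Representation k (SL2 p) W} {s t : State p → ℕ}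

theorem equiv (h : RepStableType ρ s) (e : ρ.Equiv σ) : RepStableType σ s :=
  StableType.equiv _ _ _ e.asModuleEquiv h

theorem prod (hρ : RepStableType ρ s) (hσ : RepStableType σ t) :
    RepStableType (ρ.prod σ) (s + t) :=
  StableType.equiv _ _ _ (Representation.prodAsModuleEquiv ρ σ).symm (StableType.prod _ _ _ _ hρ hσ)

theorem of_hasTraceOne [Fact p.Prime] [Module.Finite k V] (h : ρ.HasTraceOne) :
    RepStableType ρ 0 := by
  have h1 : Module.Projective (SL2Alg k p) ρ.asModule := h.projective
  have h2 : Module.Finite (SL2Alg k p) ρ.asModule := Module.Finite.of_restrictScalars_finite k _ _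
  exact StableType.projective _

theorem simple (j : State p) : RepStableType (VRep k p j) (Pi.single j 1) :=
  StableType.simple j

end RepStableType

variable (k p) [Fact p.Prime]

instance SL2Alg_finite : Module.Finite k (SL2Alg k p) :=
  Module.Finite.equiv (MonoidAlgebra.coeffLinearEquiv k).symm

instance SL2Alg_isArtinian : IsArtinianRing (SL2Alg k p) := IsArtinianRing.of_finite k _

instance stateModule_isSimple (j : State p) : IsSimpleModule (SL2Alg k p) (stateModule k p j) :=
  VMod_isSimple (by have := Finset.mem_Icc.mp j.2; omega)

theorem stateModule_not_projective (j : State p) :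
    ¬ Module.Projective (SL2Alg k p) (stateModule k p j) := by
  have := Finset.mem_Icc.mp j.2
  exact VMod_not_projective this.1 (by omega)

variable {k p}

/-- The decomposition given by either type bounds its multiplicities by those of the other. -/
theorem VStableType.unique {M : Type u} [AddCommGroup M] [Module (SL2Alg k p) M]
    {s t : State p → ℕ} (hs : VStableType k p M s) (ht : VStableType k p M t) :
    s = t := by
  funext j
  obtain ⟨W, _, _, ⟨e⟩⟩ := hs.exists_equiv j
  obtain ⟨W', _, _, ⟨e'⟩⟩ := ht.exists_equiv j
  exact le_antisymm
    (ht.le_of_summand (stateModule_not_projective k p) (stateModule_equiv_eq k p) j e)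
    (hs.le_of_summand (stateModule_not_projective k p) (stateModule_equiv_eq k p) j e')

namespace RepStableType

variable {V W : Type u} [AddCommGroup V] [Module k V] [AddCommGroup W] [Module k W]
  {ρ : Representation k (SL2 p) V} {σ : Representation k (SL2 p) W} {s t : State p → ℕ}

theorem unique (hs : RepStableType ρ s) (ht : RepStableType ρ t) : s = t :=
  VStableType.unique hs ht

theorem exists_right_of_prod (h : RepStableType (ρ.prod σ) s) : ∃ t, RepStableType σ t :=
  (StableType.equiv _ _ _ (Representation.prodAsModuleEquiv ρ σ) h).exists_of_summand
    (LinearMap.inr (SL2Alg k p) _ _) (LinearMap.snd (SL2Alg k p) _ _) (LinearMap.snd_comp_inr _ _ _)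

end RepStableType

/-- The case `m = p` is included: no state has label `p`, so the indicator is zero, which is the
type of the projective Steinberg module. This is where the walk is reflected at the upper end. -/
theorem repStableType_V {m : ℕ} (hm : 1 ≤ m) (hmp : m ≤ p) :
    RepStableType (VRep k p m) (fun j => if (j : ℕ) = m then 1 else 0) := by
  rcases hmp.lt_or_eq with h | rfl
  · let m' : State p := ⟨m, Finset.mem_Icc.mpr ⟨hm, by omega⟩⟩
    convert RepStableType.simple (k := k) m' using 1
    funext j
    rw [Pi.single_apply]
    simp [m', Subtype.ext_iff]
  · convert RepStableType.of_hasTraceOne (VRep_p_hasTraceOne (k := k) (p := m)) using 1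
    funext j
    have := Finset.mem_Icc.mp j.2
    simp
    omega

theorem repStableType_tprod_two_of_equiv {V : Type u} [AddCommGroup V] [Module k V]
    (ρ : Representation k (SL2 p) V) (i : State p) (e : ρ.Equiv (VRep k p i)) :
    RepStableType (ρ.tprod (VRep k p 2)) (stepType (Pi.single i 1)) := by
  have hi := Finset.mem_Icc.mp i.2
  have hstep : ∀ j : State p, stepType (Pi.single i 1) j =
      (if (j : ℕ) + 1 = i then 1 else 0) + if (i : ℕ) + 1 = j then 1 else 0 := by
    intro j
    rw [stepType, Finset.sum_eq_single_of_mem i (Finset.mem_univ _)]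
    · simp
    · intro l _ hl
      simp [Pi.single_eq_of_ne hl]
  refine RepStableType.equiv (V := VSpace k i ⊗[k] VSpace k 2) ?_
    (e.tprodCongr (VRep k p 2)).symm
  obtain h1 | ⟨d, hd⟩ : (i : ℕ) = 1 ∨ ∃ d, (i : ℕ) = d + 2 := by
    by_cases h : (i : ℕ) = 1
    · exact Or.inl h
    · exact Or.inr ⟨i - 2, by omega⟩
  · rw [h1]
    obtain ⟨e2⟩ := nonempty_tprod_one_equiv (k := k) (p := p) (i := 2) (by norm_num)
    convert RepStableType.equiv (W := VSpace k 1 ⊗[k] VSpace k 2)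
      (repStableType_V (k := k) (p := p) (m := 2) (by norm_num) (Fact.out : p.Prime).two_le)
      ((Representation.TensorProduct.comm _ _).trans e2).symm using 1
    funext j
    have := Finset.mem_Icc.mp j.2
    rw [hstep]
    grind
  · rw [hd]
    obtain ⟨e2⟩ := nonempty_tprod_two_equiv (k := k) (p := p) (d := d) (by omega)
    convert RepStableType.equiv (W := VSpace k (d + 2) ⊗[k] VSpace k 2)
      (RepStableType.prod
        (repStableType_V (k := k) (p := p) (m := d + 1) (by omega) (by omega))
        (repStableType_V (k := k) (p := p) (m := d + 3) (by omega) (by omega))) e2.symm using 1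
    funext j
    have := Finset.mem_Icc.mp j.2
    rw [hstep]
    simp only [Pi.add_apply]
    grind

/-- Induction on the construction of the type: tensoring is additive, it preserves projectives, and
on the simple modules it is the `V_2` rule. The representation is quantified after the module
because the induction only sees the module. -/
theorem VStableType.tprod_two {M : Type u} [AddCommGroup M] [Module (SL2Alg k p) M]
    {s : State p → ℕ} (h : VStableType k p M s) :
    ∀ {V : Type u} [AddCommGroup V] [Module k V] (ρ : Representation k (SL2 p) V)
      (_ : ρ.asModule ≃ₗ[SL2Alg k p] M),
      RepStableType (ρ.tprod (VRep k p 2)) (stepType s) := by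
  induction h with
  | projective M =>
    intro V _ _ ρ e
    have h1 : Module.Projective (SL2Alg k p) ρ.asModule := Module.Projective.of_equiv e.symm
    have h2 : Module.Finite (SL2Alg k p) ρ.asModule := Module.Finite.equiv e.symm
    have h3 : Module.Finite k ρ.asModule := Module.Finite.trans (SL2Alg k p) _
    have h4 : Module.Finite k V := h3
    convert RepStableType.of_hasTraceOne (V := V ⊗[k] VSpace k 2)
      (ρ.hasTraceOne_of_projective.tprod (VRep k p 2)) using 1
    funext j
    simp [stepType]
  | simple i =>
    intro V _ _ ρ e
    exact repStableType_tprod_two_of_equiv ρ i (Representation.equivOfAsModuleEquiv e)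
  | prod M N s t _ _ hM hN =>
    intro V _ _ ρ e
    obtain ⟨V₁, _, _, ρ₁, ⟨e₁⟩⟩ := Representation.exists_asModule_equiv (k := k) (G := SL2 p) M
    obtain ⟨V₂, _, _, ρ₂, ⟨e₂⟩⟩ := Representation.exists_asModule_equiv (k := k) (G := SL2 p) N
    have e3 : ρ.Equiv (ρ₁.prod ρ₂) := Representation.equivOfAsModuleEquiv
      ((e.trans (e₁.prodCongr e₂).symm).trans (Representation.prodAsModuleEquiv _ _).symm)
    have e4 := (e3.tprodCongr (VRep k p 2)).trans
      (Representation.prodTprodEquiv ρ₁ ρ₂ (VRep k p 2))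
    convert RepStableType.equiv (W := V ⊗[k] VSpace k 2)
      (RepStableType.prod (hM ρ₁ e₁) (hN ρ₂ e₂)) e4.symm using 1
    funext j
    simp only [stepType, Pi.add_apply, add_mul, Finset.sum_add_distrib]
  | equiv M N s e _ ih =>
    intro V _ _ ρ e'
    exact ih ρ (e'.trans e.symm)

theorem RepStableType.tprod_two {V : Type u} [AddCommGroup V] [Module k V]
    {ρ : Representation k (SL2 p) V} {s : State p → ℕ} (h : RepStableType ρ s) :
    RepStableType (ρ.tprod (VRep k p 2)) (stepType s) :=
  VStableType.tprod_two h ρ (LinearEquiv.refl _ _)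

/-- Tensoring with ρ exhibits `ρ ⊗ ρ₃` as a summand of `(ρ ⊗ ρ₂) ⊗ V_2`, so it has a stable type.
Uniqueness of types then yields an equation from which that type is found by subtraction. -/
theorem RepStableType.exists_of_tprod_two {U V₁ V₂ V₃ : Type u} [AddCommGroup U] [Module k U]
    [AddCommGroup V₁] [Module k V₁] [AddCommGroup V₂] [Module k V₂] [AddCommGroup V₃] [Module k V₃]
    {ρ : Representation k (SL2 p) U} {ρ₁ : Representation k (SL2 p) V₁}
    {ρ₂ : Representation k (SL2 p) V₂} {ρ₃ : Representation k (SL2 p) V₃} {s t : State p → ℕ}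
    (e : (ρ₂.tprod (VRep k p 2)).Equiv (ρ₁.prod ρ₃)) (h₁ : RepStableType (ρ.tprod ρ₁) s)
    (h₂ : RepStableType (ρ.tprod ρ₂) t) :
    ∃ r, RepStableType (ρ.tprod ρ₃) r ∧ stepType t = s + r := by
  let e' : ((ρ.tprod ρ₂).tprod (VRep k p 2)).Equiv ((ρ₁.tprod ρ).prod (ρ₃.tprod ρ)) :=
    (Representation.TensorProduct.assoc _ _ _).trans
      ((Representation.TensorProduct.comm _ _).trans
        ((Representation.Equiv.tprodCongr e ρ).trans (Representation.prodTprodEquiv _ _ _)))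
  have h := h₂.tprod_two.equiv e'
  obtain ⟨r, hr⟩ := h.exists_right_of_prod
  exact ⟨r, hr.equiv (Representation.TensorProduct.comm _ _),
    h.unique ((h₁.equiv (Representation.TensorProduct.comm _ _)).prod hr)⟩

/-- `V_i ⊗ V_n` is, up to a projective summand, the sum of the `V_j` with
`fusion p i n j = 1`. -/
theorem repStableType_tensor {i n : ℕ} (hi : 1 ≤ i) (hip : i < p) (hn : 1 ≤ n) (hnp : n < p) :
    RepStableType (V := VSpace k i ⊗[k] VSpace k n) ((VRep k p i).tprod (VRep k p n))
      (fun j => fusion p i n j) := by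
  induction n using Nat.strong_induction_on with
  | _ n ih =>
  obtain ⟨e1⟩ := nonempty_tprod_one_equiv (k := k) (p := p) hi
  have base : RepStableType (VRep k p i) (fun j => fusion p i 1 j) := by
    convert repStableType_V (k := k) (p := p) (m := i) (by omega) (by omega) using 1
    funext j
    have hj := Finset.mem_Icc.mp j.2
    unfold fusion
    refine if_congr ?_ rfl rfl
    omega
  obtain h1 | h2 | ⟨d, hd⟩ : n = 1 ∨ n = 2 ∨ ∃ d, n = d + 3 := by
    by_cases h : n < 3
    · omega
    · exact Or.inr (Or.inr ⟨n - 3, by omega⟩)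
  · subst h1
    exact RepStableType.equiv (W := VSpace k i ⊗[k] VSpace k 1) base e1.symm
  · subst h2
    convert base.tprod_two using 1
    funext j
    have hj := Finset.mem_Icc.mp j.2
    rw [stepType_fusion _ _ (by omega)]
    unfold fusion
    grind
  · subst hd
    have hA := ih (d + 1) (by omega) (by omega) (by omega)
    obtain ⟨e2⟩ := nonempty_tprod_two_equiv (k := k) (p := p) (d := d) (by omega)
    -- With `n = d + 3`, the type of `V_i ⊗ V_n` at `j` is the sum of the values for `n - 1` at `j -
    -- 1` and `j + 1`, minus the value for `n - 2` at `j`. The fusion rule satisfies the same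
    -- recursion.
    obtain ⟨t, ht, hsum⟩ := RepStableType.exists_of_tprod_two e2 hA
      (ih (d + 2) (by omega) (by omega) (by omega))
    convert ht using 1
    funext j
    have hj := congrFun hsum j
    have hj' := Finset.mem_Icc.mp j.2
    rw [stepType_fusion _ _ (by omega)] at hj
    simp only [Pi.add_apply] at hj
    unfold fusion at hj ⊢
    split_ifs at hj ⊢ <;> omega

end Fusion

/-! ### Multiplicities and transition probabilities -/

section Multiplicities

open scoped TensorProduct

variable {k : Type u} [Field k] {p : ℕ}

theorem modClass_eq_iff {M N : ModuleCat.{u} (SL2Alg k p)} :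
    modClass M = modClass N ↔ Nonempty (M ≃ₗ[SL2Alg k p] N) := by
  constructor
  · intro h
    obtain ⟨f⟩ := Quotient.exact h
    exact ⟨f.toLinearEquiv⟩
  · rintro ⟨e⟩
    exact Quotient.sound ⟨e.toModuleIso⟩

theorem modClass_out (c : ModClass k p) : modClass c.out = c := Quotient.out_eq c

variable [Fact p.Prime] [CharP k p]

/-- Stable types of objects of the category of modules. -/
def ModStableType (U : ModuleCat.{u} (SL2Alg k p)) (s : State p → ℕ) : Prop :=
  VStableType k p U s

theorem modStableType_VTensor {i n : ℕ} (hi : 1 ≤ i) (hip : i < p) (hn : 1 ≤ n) (hnp : n < p) :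
    ModStableType (VTensor k p i n) (fun j => fusion p i n j) :=
  repStableType_tensor hi hip hn hnp

/-- The multiplicity of `V_j` in a module is determined by its stable type. -/
theorem summandMult_eq_of_equiv {M U : ModuleCat.{u} (SL2Alg k p)} {s : State p → ℕ}
    (h : ModStableType U s) (j : State p) (e : M ≃ₗ[SL2Alg k p] stateModule k p j) :
    summandMult M U = s j := by
  have e' : ∀ m : ℕ, (Fin m → M) ≃ₗ[SL2Alg k p] (Fin m → stateModule k p j) := fun m =>
    LinearEquiv.piCongrRight fun _ => e
  refine IsGreatest.csSup_eq ⟨?_, ?_⟩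
  · obtain ⟨W, _, _, ⟨f⟩⟩ := StableType.exists_equiv h j
    exact ⟨ModuleCat.of _ W, ⟨f.trans ((e' (s j)).symm.prodCongr (LinearEquiv.refl _ _))⟩⟩
  · rintro m ⟨W, ⟨f⟩⟩
    exact StableType.le_of_summand (stateModule_not_projective k p) (stateModule_equiv_eq k p) h j
      (f.trans ((e' m).prodCongr (LinearEquiv.refl _ _)))

theorem summandMult_VTensor {i n : ℕ} (hi : 1 ≤ i) (hip : i < p) (hn : 1 ≤ n) (hnp : n < p)
    (j : State p) : summandMult (VMod k p j) (VTensor k p i n) = fusion p i n j :=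
  summandMult_eq_of_equiv (modStableType_VTensor hi hip hn hnp) j (LinearEquiv.refl _ _)

/-- A non-projective indecomposable module other than the `V_j` is not a summand of a module that
has a stable type. -/
theorem summandMult_eq_zero {M U : ModuleCat.{u} (SL2Alg k p)} {s : State p → ℕ}
    (h : ModStableType U s) (hM : IsNonProjIndec M)
    (hne : ∀ j : State p, IsEmpty (M ≃ₗ[SL2Alg k p] stateModule k p j)) :
    summandMult M U = 0 := by
  -- A positive `m` would make `M` a retract of `U`, via its copy with index 0, hence projective or
  -- one of the `V_j`. The set is therefore empty or `{0}`, and both have supremum 0 in ℕ.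
  have h0 : {m : ℕ | ∃ W : ModuleCat.{u} (SL2Alg k p),
      Nonempty (U ≃ₗ[SL2Alg k p] (Fin m → M) × W)} ⊆ {0} := by
    rintro m ⟨W, ⟨f⟩⟩
    by_contra hm
    obtain ⟨l, rfl⟩ := Nat.exists_eq_succ_of_ne_zero hm
    have := hM.finite
    rcases StableType.projective_or_equiv hM.indecomposable h
      (f.symm.toLinearMap ∘ₗ LinearMap.inl (SL2Alg k p) (Fin (l + 1) → M) W ∘ₗ
        LinearMap.single (SL2Alg k p) (fun _ => (M : Type u)) 0)
      (LinearMap.proj 0 ∘ₗ LinearMap.fst (SL2Alg k p) (Fin (l + 1) → M) W ∘ₗ f.toLinearMap)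
      (by
        convert Function.bijective_id
        ext x
        simp) with h1 | ⟨j, -, ⟨e⟩⟩
    · exact hM.not_projective h1
    · exact (hne j).false e
  rcases Set.subset_singleton_iff_eq.mp h0 with h1 | h1
  · rw [summandMult, h1]
    exact csSup_empty
  · rw [summandMult, h1, csSup_singleton]

theorem isNonProjIndec_of_equiv {M : ModuleCat.{u} (SL2Alg k p)} (j : State p)
    (e : M ≃ₗ[SL2Alg k p] stateModule k p j) : IsNonProjIndec M := by
  have hs : IsSimpleModule (SL2Alg k p) M := IsSimpleModule.congr (N := stateModule k p j) e
  refine ⟨inferInstance, StableType.isIndecomposable_of_isSimple _, fun h => ?_⟩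
  exact stateModule_not_projective k p j (Module.Projective.of_equiv e)

/-- The total weight of the non-projective part of a module of known stable type. -/
theorem totalWeight_eq (w : ModClass k p → ℝ) {U : ModuleCat.{u} (SL2Alg k p)} {s : State p → ℕ}
    (h : ModStableType U s) : totalWeight w U = ∑ j : State p, weightOf w j * s j := by
  classical
  have hinj : Function.Injective fun j : State p => modClass (VMod k p j) := fun i j hij =>
    stateModule_equiv_eq k p i j (modClass_eq_iff.mp hij)
  -- Only the classes of the `V_j` contribute to the sum over all classes. The representative chosen
  -- by `Quotient.out` is merely isomorphic to `V_j`, which suffices for its multiplicity.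
  rw [totalWeight, finsum_eq_sum_of_support_subset
    (s := Finset.univ.image fun j : State p => modClass (VMod k p j))]
  · rw [Finset.sum_image fun i _ j _ hij => hinj hij]
    refine Finset.sum_congr rfl fun j _ => ?_
    obtain ⟨e⟩ := modClass_eq_iff.mp (modClass_out (modClass (VMod k p j)))
    rw [finsum_eq_if, if_pos (isNonProjIndec_of_equiv j e), summandMult_eq_of_equiv h j e]
    rfl
  · intro c hc
    rw [Function.mem_support] at hc
    by_contra hcon
    apply hc
    rw [finsum_eq_if]
    split_ifs with hM
    · rw [summandMult_eq_zero h hM, Nat.cast_zero, mul_zero]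
      intro j
      refine ⟨fun e => hcon ?_⟩
      rw [← modClass_out c, Finset.coe_image]
      exact ⟨j, by simp, (modClass_eq_iff.mpr ⟨e⟩).symm⟩
    · rfl

theorem weightOf_pos {w : ModClass k p → ℝ} (hw : IsWeight w) (j : State p) :
    0 < weightOf w j :=
  hw _ (isNonProjIndec_of_equiv j (LinearEquiv.refl _ _))

theorem multMatrix_apply {n : ℕ} (hn : 1 ≤ n) (hnp : n < p) (i j : State p) :
    multMatrix k p n i j = fusion p i n j := by
  have hi := Finset.mem_Icc.mp i.2
  rw [multMatrix, Matrix.of_apply, summandMult_VTensor hi.1 (by omega) hn hnp]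

theorem transMatrix_apply (w : ModClass k p → ℝ) {n : ℕ} (hn : 1 ≤ n) (hnp : n < p)
    (i j : State p) :
    transMatrix w n i j = weightOf w j * fusion p i n j /
      ∑ l : State p, weightOf w l * fusion p i n l := by
  have hi := Finset.mem_Icc.mp i.2
  rw [transMatrix, Matrix.of_apply, summandMult_VTensor hi.1 (by omega) hn hnp,
    totalWeight_eq w (modStableType_VTensor hi.1 (by omega) hn hnp)]

end Multiplicities

/-! ### Reversible Markov chains -/

section Reversible

variable {S : Type} [Fintype S] [DecidableEq S]

/-- `P` is a stochastic matrix that satisfies detailed balance with respect to the positive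
distribution `π`. -/
structure IsReversibleChain (P : Matrix S S ℝ) (π : S → ℝ) : Prop where
  nonneg : ∀ i j, 0 ≤ P i j
  sum_row : ∀ i, ∑ j, P i j = 1
  pos : ∀ i, 0 < π i
  sum_dist : ∑ i, π i = 1
  balance : ∀ i j, π i * P i j = π j * P j i

namespace IsReversibleChain

variable {P : Matrix S S ℝ} {π : S → ℝ}

theorem mem_rowStochastic (h : IsReversibleChain P π) : P ∈ Matrix.rowStochastic ℝ S :=
  Matrix.mem_rowStochastic_iff_sum.mpr ⟨h.nonneg, h.sum_row⟩

theorem isStationaryDist (h : IsReversibleChain P π) : IsStationaryDist P π := by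
  refine ⟨⟨fun i => (h.pos i).le, h.sum_dist⟩, ?_⟩
  funext j
  simp only [Matrix.vecMul, dotProduct]
  rw [Finset.sum_congr rfl fun i _ => h.balance i j, ← Finset.mul_sum, h.sum_row, mul_one]

/-- Passing to `P * P` treats the eigenvalues `1` and `-1` alike: connectedness of its graph rules
out periodicity too. -/
theorem sq (h : IsReversibleChain P π) : IsReversibleChain (P * P) π where
  nonneg i j := by
    rw [Matrix.mul_apply]
    exact Finset.sum_nonneg fun l _ => mul_nonneg (h.nonneg _ _) (h.nonneg _ _)
  sum_row i := by
    simp only [Matrix.mul_apply]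
    rw [Finset.sum_comm]
    simp only [← Finset.mul_sum, h.sum_row, mul_one]
  pos := h.pos
  sum_dist := h.sum_dist
  balance i j := by
    simp only [Matrix.mul_apply, Finset.mul_sum]
    refine Finset.sum_congr rfl fun l _ => ?_
    rw [← mul_assoc, h.balance i l, mul_comm (π l), mul_assoc, h.balance l j]
    ring

theorem lazy (h : IsReversibleChain P π) : IsReversibleChain (lazyChain P) π where
  nonneg i j := by
    have h1 := h.nonneg i j
    have h2 : (0 : ℝ) ≤ (1 : Matrix S S ℝ) i j := by
      rw [Matrix.one_apply]
      split_ifs <;> norm_num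
    simp only [lazyChain, Matrix.smul_apply, Matrix.add_apply, smul_eq_mul]
    positivity
  sum_row i := by
    simp only [lazyChain, Matrix.smul_apply, Matrix.add_apply, smul_eq_mul]
    rw [← Finset.mul_sum, Finset.sum_add_distrib, h.sum_row]
    simp [Matrix.one_apply]
    norm_num
  pos := h.pos
  sum_dist := h.sum_dist
  balance i j := by
    have h1 := h.balance i j
    have h2 : π i * (1 : Matrix S S ℝ) i j = π j * (1 : Matrix S S ℝ) j i := by
      by_cases hij : i = j
      · rw [hij]
      · rw [Matrix.one_apply_ne hij, Matrix.one_apply_ne (Ne.symm hij), mul_zero, mul_zero]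
    simp only [lazyChain, Matrix.smul_apply, Matrix.add_apply, smul_eq_mul]
    linear_combination (1 / 2) * h1 + (1 / 2) * h2

theorem mulVec_one (h : IsReversibleChain P π) : P.mulVec 1 = 1 := by
  funext i
  simp [Matrix.mulVec, dotProduct, h.sum_row]

/-- The Dirichlet form. -/
theorem sum_mul_sub_sq (h : IsReversibleChain P π) (f : S → ℝ) :
    ∑ i, ∑ j, π i * P i j * (f i - f j) ^ 2 = 2 * ∑ i, π i * f i * (f i - P.mulVec f i) := by
  have h1 : ∑ i, ∑ j, π i * P i j * f j ^ 2 = ∑ i, π i * f i ^ 2 := by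
    rw [Finset.sum_comm]
    refine Finset.sum_congr rfl fun j _ => ?_
    rw [← Finset.sum_mul, Finset.sum_congr rfl fun i _ => h.balance i j, ← Finset.mul_sum,
      h.sum_row, mul_one]
  have h2 : ∑ i, ∑ j, π i * P i j * f i ^ 2 = ∑ i, π i * f i ^ 2 := by
    refine Finset.sum_congr rfl fun i _ => ?_
    rw [← Finset.sum_mul, ← Finset.mul_sum, h.sum_row, mul_one]
  have h3 : ∑ i, ∑ j, π i * P i j * (f i * f j) = ∑ i, π i * f i * P.mulVec f i := by
    refine Finset.sum_congr rfl fun i _ => ?_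
    rw [Matrix.mulVec, dotProduct, Finset.mul_sum]
    exact Finset.sum_congr rfl fun j _ => by ring
  have h4 : ∑ i, ∑ j, π i * P i j * (f i - f j) ^ 2 =
      ∑ i, ∑ j, π i * P i j * f i ^ 2 + ∑ i, ∑ j, π i * P i j * f j ^ 2
        - 2 * ∑ i, ∑ j, π i * P i j * (f i * f j) := by
    simp only [Finset.mul_sum, ← Finset.sum_add_distrib, ← Finset.sum_sub_distrib]
    exact Finset.sum_congr rfl fun i _ => Finset.sum_congr rfl fun j _ => by ring
  have h5 : ∑ i, π i * f i * (f i - P.mulVec f i) =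
      ∑ i, π i * f i ^ 2 - ∑ i, π i * f i * P.mulVec f i := by
    rw [← Finset.sum_sub_distrib]
    exact Finset.sum_congr rfl fun i _ => by ring
  rw [h4, h1, h2, h3, h5]
  ring

/-- A harmonic function has Dirichlet form zero, and every term of that form is nonnegative. -/
theorem eq_of_harmonic (h : IsReversibleChain P π) {f : S → ℝ} (hf : P.mulVec f = f) {i j : S}
    (hij : 0 < P i j) : f i = f j := by
  have h0 := h.sum_mul_sub_sq f
  rw [hf] at h0
  simp only [sub_self, mul_zero, Finset.sum_const_zero] at h0
  have hnn : ∀ i j, 0 ≤ π i * P i j * (f i - f j) ^ 2 := fun i j =>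
    mul_nonneg (mul_nonneg (h.pos i).le (h.nonneg i j)) (sq_nonneg _)
  have h1 := (Finset.sum_eq_zero_iff_of_nonneg fun i _ => Finset.sum_nonneg fun j _ => hnn i j).mp
    h0 i (Finset.mem_univ _)
  have h2 := (Finset.sum_eq_zero_iff_of_nonneg fun j _ => hnn i j).mp h1 j (Finset.mem_univ _)
  have h3 : π i * P i j ≠ 0 := (mul_pos (h.pos i) hij).ne'
  have h4 : (f i - f j) ^ 2 = 0 := (mul_eq_zero.mp h2).resolve_left h3
  exact sub_eq_zero.mp (pow_eq_zero_iff (two_ne_zero) |>.mp h4)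

theorem sum_mul_sq_pos (h : IsReversibleChain P π) {f : S → ℝ} (hf : f ≠ 0) :
    0 < ∑ i, π i * f i ^ 2 := by
  obtain ⟨i, hi⟩ := Function.ne_iff.mp hf
  refine Finset.sum_pos' (fun j _ => mul_nonneg (h.pos j).le (sq_nonneg _))
    ⟨i, Finset.mem_univ _, mul_pos (h.pos i) (sq_pos_of_ne_zero hi)⟩

/-- The Dirichlet form of `P * P` at an eigenvector is a positive multiple of `1 - μ ^ 2` and cannot
be negative. -/
theorem sq_eigenvalue_le_one (h : IsReversibleChain P π) {f : S → ℝ} (hf : f ≠ 0) {μ : ℝ}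
    (hμ : P.mulVec f = μ • f) : μ ^ 2 ≤ 1 := by
  have h2 : (P * P).mulVec f = μ ^ 2 • f := by
    rw [← Matrix.mulVec_mulVec, hμ, Matrix.mulVec_smul, hμ, smul_smul, pow_two]
  have h3 := h.sq.sum_mul_sub_sq f
  have h4 : 0 ≤ ∑ i, ∑ j, π i * (P * P) i j * (f i - f j) ^ 2 :=
    Finset.sum_nonneg fun i _ => Finset.sum_nonneg fun j _ =>
      mul_nonneg (mul_nonneg (h.pos i).le (h.sq.nonneg i j)) (sq_nonneg _)
  have h5 : ∑ i, π i * f i * (f i - (P * P).mulVec f i) =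
      (1 - μ ^ 2) * ∑ i, π i * f i ^ 2 := by
    rw [h2, Finset.mul_sum]
    exact Finset.sum_congr rfl fun i _ => by simp only [Pi.smul_apply, smul_eq_mul]; ring
  rw [h3, h5] at h4
  have := h.sum_mul_sq_pos hf
  by_contra hlt
  push Not at hlt
  nlinarith

/-- If the graph of `P * P` is connected, then `1` is the only eigenvalue of absolute value `1`,
and harmonic functions are constant. -/
theorem eq_const_of_sq_eq_one (h : IsReversibleChain P π)
    (hconn : ∀ f : S → ℝ, (∀ i j, 0 < (P * P) i j → f i = f j) → ∃ a, f = fun _ => a)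
    {f : S → ℝ} {μ : ℝ} (hμ : P.mulVec f = μ • f) (h1 : μ ^ 2 = 1) : ∃ a, f = fun _ => a := by
  refine hconn f fun i j hij => h.sq.eq_of_harmonic ?_ hij
  rw [← Matrix.mulVec_mulVec, hμ, Matrix.mulVec_smul, hμ, smul_smul, ← pow_two, h1, one_smul]

theorem abs_eigenvalue_lt_one (h : IsReversibleChain P π)
    (hconn : ∀ f : S → ℝ, (∀ i j, 0 < (P * P) i j → f i = f j) → ∃ a, f = fun _ => a)
    {f : S → ℝ} (hf : f ≠ 0) {μ : ℝ} (hμ : P.mulVec f = μ • f) (h1 : μ ≠ 1) : |μ| < 1 := by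
  rw [← sq_lt_one_iff_abs_lt_one]
  refine lt_of_le_of_ne (h.sq_eigenvalue_le_one hf hμ) fun hsq => h1 ?_
  obtain ⟨a, rfl⟩ := h.eq_const_of_sq_eq_one hconn hμ hsq
  obtain ⟨i, hi⟩ := Function.ne_iff.mp hf
  have h2 := congrFun hμ i
  simp only [Matrix.mulVec, dotProduct, Pi.smul_apply, smul_eq_mul] at h2
  rw [← Finset.sum_mul, h.sum_row, one_mul] at h2
  exact (mul_right_cancel₀ hi (by rw [← h2, one_mul])).symm

/-- Eigenvalues of a reversible chain are real, with real eigenvectors. -/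
theorem exists_real_eigenvector (h : IsReversibleChain P π) {μ : ℂ} {g : S → ℂ} (hg : g ≠ 0)
    (hμ : (P.map (algebraMap ℝ ℂ)).mulVec g = μ • g) :
    ∃ (m : ℝ) (f : S → ℝ), μ = m ∧ f ≠ 0 ∧ P.mulVec f = m • f := by
  -- `N` is the squared ℓ²(π)-norm of `g`. By detailed balance the form `⟨g, P g⟩ = μ N` is real, so
  -- μ is real. The real and imaginary parts of `g` are then annihilated by `P - μ`, and one of them
  -- is nonzero.
  set N : ℂ := ∑ i, (π i : ℂ) * (star (g i) * g i) with hN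
  have hNpos : N ≠ 0 := by
    have : N = ((∑ i, π i * ‖g i‖ ^ 2 : ℝ) : ℂ) := by
      rw [hN]
      push_cast
      refine Finset.sum_congr rfl fun i _ => ?_
      rw [Complex.star_def, Complex.conj_mul']
    rw [this, Complex.ofReal_ne_zero]
    obtain ⟨i, hi⟩ := Function.ne_iff.mp hg
    have hp : 0 < ∑ i, π i * ‖g i‖ ^ 2 :=
      Finset.sum_pos' (fun j _ => mul_nonneg (h.pos j).le (sq_nonneg _))
        ⟨i, Finset.mem_univ _, mul_pos (h.pos i) (pow_pos (norm_pos_iff.mpr hi) 2)⟩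
    exact hp.ne'
  have hE : ∑ i, ∑ j, ((π i * P i j : ℝ) : ℂ) * (star (g i) * g j) = μ * N := by
    rw [hN, Finset.mul_sum]
    refine Finset.sum_congr rfl fun i _ => ?_
    have h1 := congrFun hμ i
    simp only [Matrix.mulVec, dotProduct, Matrix.map_apply, Pi.smul_apply, smul_eq_mul,
      Complex.coe_algebraMap] at h1
    calc ∑ j, ((π i * P i j : ℝ) : ℂ) * (star (g i) * g j)
        = (π i : ℂ) * star (g i) * ∑ j, (P i j : ℂ) * g j := by
          rw [Finset.mul_sum]
          refine Finset.sum_congr rfl fun j _ => ?_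
          push_cast
          ring
      _ = _ := by rw [h1]; ring
  have hEs : star (∑ i, ∑ j, ((π i * P i j : ℝ) : ℂ) * (star (g i) * g j)) =
      ∑ i, ∑ j, ((π i * P i j : ℝ) : ℂ) * (star (g i) * g j) := by
    rw [star_sum]
    simp only [star_sum]
    rw [Finset.sum_comm]
    refine Finset.sum_congr rfl fun i _ => Finset.sum_congr rfl fun j _ => ?_
    rw [h.balance j i]
    simp only [star_mul', Complex.conj_conj, Complex.star_def, Complex.conj_ofReal]
    ring
  have hNs : star N = N := by
    rw [hN, star_sum]
    refine Finset.sum_congr rfl fun i _ => ?_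
    simp only [star_mul', Complex.conj_conj, Complex.star_def, Complex.conj_ofReal]
    ring
  rw [hE, star_mul', hNs] at hEs
  have hreal := mul_right_cancel₀ hNpos hEs
  obtain ⟨m, rfl⟩ := Complex.conj_eq_iff_real.mp hreal
  have hre : P.mulVec (fun i => (g i).re) = m • fun i => (g i).re := by
    funext i
    have := congrArg Complex.re (congrFun hμ i)
    simpa [Matrix.mulVec, dotProduct] using this
  have him : P.mulVec (fun i => (g i).im) = m • fun i => (g i).im := by
    funext i
    have := congrArg Complex.im (congrFun hμ i)
    simpa [Matrix.mulVec, dotProduct] using this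
  by_cases hz : (fun i => (g i).re) = 0
  · refine ⟨m, _, rfl, fun hz' => hg ?_, him⟩
    funext i
    exact Complex.ext (congrFun hz i) (congrFun hz' i)
  · exact ⟨m, _, rfl, hz, hre⟩

theorem hasEigenvalue_complexEnd {f : S → ℝ} (hf : f ≠ 0) {m : ℝ} (hm : P.mulVec f = m • f) :
    (complexEnd P).HasEigenvalue (m : ℂ) := by
  refine Module.End.hasEigenvalue_of_hasEigenvector (x := fun i => (f i : ℂ)) ⟨?_, ?_⟩
  · rw [Module.End.mem_eigenspace_iff]
    funext i
    have := congrArg (fun x : ℝ => (x : ℂ)) (congrFun hm i)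
    simpa [complexEnd, Matrix.mulVec, dotProduct] using this
  · intro h0
    apply hf
    funext i
    simpa using congrFun h0 i

end IsReversibleChain

end Reversible

/-! ### Spectral contraction and mixing times of reversible chains -/

section Reversible

variable {S : Type} [Fintype S] [DecidableEq S]

namespace IsReversibleChain

variable {P : Matrix S S ℝ} {π : S → ℝ}

theorem sqrt_pos (h : IsReversibleChain P π) (i : S) : 0 < √(π i) := Real.sqrt_pos.mpr (h.pos i)

theorem sqrt_mul_sqrt (h : IsReversibleChain P π) (i : S) : √(π i) * √(π i) = π i :=
  Real.mul_self_sqrt (h.pos i).le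

/-- The symmetric matrix conjugate to a reversible chain. -/
theorem isHermitian (h : IsReversibleChain P π) :
    (Matrix.of fun i j => √(π i) * P i j / √(π j) : Matrix S S ℝ).IsHermitian := by
  ext i j
  simp only [Matrix.conjTranspose_apply, Matrix.of_apply, star_trivial]
  rw [div_eq_div_iff (h.sqrt_pos i).ne' (h.sqrt_pos j).ne']
  linear_combination h.balance j i + P j i * h.sqrt_mul_sqrt j - P i j * h.sqrt_mul_sqrt i

/-- `P` contracts the `ℓ²(π)`-norm by the factor `r` on every `f` orthogonal to all
eigenvectors whose eigenvalue exceeds `r` in absolute value. -/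
theorem sum_mul_mulVec_sq_le (h : IsReversibleChain P π) {r : ℝ} {f : S → ℝ}
    (hf : ∀ (b : S → ℝ) (μ : ℝ), P.mulVec b = μ • b → r < |μ| → ∑ i, π i * b i * f i = 0) :
    ∑ i, π i * P.mulVec f i ^ 2 ≤ r ^ 2 * ∑ i, π i * f i ^ 2 := by
  have hA := h.isHermitian
  set A : Matrix S S ℝ := Matrix.of fun i j => √(π i) * P i j / √(π j) with hAdef
  let B := hA.eigenvectorBasis
  have hinner : ∀ (x y : EuclideanSpace ℝ S), inner ℝ x y = ∑ i, x i * y i := fun x y => by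
    simp [PiLp.inner_apply, mul_comm]
  have hBeig : ∀ l i, ∑ j, √(π i) * P i j / √(π j) * B l j = hA.eigenvalues l * B l i := by
    intro l i
    have := congrFun (hA.mulVec_eigenvectorBasis l) i
    simpa [Matrix.mulVec, dotProduct, hAdef] using this
  -- Parseval: multiplying by √π turns the ℓ²(π)-norm into the Euclidean one.
  have hnorm : ∀ F : S → ℝ, ∑ l, (∑ i, B l i * (√(π i) * F i)) ^ 2 = ∑ i, π i * F i ^ 2 := by
    intro F
    have h1 := B.sum_sq_norm_inner_right (WithLp.toLp 2 fun i => √(π i) * F i)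
    rw [EuclideanSpace.norm_sq_eq] at h1
    simp only [hinner, Real.norm_eq_abs, sq_abs] at h1
    rw [h1]
    refine Finset.sum_congr rfl fun i _ => ?_
    rw [mul_pow, pow_two √(π i), h.sqrt_mul_sqrt]
  have hstep : ∀ l, ∑ i, B l i * (√(π i) * P.mulVec f i) =
      hA.eigenvalues l * ∑ i, B l i * (√(π i) * f i) := by
    intro l
    rw [Finset.mul_sum]
    simp only [Matrix.mulVec, dotProduct, Finset.mul_sum]
    rw [Finset.sum_comm]
    refine Finset.sum_congr rfl fun j _ => ?_
    rw [← mul_assoc, ← hBeig, Finset.sum_mul]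
    refine Finset.sum_congr rfl fun i _ => ?_
    have hsi := (h.sqrt_pos i).ne'
    field_simp
    linear_combination B l i * f j * (h.balance i j + P i j * h.sqrt_mul_sqrt i
      - P j i * h.sqrt_mul_sqrt j)
  rw [← hnorm, ← hnorm, Finset.mul_sum]
  refine Finset.sum_le_sum fun l _ => ?_
  rw [hstep, mul_pow]
  by_cases hl : r < |hA.eigenvalues l|
  · have h0 := hf (fun i => B l i / √(π i)) (hA.eigenvalues l) (by
      funext i
      have h1 := hBeig l i
      simp only [Matrix.mulVec, dotProduct, Pi.smul_apply, smul_eq_mul]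
      rw [mul_div_assoc', eq_div_iff (h.sqrt_pos i).ne', ← h1, Finset.sum_mul]
      exact Finset.sum_congr rfl fun j _ => by ring) hl
    have h2 : ∑ i, B l i * (√(π i) * f i) = 0 := by
      rw [← h0]
      refine Finset.sum_congr rfl fun i _ => ?_
      have hsi := (h.sqrt_pos i).ne'
      field_simp
      linear_combination B l i * f i * h.sqrt_mul_sqrt i
    rw [h2]
    simp
  · push Not at hl
    refine mul_le_mul_of_nonneg_right ?_ (sq_nonneg _)
    rw [← sq_abs]
    exact pow_le_pow_left₀ (abs_nonneg _) hl 2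

theorem sum_mul_mulVec (h : IsReversibleChain P π) (b f : S → ℝ) :
    ∑ i, π i * b i * P.mulVec f i = ∑ i, π i * P.mulVec b i * f i := by
  simp only [Matrix.mulVec, dotProduct, Finset.mul_sum, Finset.sum_mul]
  rw [Finset.sum_comm]
  refine Finset.sum_congr rfl fun i _ => Finset.sum_congr rfl fun j _ => ?_
  linear_combination b j * f i * h.balance j i

/-- The one-step contraction iterates because `P` is self-adjoint on ℓ²(π): `P f` is orthogonal to
the same eigenvectors as `f`. -/
theorem sum_mul_pow_mulVec_sq_le (h : IsReversibleChain P π) {r : ℝ} (t : ℕ) :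
    ∀ {f : S → ℝ},
    (∀ (b : S → ℝ) (μ : ℝ), P.mulVec b = μ • b → r < |μ| → ∑ i, π i * b i * f i = 0) →
    ∑ i, π i * (P ^ t).mulVec f i ^ 2 ≤ (r ^ 2) ^ t * ∑ i, π i * f i ^ 2 := by
  induction t with
  | zero => intro f _; simp
  | succ t ih =>
    intro f hf
    rw [pow_succ P, ← Matrix.mulVec_mulVec, pow_succ]
    refine (ih (f := P.mulVec f) fun b μ hb hμ => ?_).trans ?_
    · rw [h.sum_mul_mulVec, hb]
      simp only [Pi.smul_apply, smul_eq_mul]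
      have := hf b μ hb hμ
      calc ∑ i, π i * (μ * b i) * f i = μ * ∑ i, π i * b i * f i := by
            rw [Finset.mul_sum]; exact Finset.sum_congr rfl fun i _ => by ring
        _ = 0 := by rw [this, mul_zero]
    · rw [mul_assoc]
      exact mul_le_mul_of_nonneg_left (h.sum_mul_mulVec_sq_le hf) (by positivity)

/-- By detailed balance, densities with respect to π evolve by the action of `P` on functions. -/
theorem vecMul_pow (h : IsReversibleChain P π) (t : ℕ) (g : S → ℝ) :
    Matrix.vecMul (fun i => π i * g i) (P ^ t) = fun i => π i * (P ^ t).mulVec g i := by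
  induction t generalizing g with
  | zero => simp
  | succ t ih =>
    have h1 : Matrix.vecMul (fun i => π i * g i) P = fun i => π i * P.mulVec g i := by
      funext j
      simp only [Matrix.vecMul, Matrix.mulVec, dotProduct, Finset.mul_sum]
      exact Finset.sum_congr rfl fun i _ => by linear_combination g i * h.balance i j
    rw [pow_succ' P, ← Matrix.vecMul_vecMul, h1, ih, Matrix.mulVec_mulVec, ← pow_succ,
      ← pow_succ']

theorem pow_mulVec_one (h : IsReversibleChain P π) (t : ℕ) : (P ^ t).mulVec 1 = 1 := by
  induction t with
  | zero => simp
  | succ t ih => rw [pow_succ, ← Matrix.mulVec_mulVec, h.mulVec_one, ih]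

/-- The spectral bound for the distance from stationarity after `t` steps. -/
theorem tvDist_sq_le (h : IsReversibleChain P π) {r m : ℝ} (hm : 0 < m)
    (hmπ : ∀ i, m ≤ π i) {ν : S → ℝ} (hν : IsDist ν)
    (hspec : ∀ (b : S → ℝ) (μ : ℝ), P.mulVec b = μ • b → r < |μ| →
      ∑ i, b i * ν i = ∑ i, b i * π i) (t : ℕ) :
    (2 * tvDist (Matrix.vecMul ν (P ^ t)) π) ^ 2 ≤ (r ^ 2) ^ t / m := by
  -- The relative density minus 1. The hypothesis on ν says that `f` is orthogonal to all
  -- eigenvectors beyond `r`, so ℓ²-contraction applies to it.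
  set f : S → ℝ := fun i => ν i / π i - 1 with hfdef
  have hπf : ∀ i, π i * f i = ν i - π i := fun i => by
    have := (h.pos i).ne'
    simp only [hfdef]
    field_simp
  have hf : ∀ (b : S → ℝ) (μ : ℝ), P.mulVec b = μ • b → r < |μ| →
      ∑ i, π i * b i * f i = 0 := by
    intro b μ hb hμ
    have : ∑ i, π i * b i * f i = ∑ i, b i * ν i - ∑ i, b i * π i := by
      rw [← Finset.sum_sub_distrib]
      exact Finset.sum_congr rfl fun i _ => by linear_combination b i * hπf i
    rw [this, hspec b μ hb hμ, sub_self]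
  have hF : ∀ j, Matrix.vecMul ν (P ^ t) j - π j = π j * (P ^ t).mulVec f j := by
    intro j
    have h1 : ν = fun i => π i * (f + 1) i := by
      funext i
      simp only [Pi.add_apply, Pi.one_apply]
      linear_combination -hπf i
    rw [h1, h.vecMul_pow, Matrix.mulVec_add, h.pow_mulVec_one]
    simp only [Pi.add_apply, Pi.one_apply]
    ring
  set F := (P ^ t).mulVec f with hFdef
  have htv : 2 * tvDist (Matrix.vecMul ν (P ^ t)) π = ∑ i, π i * |F i| := by
    rw [tvDist, ← mul_assoc]
    norm_num
    refine Finset.sum_congr rfl fun i _ => ?_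
    rw [hF, abs_mul, abs_of_pos (h.pos i)]
  have hjensen : (∑ i, π i * |F i|) ^ 2 ≤ ∑ i, π i * F i ^ 2 := by
    obtain ⟨c, hc⟩ : ∃ c, c = ∑ i, π i * |F i| := ⟨_, rfl⟩
    have h0 : 0 ≤ ∑ i, π i * (|F i| - c) ^ 2 :=
      Finset.sum_nonneg fun i _ => mul_nonneg (h.pos i).le (sq_nonneg _)
    have h1 : ∑ i, π i * (|F i| - c) ^ 2 =
        ∑ i, π i * F i ^ 2 - 2 * c * ∑ i, π i * |F i| + c ^ 2 * ∑ i, π i := by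
      rw [Finset.mul_sum, Finset.mul_sum, ← Finset.sum_sub_distrib, ← Finset.sum_add_distrib]
      refine Finset.sum_congr rfl fun i _ => ?_
      rw [← sq_abs (F i)]
      ring
    rw [h1, h.sum_dist, ← hc] at h0
    rw [← hc]
    linarith
  -- The squared norm of `f` is `∑ ν i ^ 2 / π i - 1`, and `ν i ≤ 1` bounds it by `1 / m - 1`.
  have hinit : ∑ i, π i * f i ^ 2 ≤ 1 / m := by
    have h1 : ∀ i, π i * f i ^ 2 ≤ ν i / m - 2 * ν i + π i := by
      intro i
      have hp := (h.pos i).ne'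
      have hle : ν i ≤ 1 := by
        rw [← hν.2]
        exact Finset.single_le_sum (fun j _ => hν.1 j) (Finset.mem_univ i)
      have h2 : π i * f i ^ 2 = ν i * ν i / π i - 2 * ν i + π i := by
        simp only [hfdef]
        field_simp
        ring
      have h3 : ν i * ν i / π i ≤ ν i / m :=
        div_le_div₀ (hν.1 i) (by nlinarith [hν.1 i]) hm (hmπ i)
      linarith
    refine (Finset.sum_le_sum fun i _ => h1 i).trans ?_
    rw [Finset.sum_add_distrib, Finset.sum_sub_distrib, ← Finset.mul_sum, ← Finset.sum_div,
      hν.2, h.sum_dist]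
    linarith
  rw [htv]
  refine hjensen.trans ((h.sum_mul_pow_mulVec_sq_le t hf).trans ?_)
  rw [div_eq_mul_one_div]
  exact mul_le_mul_of_nonneg_left hinit (by positivity)

theorem iInf_pos [Nonempty S] (h : IsReversibleChain P π) : 0 < ⨅ i, π i := by
  obtain ⟨i, hi⟩ := exists_eq_ciInf_of_finite (f := π)
  rw [← hi]
  exact h.pos i

/-- The factor 1/2 is what lets the rounding loss in `pow_floor_mixBound_le` be absorbed. -/
theorem iInf_le_half [Nontrivial S] (h : IsReversibleChain P π) : ⨅ i, π i ≤ 1 / 2 := by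
  obtain ⟨i, j, hij⟩ := exists_pair_ne S
  have hbdd : BddBelow (Set.range π) := (Set.finite_range π).bddBelow
  have h1 : π i + π j ≤ 1 := by
    rw [← Finset.sum_pair hij, ← h.sum_dist]
    exact Finset.sum_le_sum_of_subset_of_nonneg (Finset.subset_univ _) fun l _ _ => (h.pos l).le
  linarith [ciInf_le hbdd i, ciInf_le hbdd j]

end IsReversibleChain

theorem mixBound_nonneg {r ε m : ℝ} (hr1 : r < 1) (hε : 0 < ε) (hε1 : ε ≤ 1) (hm : 0 < m)
    (hm2 : m ≤ 1 / 2) : 0 ≤ mixBound r ε m := by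
  refine mul_nonneg (div_nonneg zero_le_one (by linarith)) (Real.log_nonneg ?_)
  rw [le_div_iff₀ (mul_pos hε hm)]
  nlinarith

/-- From `r ≤ exp (-(1 - r))` and `t > B - 1` one gets `r ^ (2t) ≤ e² (ε m)²`. As `e² ≤ 8` and `m ≤
1/2`, dividing by `m` leaves at most `4 ε²`. -/
theorem pow_floor_mixBound_le {r ε m : ℝ} (hr0 : 0 ≤ r) (hr1 : r < 1) (hε : 0 < ε)
    (hm : 0 < m) (hm2 : m ≤ 1 / 2) :
    (r ^ 2) ^ ⌊mixBound r ε m⌋₊ / m ≤ (2 * ε) ^ 2 := by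
  set B := mixBound r ε m with hB
  set t := ⌊B⌋₊
  have ht : B < t + 1 := Nat.lt_floor_add_one B
  have hr : 0 < 1 - r := by linarith
  have hBr : (1 - r) * B = -Real.log (ε * m) := by
    rw [hB, mixBound, one_div (ε * m), Real.log_inv]
    field_simp
  have h1 : r ^ 2 ≤ Real.exp (-(2 * (1 - r))) := by
    have : r ≤ Real.exp (-(1 - r)) := by linarith [Real.add_one_le_exp (-(1 - r))]
    calc r ^ 2 ≤ Real.exp (-(1 - r)) ^ 2 := pow_le_pow_left₀ hr0 this 2
      _ = _ := by rw [← Real.exp_nat_mul]; congr 1; push_cast; ring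
  have h2 : (r ^ 2) ^ t ≤ Real.exp 2 * (ε * m) ^ 2 := by
    calc (r ^ 2) ^ t ≤ Real.exp (-(2 * (1 - r))) ^ t := pow_le_pow_left₀ (sq_nonneg r) h1 t
      _ = Real.exp (t * -(2 * (1 - r))) := by rw [← Real.exp_nat_mul]
      _ ≤ Real.exp (2 + (Real.log (ε * m) + Real.log (ε * m))) := by
          refine Real.exp_le_exp.mpr ?_
          nlinarith
      _ = _ := by
          rw [Real.exp_add, Real.exp_add, Real.exp_log (mul_pos hε hm)]
          ring
  have h3 : Real.exp 2 ≤ 8 := by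
    have h4 := Real.exp_one_lt_d9
    have h5 : Real.exp 2 = Real.exp 1 * Real.exp 1 := by rw [← Real.exp_add]; norm_num
    rw [h5]
    nlinarith [Real.exp_pos 1]
  rw [div_le_iff₀ hm]
  have h6 : 0 ≤ ε ^ 2 * m := by positivity
  calc (r ^ 2) ^ t ≤ Real.exp 2 * (ε * m) ^ 2 := h2
    _ ≤ 8 * (ε * m) ^ 2 := mul_le_mul_of_nonneg_right h3 (by positivity)
    _ = 8 * m * (ε ^ 2 * m) := by ring
    _ ≤ 4 * (ε ^ 2 * m) := mul_le_mul_of_nonneg_right (by linarith) h6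
    _ = _ := by ring

theorem exists_isLeast_le_of_floor {A : Set ℕ} {B : ℝ} (hB : 0 ≤ B) (h : ⌊B⌋₊ ∈ A) :
    ∃ t, IsLeast A t ∧ (t : ℝ) ≤ B :=
  ⟨sInf A, ⟨Nat.sInf_mem ⟨_, h⟩, fun _ hs => Nat.sInf_le hs⟩,
    (Nat.cast_le.mpr (Nat.sInf_le h)).trans (Nat.floor_le hB)⟩

namespace IsReversibleChain

variable {P : Matrix S S ℝ} {π : S → ℝ}

theorem tvDist_floor_mixBound_le [Nontrivial S] (h : IsReversibleChain P π) {r ε : ℝ}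
    (hr0 : 0 ≤ r) (hr1 : r < 1) (hε : 0 < ε) {ν : S → ℝ} (hν : IsDist ν)
    (hspec : ∀ (b : S → ℝ) (μ : ℝ), P.mulVec b = μ • b → r < |μ| →
      ∑ i, b i * ν i = ∑ i, b i * π i) :
    tvDist (Matrix.vecMul ν (P ^ ⌊mixBound r ε (⨅ i, π i)⌋₊)) π ≤ ε := by
  have h1 := h.tvDist_sq_le h.iInf_pos (ciInf_le (Set.finite_range π).bddBelow) hν hspec
    ⌊mixBound r ε (⨅ i, π i)⌋₊
  have h2 := (abs_le.mp (abs_le_of_sq_le_sq (h1.trans (pow_floor_mixBound_le hr0 hr1 hε h.iInf_pos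
    h.iInf_le_half)) (by positivity))).2
  linarith

/-- The mixing time of a reversible chain whose eigenvectors with eigenvalue larger than `r` in
absolute value are constant. -/
theorem exists_isMixingTime [Nontrivial S] (h : IsReversibleChain P π) {r ε : ℝ}
    (hr0 : 0 ≤ r) (hr1 : r < 1) (hε : 0 < ε) (hε1 : ε ≤ 1)
    (hspec : ∀ (b : S → ℝ) (μ : ℝ), P.mulVec b = μ • b → r < |μ| → ∃ a, b = fun _ => a) :
    ∃ t : ℕ, IsMixingTime P π ε t ∧ (t : ℝ) ≤ mixBound r ε (⨅ i, π i) := by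
  refine exists_isLeast_le_of_floor (mixBound_nonneg hr1 hε hε1 h.iInf_pos h.iInf_le_half) ?_
  intro i
  have h1 : IsDist (Pi.single i 1 : S → ℝ) :=
    ⟨fun j => by by_cases hj : j = i <;> simp [hj], by simp⟩
  have h2 := h.tvDist_floor_mixBound_le hr0 hr1 hε h1 fun b μ hb hμ => by
    obtain ⟨a, rfl⟩ := hspec b μ hb hμ
    rw [← Finset.mul_sum, ← Finset.mul_sum, h1.2, h.sum_dist]
  rwa [Matrix.single_one_vecMul] at h2

/-- A reversible chain on more than one state with constant harmonic functions has an eigenvalue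
other than `1`. -/
theorem exists_eigenvalue_ne_one [Nontrivial S] (h : IsReversibleChain P π)
    (hharm : ∀ f : S → ℝ, P.mulVec f = f → ∃ a, f = fun _ => a) :
    ∃ (μ : ℝ) (f : S → ℝ), μ ≠ 1 ∧ f ≠ 0 ∧ P.mulVec f = μ • f := by
  by_contra hno
  push Not at hno
  obtain ⟨i, j, hij⟩ := exists_pair_ne S
  -- A nonzero function orthogonal to the constants. If 1 were the only eigenvalue, contraction with
  -- `r = 0` would give `P f = 0`, making `f` an eigenvector for 0.
  let f : S → ℝ := Pi.single i (π j) - Pi.single j (π i)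
  have hfi : f i = π j := by simp [f, hij]
  have hf0 : f ≠ 0 := fun h0 => (h.pos j).ne' (by rw [← hfi, h0]; rfl)
  have hsum : ∑ l, π l * f l = 0 := by
    simp [f, mul_sub, Finset.sum_sub_distrib, Pi.single_apply]
    ring
  have h1 := h.sum_mul_mulVec_sq_le (r := 0) (f := f) fun b μ hb hμ => by
    have hb1 : ∃ a, b = fun _ => a := by
      by_cases hb0 : b = 0
      · exact ⟨0, by rw [hb0]; rfl⟩
      · refine hharm b ?_
        by_cases hμ1 : μ = 1
        · rw [hb, hμ1, one_smul]
        · exact absurd hb (hno μ b hμ1 hb0)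
    obtain ⟨a, rfl⟩ := hb1
    calc ∑ l, π l * a * f l = a * ∑ l, π l * f l := by
          rw [Finset.mul_sum]; exact Finset.sum_congr rfl fun l _ => by ring
      _ = 0 := by rw [hsum, mul_zero]
  have h2 : P.mulVec f = (0 : ℝ) • f := by
    by_contra hne
    rw [zero_smul] at hne
    have := h.sum_mul_sq_pos hne
    simp only [ne_eq, OfNat.ofNat_ne_zero, not_false_eq_true, zero_pow, zero_mul] at h1
    linarith
  exact hno 0 f zero_ne_one hf0 h2

/-- A reversible chain `P` such that the graph of `P * P` is connected is irreducible. -/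
theorem isIrreducible (h : IsReversibleChain P π)
    (hconn : ∀ f : S → ℝ, (∀ i j, 0 < (P * P) i j → f i = f j) → ∃ a, f = fun _ => a) :
    P.IsIrreducible := by
  classical
  rw [Matrix.isIrreducible_iff_exists_pow_pos h.nonneg]
  intro i j
  have hstep : ∀ a b, 0 < (P * P) a b → (∃ k, 0 < ((P * P) ^ k) i a) →
      ∃ k, 0 < ((P * P) ^ k) i b := by
    rintro a b hab ⟨k, hk⟩
    refine ⟨k + 1, ?_⟩
    rw [pow_succ, Matrix.mul_apply]
    exact Finset.sum_pos' (fun l _ => mul_nonneg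
      (Matrix.pow_apply_nonneg h.sq.nonneg k i l) (h.sq.nonneg l b))
      ⟨a, Finset.mem_univ _, mul_pos hk hab⟩
  have hsymm : ∀ a b, 0 < (P * P) a b → 0 < (P * P) b a := by
    intro a b hab
    have h1 := h.sq.balance a b
    have h2 := mul_pos (h.pos a) hab
    rw [h1] at h2
    exact pos_of_mul_pos_right h2 (h.pos b).le
  -- The indicator of the states reachable from `i` by powers of `P * P` is constant along the
  -- edges, as these are symmetric. Hence it is constant, with value 1 at `i` itself.
  obtain ⟨c, hc⟩ := hconn (fun l => if ∃ k, 0 < ((P * P) ^ k) i l then 1 else 0) fun a b hab => by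
    have : (∃ k, 0 < ((P * P) ^ k) i a) ↔ ∃ k, 0 < ((P * P) ^ k) i b :=
      ⟨hstep a b hab, hstep b a (hsymm a b hab)⟩
    simp only [this]
  have hi := congrFun hc i
  have hj := congrFun hc j
  rw [if_pos ⟨0, by simp⟩] at hi
  have hij : ∃ k, 0 < ((P * P) ^ k) i j := by
    by_contra hno
    rw [if_neg hno, ← hi] at hj
    exact zero_ne_one hj
  obtain ⟨k, hk⟩ := hij
  -- Irreducibility asks for a positive exponent. When `k = 0` the states agree, and a step to some
  -- neighbour and back takes time 2.
  rcases Nat.eq_zero_or_pos k with rfl | hk0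
  · have hij : i = j := by
      by_contra hne
      rw [pow_zero, Matrix.one_apply_ne hne] at hk
      exact hk.false
    subst hij
    refine ⟨2, two_pos, ?_⟩
    rw [pow_two, Matrix.mul_apply]
    have h1 : ∃ l, 0 < P i l := by
      by_contra hno
      push Not at hno
      have := Finset.sum_nonpos fun l (_ : l ∈ Finset.univ) => hno l
      rw [h.sum_row] at this
      linarith
    obtain ⟨l, hl⟩ := h1
    refine Finset.sum_pos' (fun l _ => mul_nonneg (h.nonneg _ _) (h.nonneg _ _))
      ⟨l, Finset.mem_univ _, mul_pos hl ?_⟩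
    have h2 := mul_pos (h.pos i) hl
    rw [h.balance i l] at h2
    exact pos_of_mul_pos_right h2 (h.pos l).le
  · refine ⟨2 * k, by omega, ?_⟩
    rwa [pow_mul, pow_two]

/-- The largest absolute value of an eigenvalue other than `1`. -/
theorem exists_isGreatest_nontrivialModuli [Nontrivial S] (h : IsReversibleChain P π)
    (hconn : ∀ f : S → ℝ, (∀ i j, 0 < (P * P) i j → f i = f j) → ∃ a, f = fun _ => a) :
    ∃ r, IsGreatest (nontrivialModuli P) r ∧ 0 ≤ r ∧ r < 1 ∧
      ∀ (f : S → ℝ) (μ : ℝ), P.mulVec f = μ • f → r < |μ| → f = 0 ∨ μ = 1 ∧ ∃ a, f = fun _ => a := by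
  have hharm : ∀ f : S → ℝ, P.mulVec f = f → ∃ a, f = fun _ => a := fun f hf =>
    h.eq_const_of_sq_eq_one hconn (μ := 1) (by rw [hf, one_smul]) (one_pow 2)
  have hfin : (nontrivialModuli P).Finite := by
    refine ((Module.End.finite_hasEigenvalue (complexEnd P)).image norm).subset ?_
    rintro _ ⟨μ, hμ, _, rfl⟩
    exact ⟨μ, hμ, rfl⟩
  have hreal : ∀ {μ : ℝ} {f : S → ℝ}, f ≠ 0 → P.mulVec f = μ • f → μ ≠ 1 →
      |μ| ∈ nontrivialModuli P := by
    intro μ f hf hμ h1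
    refine ⟨μ, hasEigenvalue_complexEnd hf hμ, ?_, ?_⟩
    · exact_mod_cast h1
    · rw [Complex.norm_real, Real.norm_eq_abs]
  obtain ⟨μ, f, h1, hf, hμ⟩ := h.exists_eigenvalue_ne_one hharm
  obtain ⟨r, hr, hmax⟩ := hfin.exists_maximalFor id _ ⟨_, hreal hf hμ h1⟩
  have hle : ∀ s ∈ nontrivialModuli P, s ≤ r := fun s hs => by
    by_contra hlt
    push Not at hlt
    exact absurd (hmax hs hlt.le) (not_le.mpr hlt)
  refine ⟨r, ⟨hr, hle⟩, ?_, ?_, ?_⟩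
  · obtain ⟨ν, _, _, rfl⟩ := hr
    exact norm_nonneg ν
  · obtain ⟨ν, hν, hν1, rfl⟩ := hr
    obtain ⟨g, hg⟩ := hν.exists_hasEigenvector
    obtain ⟨m, f', rfl, hf', hm⟩ := h.exists_real_eigenvector hg.2 (by
      have := hg.apply_eq_smul
      rwa [complexEnd, Matrix.toLin'_apply] at this)
    rw [Complex.norm_real, Real.norm_eq_abs]
    exact h.abs_eigenvalue_lt_one hconn hf' hm (by exact_mod_cast hν1)
  · intro f μ hf hμ
    by_cases hf0 : f = 0
    · exact Or.inl hf0
    · by_cases hμ1 : μ = 1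
      · exact Or.inr ⟨hμ1, hharm f (by rw [hf, hμ1, one_smul])⟩
      · exact absurd (hle _ (hreal hf0 hf hμ1)) (not_le.mpr hμ)

end IsReversibleChain

end Reversible

/-! ### Symmetries of the fusion rules -/

theorem fusion_comm (p i n j : ℕ) : fusion p i n j = fusion p j n i := by
  unfold fusion
  split_ifs <;> omega

/-- The substitution exchanges the first two inequalities of the rule, and also the last two; the
two label sums differ by an even number. -/
theorem fusion_sub_left {p i n : ℕ} (hi : i < p) (hn : n < p) (j : ℕ) :
    fusion p (p - i) n j = fusion p i (p - n) j := by
  unfold fusion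
  split_ifs <;> omega

theorem fusion_sub_right {p n j : ℕ} (hn : n < p) (hj : j < p) (i : ℕ) :
    fusion p i n (p - j) = fusion p i (p - n) j := by
  rw [fusion_comm, fusion_sub_left hj hn, fusion_comm]

theorem fusion_sub_sub {p i n j : ℕ} (hi : i < p) (hj : j < p) :
    fusion p (p - i) n (p - j) = fusion p i n j := by
  unfold fusion
  split_ifs <;> omega

theorem fusion_eq_zero {p i n j : ℕ} (h : (i + n + j) % 2 ≠ 1) : fusion p i n j = 0 :=
  if_neg fun h' => h h'.1

theorem State.one_le {p : ℕ} (i : State p) : 1 ≤ (i : ℕ) := (Finset.mem_Icc.mp i.2).1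

theorem State.lt {p : ℕ} (i : State p) : (i : ℕ) < p := by
  have := Finset.mem_Icc.mp i.2
  omega

theorem HalfIdx.one_le {p : ℕ} (i : HalfIdx p) : 1 ≤ (i : ℕ) := (Finset.mem_Icc.mp i.2).1

theorem HalfIdx.two_mul_lt {p : ℕ} (i : HalfIdx p) : 2 * (i : ℕ) < p := by
  have := Finset.mem_Icc.mp i.2
  omega

@[simp] theorem coe_flipState {p : ℕ} (i : State p) : (flipState p i : ℕ) = p - i := rfl

@[simp] theorem coe_oddState {p : ℕ} (i : HalfIdx p) : (oddState i : ℕ) = 2 * i - 1 := rfl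

@[simp] theorem coe_coState {p : ℕ} (i : HalfIdx p) : (coState i : ℕ) = p + 1 - 2 * i := rfl

theorem flipState_flipState {p : ℕ} (i : State p) : flipState p (flipState p i) = i := by
  have := i.lt
  apply Subtype.ext
  simp only [coe_flipState]
  omega

theorem flipState_oddState {p : ℕ} (i : HalfIdx p) : flipState p (oddState i) = coState i := by
  have := i.one_le
  have := i.two_mul_lt
  apply Subtype.ext
  simp only [coe_flipState, coe_oddState, coe_coState]
  omega

theorem flipState_coState {p : ℕ} (i : HalfIdx p) : flipState p (coState i) = oddState i := by
  rw [← flipState_oddState, flipState_flipState]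

theorem flipMatrix_mul_apply {p : ℕ} (A : Matrix (State p) (State p) ℝ) (i j : State p) :
    (flipMatrix p * A) i j = A (flipState p i) j := by
  rw [Matrix.mul_apply, Finset.sum_eq_single (flipState p i)]
  · have := i.lt
    rw [flipMatrix, Matrix.of_apply, if_pos (by rw [coe_flipState]; omega), one_mul]
  · intro l _ hl
    have := i.lt
    simp only [flipMatrix, Matrix.of_apply]
    rw [if_neg, zero_mul]
    intro h
    apply hl
    apply Subtype.ext
    simp only [coe_flipState]
    omega
  · exact fun h => absurd (Finset.mem_univ _) h

theorem mul_flipMatrix_apply {p : ℕ} (A : Matrix (State p) (State p) ℝ) (i j : State p) :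
    (A * flipMatrix p) i j = A i (flipState p j) := by
  rw [Matrix.mul_apply, Finset.sum_eq_single (flipState p j)]
  · have := j.lt
    rw [flipMatrix, Matrix.of_apply, if_pos (by rw [coe_flipState]; omega), mul_one]
  · intro l _ hl
    have := j.lt
    simp only [flipMatrix, Matrix.of_apply]
    rw [if_neg, mul_zero]
    intro h
    apply hl
    apply Subtype.ext
    simp only [coe_flipState]
    omega
  · exact fun h => absurd (Finset.mem_univ _) h

/-! ### The walk attached to the fusion rules -/

/-- The total weight of the states that can be reached from `i`. -/
def fusionTotal (p : ℕ) (v : State p → ℝ) (n : ℕ) (i : State p) : ℝ :=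
  ∑ l : State p, v l * fusion p i n l

/-- The random walk on the states given by the fusion rules and the weight `v`. -/
def fusionWalk (p : ℕ) (v : State p → ℝ) (n : ℕ) : Matrix (State p) (State p) ℝ :=
  Matrix.of fun i j => v j * fusion p i n j / fusionTotal p v n i

/-- The distribution proportional to `v i * fusionTotal p v n i`. -/
def fusionDist (p : ℕ) (v : State p → ℝ) (n : ℕ) (i : State p) : ℝ :=
  v i * fusionTotal p v n i / ∑ x, v x * fusionTotal p v n x

section FusionWalk

variable {p n : ℕ} {v : State p → ℝ}

theorem fusionTotal_pos (hn : 1 ≤ n) (hnp : n < p) (hv : ∀ i, 0 < v i) (i : State p) :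
    0 < fusionTotal p v n i := by
  have h1 := i.one_le
  have h2 := i.lt
  -- The least label allowed by the triangle inequalities is `|i - n| + 1`, and it always passes the
  -- cutoff.
  obtain ⟨l, hl1, hl2, hl⟩ : ∃ l, 1 ≤ l ∧ l ≤ p - 1 ∧ fusion p i n l = 1 := by
    rcases le_total n (i : ℕ) with h | h
    · exact ⟨i - n + 1, by omega, by omega, if_pos (by omega)⟩
    · exact ⟨n - i + 1, by omega, by omega, if_pos (by omega)⟩
  refine Finset.sum_pos' (fun l _ => mul_nonneg (hv l).le (Nat.cast_nonneg _))
    ⟨⟨l, Finset.mem_Icc.mpr ⟨hl1, hl2⟩⟩, Finset.mem_univ _, ?_⟩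
  simp only [hl, Nat.cast_one, mul_one]
  exact hv _

theorem fusionTotal_flipState (hsymm : ∀ i, v (flipState p i) = v i)
    (i : State p) : fusionTotal p v n (flipState p i) = fusionTotal p v n i := by
  unfold fusionTotal
  rw [← Equiv.sum_comp (flipState p)]
  refine Finset.sum_congr rfl fun l _ => ?_
  rw [hsymm, coe_flipState, coe_flipState, fusion_sub_sub i.lt l.lt]

theorem fusionTotal_sub (hnp : n < p) (hsymm : ∀ i, v (flipState p i) = v i)
    (i : State p) : fusionTotal p v (p - n) i = fusionTotal p v n i := by
  rw [← fusionTotal_flipState (n := n) hsymm]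
  refine Finset.sum_congr rfl fun l _ => ?_
  rw [coe_flipState, fusion_sub_left i.lt hnp]

theorem fusionWalk_flipState (hsymm : ∀ i, v (flipState p i) = v i)
    (i j : State p) :
    fusionWalk p v n (flipState p i) (flipState p j) = fusionWalk p v n i j := by
  simp only [fusionWalk, Matrix.of_apply, hsymm, fusionTotal_flipState hsymm, coe_flipState,
    fusion_sub_sub i.lt j.lt]

theorem fusionWalk_sub (hnp : n < p) (hsymm : ∀ i, v (flipState p i) = v i)
    (i j : State p) : fusionWalk p v (p - n) i j = fusionWalk p v n i (flipState p j) := by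
  simp only [fusionWalk, Matrix.of_apply, hsymm, fusionTotal_sub hnp hsymm, coe_flipState,
    fusion_sub_right hnp j.lt]

theorem fusionWalk_eq_zero {i j : State p} (h : ((i : ℕ) + n + j) % 2 ≠ 1) :
    fusionWalk p v n i j = 0 := by
  simp [fusionWalk, fusion_eq_zero h]

theorem fusionWalk_pos (hn : 1 ≤ n) (hnp : n < p) (hv : ∀ i, 0 < v i) {i j : State p}
    (h : fusion p i n j = 1) : 0 < fusionWalk p v n i j := by
  simp only [fusionWalk, Matrix.of_apply, h, Nat.cast_one, mul_one]
  exact div_pos (hv j) (fusionTotal_pos hn hnp hv i)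

theorem fusionDist_flipState (hsymm : ∀ i, v (flipState p i) = v i)
    (i : State p) : fusionDist p v n (flipState p i) = fusionDist p v n i := by
  simp only [fusionDist, hsymm, fusionTotal_flipState hsymm]

/-- The total weight of the row cancels in the product of `fusionDist` and the transition
probability. What remains is proportional to `v i * v j * fusion p i n j`, which is symmetric in `i`
and `j`. -/
theorem isReversibleChain_fusionWalk (hn : 1 ≤ n) (hnp : n < p) (hv : ∀ i, 0 < v i) :
    IsReversibleChain (fusionWalk p v n) (fusionDist p v n) := by
  have hD := fusionTotal_pos hn hnp hv
  have hpos : ∀ i, 0 < v i * fusionTotal p v n i := fun i => mul_pos (hv i) (hD i)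
  have hZ : 0 < ∑ x, v x * fusionTotal p v n x :=
    Finset.sum_pos (fun i _ => hpos i)
      ⟨⟨1, Finset.mem_Icc.mpr ⟨le_rfl, by omega⟩⟩, Finset.mem_univ _⟩
  refine ⟨fun i j => ?_, fun i => ?_, fun i => div_pos (hpos i) hZ, ?_, fun i j => ?_⟩
  · exact div_nonneg (mul_nonneg (hv j).le (Nat.cast_nonneg _)) (hD i).le
  · simp only [fusionWalk, Matrix.of_apply]
    rw [← Finset.sum_div]
    exact div_self (hD i).ne'
  · simp only [fusionDist]
    rw [← Finset.sum_div]
    exact div_self hZ.ne'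
  · simp only [fusionDist, fusionWalk, Matrix.of_apply, fusion_comm p j n i]
    have h1 := (hD i).ne'
    have h2 := (hD j).ne'
    have h3 := hZ.ne'
    field_simp

end FusionWalk

/-! ### The two halves of the state space -/

theorem oddState_injective {p : ℕ} : Function.Injective (oddState (p := p)) := fun i j h => by
  have := congrArg Subtype.val h
  have := i.one_le
  have := j.one_le
  apply Subtype.ext
  simp only [coe_oddState] at *
  omega

theorem coState_injective {p : ℕ} : Function.Injective (coState (p := p)) := fun i j h => by
  rw [← flipState_oddState, ← flipState_oddState] at h
  exact oddState_injective ((flipState p).injective h)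

theorem odd_oddState {p : ℕ} (i : HalfIdx p) : Odd (oddState i : ℕ) := by
  have := i.one_le
  rw [Nat.odd_iff, coe_oddState]
  omega

theorem even_coState {p : ℕ} (hp : Odd p) (i : HalfIdx p) : Even (coState i : ℕ) := by
  have := i.two_mul_lt
  rw [Nat.odd_iff] at hp
  rw [Nat.even_iff, coe_coState]
  omega

theorem exists_oddState_eq {p : ℕ} (hp : Odd p) {s : State p} (hs : Odd (s : ℕ)) :
    ∃ i, oddState i = s := by
  have h1 := s.one_le
  have h2 := s.lt
  rw [Nat.odd_iff] at hp hs
  refine ⟨⟨(s + 1) / 2, Finset.mem_Icc.mpr (by omega)⟩, ?_⟩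
  apply Subtype.ext
  simp only [coe_oddState]
  omega

theorem exists_coState_eq {p : ℕ} (hp : Odd p) {s : State p} (hs : Even (s : ℕ)) :
    ∃ i, coState i = s := by
  obtain ⟨i, hi⟩ := exists_oddState_eq hp (s := flipState p s) (by
    have := s.lt
    rw [Nat.odd_iff] at *
    rw [Nat.even_iff] at hs
    rw [coe_flipState]
    omega)
  exact ⟨i, by rw [← flipState_oddState, hi, flipState_flipState]⟩

/-- The states of odd label. -/
def halfEquivOdd {p : ℕ} (hp : Odd p) : HalfIdx p ≃ OddStates p :=
  Equiv.ofBijective (fun i => ⟨oddState i, odd_oddState i⟩)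
    ⟨fun _ _ h => oddState_injective (congrArg Subtype.val h), fun s => by
      obtain ⟨i, hi⟩ := exists_oddState_eq hp s.2
      exact ⟨i, Subtype.ext hi⟩⟩

/-- The states of even label, in decreasing order. -/
def halfEquivEven {p : ℕ} (hp : Odd p) : HalfIdx p ≃ EvenStates p :=
  Equiv.ofBijective (fun i => ⟨coState i, even_coState hp i⟩)
    ⟨fun _ _ h => coState_injective (congrArg Subtype.val h), fun s => by
      obtain ⟨i, hi⟩ := exists_coState_eq hp s.2
      exact ⟨i, Subtype.ext hi⟩⟩

/-- The state space is the disjoint union of its two halves. -/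
def halfSumEquiv {p : ℕ} (hp : Odd p) : HalfIdx p ⊕ HalfIdx p ≃ State p :=
  Equiv.ofBijective (Sum.elim oddState coState) (by
    refine ⟨oddState_injective.sumElim coState_injective fun i j h => ?_, fun s => ?_⟩
    · exact Nat.not_even_iff_odd.mpr (odd_oddState i) (h ▸ even_coState hp j)
    · rcases Nat.even_or_odd (s : ℕ) with hs | hs
      · obtain ⟨i, hi⟩ := exists_coState_eq hp hs
        exact ⟨Sum.inr i, hi⟩
      · obtain ⟨i, hi⟩ := exists_oddState_eq hp hs
        exact ⟨Sum.inl i, hi⟩)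

@[simp] theorem halfSumEquiv_inl {p : ℕ} (hp : Odd p) (i : HalfIdx p) :
    halfSumEquiv hp (Sum.inl i) = oddState i := rfl

@[simp] theorem halfSumEquiv_inr {p : ℕ} (hp : Odd p) (i : HalfIdx p) :
    halfSumEquiv hp (Sum.inr i) = coState i := rfl

theorem sum_state {p : ℕ} (hp : Odd p) (f : State p → ℝ) :
    ∑ s, f s = ∑ i, f (oddState i) + ∑ i, f (coState i) := by
  rw [← Equiv.sum_comp (halfSumEquiv hp), Fintype.sum_sum_type]
  rfl

theorem stateOrder_bijective {p : ℕ} (hp : Odd p) : Function.Bijective (stateOrder p) := by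
  constructor
  · rintro ⟨i, a⟩ ⟨j, b⟩ h
    have key : ∀ i j : HalfIdx p, oddState i ≠ coState j := fun i j h =>
      Nat.not_even_iff_odd.mpr (odd_oddState i) (h ▸ even_coState hp j)
    fin_cases a <;> fin_cases b <;> simp only [stateOrder, Fin.zero_eta, Fin.mk_one, if_true,
      one_ne_zero, if_false, Fin.isValue] at h
    · rw [oddState_injective h]
    · exact absurd h (key _ _)
    · exact absurd h.symm (key _ _)
    · rw [coState_injective h]
  · intro s
    obtain ⟨x | x, rfl⟩ := (halfSumEquiv hp).surjective s
    · exact ⟨(x, 0), rfl⟩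
    · exact ⟨(x, 1), rfl⟩

theorem nontrivial_halfIdx {p : ℕ} (hp : 5 ≤ p) : Nontrivial (HalfIdx p) :=
  ⟨⟨1, Finset.mem_Icc.mpr (by omega)⟩, ⟨2, Finset.mem_Icc.mpr (by omega)⟩, fun h => by
    have := congrArg Subtype.val h
    simp at this⟩

theorem nontrivial_state {p : ℕ} (hp : 3 ≤ p) : Nontrivial (State p) :=
  ⟨⟨1, Finset.mem_Icc.mpr (by omega)⟩, ⟨2, Finset.mem_Icc.mpr (by omega)⟩, fun h => by
    have := congrArg Subtype.val h
    simp at this⟩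

/-! ### The quotient walk -/

/-- The matrix of the walk modulo the symmetry `i ↦ p - i`. -/
def fusionBar (p : ℕ) (v : State p → ℝ) (n : ℕ) : Matrix (HalfIdx p) (HalfIdx p) ℝ :=
  Matrix.of fun i j =>
    if Odd n then fusionWalk p v n (oddState i) (oddState j)
    else fusionWalk p v n (oddState i) (coState j)

section FusionBar

variable {p n : ℕ} {v : State p → ℝ}

/-- As `p` is odd, `n` and `p - n` have opposite parity, so the two definitions use complementary
column sets. The reflection of the columns matches them. -/
theorem fusionBar_sub (hp : Odd p) (hnp : n < p) (hsymm : ∀ i, v (flipState p i) = v i) :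
    fusionBar p v (p - n) = fusionBar p v n := by
  ext i j
  simp only [fusionBar, Matrix.of_apply, fusionWalk_sub hnp hsymm, flipState_oddState,
    flipState_coState]
  by_cases h : Odd n
  · rw [if_neg (by rw [Nat.odd_iff] at *; omega), if_pos h]
  · rw [if_pos (by rw [Nat.odd_iff] at *; omega), if_neg h]

/-- A step from `i` leads to `j` with `j ≡ i + n + 1` modulo 2, so odd `n` preserves parity. The
reflection identifies the two remaining blocks. -/
theorem fusionWalk_submatrix_of_odd (hp : Odd p)
    (hsymm : ∀ i, v (flipState p i) = v i) (hn : Odd n) :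
    (fusionWalk p v n).submatrix (halfSumEquiv hp) (halfSumEquiv hp) =
      Matrix.fromBlocks (fusionBar p v n) 0 0 (fusionBar p v n) := by
  have h1 := fun i : HalfIdx p => odd_oddState i
  have h2 := fun i : HalfIdx p => even_coState hp i
  simp only [Nat.odd_iff, Nat.even_iff] at h1 h2
  have h3 := Nat.odd_iff.mp hn
  ext (i | i) (j | j) <;> simp only [Matrix.submatrix_apply, halfSumEquiv_inl, halfSumEquiv_inr,
    Matrix.fromBlocks_apply₁₁, Matrix.fromBlocks_apply₁₂, Matrix.fromBlocks_apply₂₁,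
    Matrix.fromBlocks_apply₂₂, Matrix.zero_apply, fusionBar, Matrix.of_apply, if_pos hn]
  · exact fusionWalk_eq_zero (by have := h1 i; have := h2 j; omega)
  · exact fusionWalk_eq_zero (by have := h2 i; have := h1 j; omega)
  · rw [← flipState_oddState, ← flipState_oddState, fusionWalk_flipState hsymm]

theorem fusionWalk_submatrix_of_even (hp : Odd p)
    (hsymm : ∀ i, v (flipState p i) = v i) (hn : Even n) :
    (fusionWalk p v n).submatrix (halfSumEquiv hp) (halfSumEquiv hp) =
      Matrix.fromBlocks 0 (fusionBar p v n) (fusionBar p v n) 0 := by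
  have h1 := fun i : HalfIdx p => odd_oddState i
  have h2 := fun i : HalfIdx p => even_coState hp i
  simp only [Nat.odd_iff, Nat.even_iff] at h1 h2
  have h3 := Nat.even_iff.mp hn
  ext (i | i) (j | j) <;> simp only [Matrix.submatrix_apply, halfSumEquiv_inl, halfSumEquiv_inr,
    Matrix.fromBlocks_apply₁₁, Matrix.fromBlocks_apply₁₂, Matrix.fromBlocks_apply₂₁,
    Matrix.fromBlocks_apply₂₂, Matrix.zero_apply, fusionBar, Matrix.of_apply,
    if_neg (Nat.not_odd_iff_even.mpr hn)]
  · exact fusionWalk_eq_zero (by have := h1 i; have := h1 j; omega)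
  · rw [← fusionWalk_flipState hsymm (coState i), flipState_coState, flipState_oddState]
  · exact fusionWalk_eq_zero (by have := h2 i; have := h2 j; omega)

/-- The swap matrix squares to 1, so its power `n + 1` is the identity for odd `n` and the swap for
even `n`. These are the two block shapes. -/
theorem fusionWalk_submatrix_stateOrder (hp : Odd p)
    (hsymm : ∀ i, v (flipState p i) = v i) :
    (fusionWalk p v n).submatrix (stateOrder p) (stateOrder p) =
      Matrix.kronecker (fusionBar p v n)
        ((!![0, 1; 1, 0] : Matrix (Fin 2) (Fin 2) ℝ) ^ (n + 1)) := by
  have hsq : (!![0, 1; 1, 0] : Matrix (Fin 2) (Fin 2) ℝ) ^ 2 = 1 := by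
    rw [pow_two]
    ext i j
    fin_cases i <;> fin_cases j <;> simp
  let c : HalfIdx p → Fin 2 → HalfIdx p ⊕ HalfIdx p := fun i a =>
    if a = 0 then Sum.inl i else Sum.inr i
  have hc : ∀ i a, stateOrder p (i, a) = halfSumEquiv hp (c i a) := by
    intro i a
    fin_cases a <;> rfl
  ext ⟨i, a⟩ ⟨j, b⟩
  rw [Matrix.submatrix_apply, hc, hc, ← Matrix.submatrix_apply (fusionWalk p v n)]
  rcases Nat.even_or_odd n with hn | hn
  · obtain ⟨l, hl⟩ := hn
    rw [fusionWalk_submatrix_of_even hp hsymm ⟨l, hl⟩,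
      show n + 1 = 2 * l + 1 by omega, pow_succ, pow_mul, hsq, one_pow, one_mul]
    fin_cases a <;> fin_cases b <;> simp [c, Matrix.kroneckerMap_apply]
  · obtain ⟨l, hl⟩ := hn
    rw [fusionWalk_submatrix_of_odd hp hsymm ⟨l, hl⟩,
      show n + 1 = 2 * (l + 1) by omega, pow_mul, hsq, one_pow]
    fin_cases a <;> fin_cases b <;> simp [c, Matrix.kroneckerMap_apply]

theorem sum_fusionDist_oddState (hp : Odd p) (hn : 1 ≤ n) (hnp : n < p) (hv : ∀ i, 0 < v i)
    (hsymm : ∀ i, v (flipState p i) = v i) :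
    ∑ i : HalfIdx p, fusionDist p v n (oddState i) = 1 / 2 := by
  have h := (isReversibleChain_fusionWalk hn hnp hv).sum_dist
  rw [sum_state hp] at h
  simp only [← flipState_oddState, fusionDist_flipState hsymm] at h
  linarith

/-- From an odd state the walk reaches only one of the two halves, so the row sums stay 1. For even
`n` this is the walk on the odd states modulo `i ~ p - i`, and detailed balance uses the reflection.
-/
theorem isReversibleChain_fusionBar (hp : Odd p) (hn : 1 ≤ n) (hnp : n < p) (hv : ∀ i, 0 < v i)
    (hsymm : ∀ i, v (flipState p i) = v i) :
    IsReversibleChain (fusionBar p v n) fun i => 2 * fusionDist p v n (oddState i) := by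
  have h := isReversibleChain_fusionWalk hn hnp hv
  refine ⟨fun i j => ?_, fun i => ?_, fun i => mul_pos two_pos (h.pos _), ?_, fun i j => ?_⟩
  · simp only [fusionBar, Matrix.of_apply]
    split_ifs <;> exact h.nonneg _ _
  · have h1 := h.sum_row (oddState i)
    rw [sum_state hp] at h1
    have h2 := fun i : HalfIdx p => odd_oddState i
    have h3 := fun i : HalfIdx p => even_coState hp i
    simp only [Nat.odd_iff, Nat.even_iff] at h2 h3
    simp only [fusionBar, Matrix.of_apply]
    by_cases hodd : Odd n
    · have h4 := Nat.odd_iff.mp hodd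
      rw [Finset.sum_eq_zero (s := Finset.univ)
        (f := fun j : HalfIdx p => fusionWalk p v n (oddState i) (coState j)) fun j _ =>
        fusionWalk_eq_zero (by have := h2 i; have := h3 j; omega), add_zero] at h1
      simpa only [if_pos hodd] using h1
    · have h4 := Nat.odd_iff.not.mp hodd
      rw [Finset.sum_eq_zero (s := Finset.univ)
        (f := fun j : HalfIdx p => fusionWalk p v n (oddState i) (oddState j)) fun j _ =>
        fusionWalk_eq_zero (by have := h2 i; have := h2 j; omega), zero_add] at h1
      simpa only [if_neg hodd] using h1
  · rw [← Finset.mul_sum, sum_fusionDist_oddState hp hn hnp hv hsymm]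
    norm_num
  · simp only [fusionBar, Matrix.of_apply]
    split_ifs
    · linear_combination 2 * h.balance (oddState i) (oddState j)
    · have h1 := h.balance (oddState i) (coState j)
      rw [← fusionDist_flipState hsymm (coState j),
        ← fusionWalk_flipState hsymm (coState j), flipState_coState, flipState_oddState] at h1
      linear_combination 2 * h1

/-- By `fusionBar_sub` one may take the odd one of `n` and `p - n`; both lie in `[2, p - 2]`. It
then suffices to join the odd labels `2a - 1` and `2a + 1` through a common neighbour. -/
theorem fusionBar_connected (hp : Odd p) (hn : 2 ≤ n) (hnp : n + 2 ≤ p) (hv : ∀ i, 0 < v i)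
    (hsymm : ∀ i, v (flipState p i) = v i) {f : HalfIdx p → ℝ}
    (hf : ∀ i j, 0 < (fusionBar p v n * fusionBar p v n) i j → f i = f j) :
    ∃ a, f = fun _ => a := by
  obtain ⟨m, hmodd, hm2, hmp, hbar⟩ : ∃ m, Odd m ∧ 2 ≤ m ∧ m + 2 ≤ p ∧
      fusionBar p v n = fusionBar p v m := by
    by_cases h : Odd n
    · exact ⟨n, h, hn, hnp, rfl⟩
    · refine ⟨p - n, ?_, by omega, by omega, (fusionBar_sub hp (by omega) hsymm).symm⟩
      rw [Nat.odd_iff] at *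
      omega
  rw [hbar] at hf
  have h1 : 1 ≤ (p - 1) / 2 := by omega
  have hrev := isReversibleChain_fusionBar (n := m) hp (by omega) (by omega) hv hsymm
  have key : ∀ a, ∀ h : a ∈ Finset.Icc 1 ((p - 1) / 2), ∀ h' : a + 1 ∈ Finset.Icc 1 ((p - 1) / 2),
      f ⟨a, h⟩ = f ⟨a + 1, h'⟩ := by
    intro a ha ha'
    apply hf
    rw [Finset.mem_Icc] at ha ha'
    have hmo := Nat.odd_iff.mp hmodd
    have hpo := Nat.odd_iff.mp hp
    -- The neighbours of `2a - 1` begin at `|2a - 1 - m| + 1` and go up in steps of 2; likewise for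
    -- `2a + 1`. In each case `2s - 1` is the larger of the two starting points. `2 ≤ m` and `m ≤ p
    -- - 2` keep it below the upper limits.
    obtain ⟨s, hs1, hs2, hs3, hs4⟩ : ∃ s, 1 ≤ s ∧ s ≤ (p - 1) / 2 ∧
        fusion p (2 * a - 1) m (2 * s - 1) = 1 ∧ fusion p (2 * s - 1) m (2 * (a + 1) - 1) = 1 := by
      rcases le_total m (2 * a - 1) with h | h
      · exact ⟨(2 * a + 3 - m) / 2, by omega, by omega, if_pos (by omega), if_pos (by omega)⟩
      · by_cases h' : m = 2 * a - 1
        · exact ⟨2, by omega, by omega, if_pos (by omega), if_pos (by omega)⟩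
        · exact ⟨(m + 3 - 2 * a) / 2, by omega, by omega, if_pos (by omega), if_pos (by omega)⟩
    have hpos : ∀ {i j : HalfIdx p}, fusion p (2 * i - 1) m (2 * j - 1) = 1 →
        0 < fusionBar p v m i j := by
      intro i j hij
      simp only [fusionBar, Matrix.of_apply, if_pos hmodd]
      exact fusionWalk_pos (by omega) (by omega) hv hij
    rw [Matrix.mul_apply]
    exact Finset.sum_pos' (fun l _ => mul_nonneg (hrev.nonneg _ _) (hrev.nonneg _ _))
      ⟨⟨s, Finset.mem_Icc.mpr ⟨hs1, hs2⟩⟩, Finset.mem_univ _, mul_pos (hpos hs3) (hpos hs4)⟩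
  refine ⟨f ⟨1, Finset.mem_Icc.mpr ⟨le_rfl, h1⟩⟩, ?_⟩
  have hind : ∀ a, ∀ h : a + 1 ∈ Finset.Icc 1 ((p - 1) / 2),
      f ⟨a + 1, h⟩ = f ⟨1, Finset.mem_Icc.mpr ⟨le_rfl, h1⟩⟩ := by
    intro a
    induction a with
    | zero => exact fun h => rfl
    | succ a ih =>
      intro h
      have h' : a + 1 ∈ Finset.Icc 1 ((p - 1) / 2) := by
        rw [Finset.mem_Icc] at *
        omega
      rw [← key (a + 1) h' h, ih h']
  funext ⟨i, hi⟩
  obtain ⟨a, rfl⟩ : ∃ a, i = a + 1 := ⟨i - 1, by rw [Finset.mem_Icc] at hi; omega⟩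
  exact hind a hi

end FusionBar

/-! ### Matrices with two equal blocks -/

theorem charpoly_neg_eq {H K : Type*} [Fintype H] [DecidableEq H] [CommRing K]
    (A : Matrix H H K) :
    (-A).charpoly = (-1) ^ Fintype.card H * A.charpoly.comp (-Polynomial.X) := by
  have h1 : A.charpoly.comp (-Polynomial.X) =
      ((Polynomial.compRingHom (-Polynomial.X : Polynomial K)).mapMatrix A.charmatrix).det := by
    rw [← RingHom.map_det]
    rfl
  have h2 : (Polynomial.compRingHom (-Polynomial.X : Polynomial K)).mapMatrix A.charmatrix =
      -(-A).charmatrix := by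
    ext1 i j
    by_cases hij : i = j
    · subst hij
      simp [Matrix.charmatrix_apply_eq, sub_eq_add_neg, add_comm]
    · simp [Matrix.charmatrix_apply_ne _ _ _ hij]
  rw [h1, h2, Matrix.det_neg, ← mul_assoc, ← mul_pow]
  simp [Matrix.charpoly]

theorem roots_charpoly_neg {H K : Type*} [Fintype H] [DecidableEq H] [Field K]
    (A : Matrix H H K) : (-A).charpoly.roots = A.charpoly.roots.map fun x => -x := by
  have h1 : ((-1 : Polynomial K) ^ Fintype.card H) = Polynomial.C ((-1) ^ Fintype.card H) := by
    simp
  rw [charpoly_neg_eq, h1, Polynomial.roots_C_mul _ (pow_ne_zero _ (neg_ne_zero.mpr one_ne_zero)),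
    Polynomial.roots_comp_neg_X]

/-- Conjugation by the block matrix `(1 1; 1 -1)`, that is, passing to sums and differences of the
halves, gives `diag(A, -A)`. -/
theorem charpoly_fromBlocks_antidiagonal {H K : Type*} [Fintype H] [DecidableEq H] [Field K]
    [CharZero K] (A : Matrix H H K) :
    (Matrix.fromBlocks 0 A A 0).charpoly = A.charpoly * (-A).charpoly := by
  let U : Matrix (H ⊕ H) (H ⊕ H) K := Matrix.fromBlocks 1 1 1 (-1)
  have hU : U * ((1 / 2 : K) • U) = 1 := by
    have h2 : (1 / 2 : K) • ((1 : Matrix H H K) + 1) = 1 := by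
      rw [← two_smul K (1 : Matrix H H K), smul_smul]
      norm_num
    rw [Matrix.mul_smul]
    simp only [U, Matrix.fromBlocks_multiply, Matrix.fromBlocks_smul, mul_one, mul_neg, neg_neg,
      add_neg_cancel, smul_zero, h2, Matrix.fromBlocks_one]
  have hU' : ((1 / 2 : K) • U) * U = 1 := by
    rw [Matrix.smul_mul, ← Matrix.mul_smul, hU]
  have h := Matrix.charpoly_units_conj ⟨U, (1 / 2 : K) • U, hU, hU'⟩ (Matrix.fromBlocks 0 A A 0)
  have h3 : U * Matrix.fromBlocks 0 A A 0 = Matrix.fromBlocks A 0 0 (-A) * U := by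
    simp [U, Matrix.fromBlocks_multiply]
  rw [← Matrix.coe_units_inv] at h
  rw [← h]
  change (U * Matrix.fromBlocks 0 A A 0 * ((1 / 2 : K) • U)).charpoly = _
  rw [h3, mul_assoc, hU, mul_one, Matrix.charpoly_fromBlocks_zero₁₂]

section Blocks

variable {S H : Type} [Fintype S] [DecidableEq S] [Fintype H] [DecidableEq H]
  {Q : Matrix S S ℝ} {R : Matrix H H ℝ}

theorem complexEigenvalues_submatrix (e : H ≃ S) :
    complexEigenvalues (Q.submatrix e e) = complexEigenvalues Q := by
  unfold complexEigenvalues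
  rw [← Matrix.charpoly_reindex e.symm]
  rfl

theorem even_count_complexEigenvalues (e : H ⊕ H ≃ S)
    (h : Q.submatrix e e = Matrix.fromBlocks R 0 0 R) (μ : ℂ) :
    Even ((complexEigenvalues Q).count μ) := by
  rw [← complexEigenvalues_submatrix e, h, complexEigenvalues, Matrix.fromBlocks_map]
  simp only [Matrix.map_zero _ (map_zero (algebraMap ℝ ℂ))]
  rw [Matrix.charpoly_fromBlocks_zero₁₂, Polynomial.roots_mul
    (mul_ne_zero (Matrix.charpoly_monic _).ne_zero (Matrix.charpoly_monic _).ne_zero),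
    Multiset.count_add]
  exact ⟨_, rfl⟩

theorem exists_complexEigenvalues_eq (e : H ⊕ H ≃ S)
    (h : Q.submatrix e e = Matrix.fromBlocks 0 R R 0) :
    ∃ A : Multiset ℂ, complexEigenvalues Q = A + A.map fun μ => -μ := by
  refine ⟨complexEigenvalues R, ?_⟩
  rw [← complexEigenvalues_submatrix e, h, complexEigenvalues, Matrix.fromBlocks_map]
  simp only [Matrix.map_zero _ (map_zero (algebraMap ℝ ℂ))]
  rw [charpoly_fromBlocks_antidiagonal, Polynomial.roots_mul
    (mul_ne_zero (Matrix.charpoly_monic _).ne_zero (Matrix.charpoly_monic _).ne_zero),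
    roots_charpoly_neg]
  rfl

theorem mulVec_submatrix_comp {K : Type*} [CommRing K] (A : Matrix S S K) (e : H ≃ S)
    (b : S → K) : (A.submatrix e e).mulVec (b ∘ e) = A.mulVec b ∘ e := by
  funext i
  simp only [Matrix.mulVec, dotProduct, Matrix.submatrix_apply, Function.comp_apply]
  exact Equiv.sum_comp e fun j => A (e i) j * b j

theorem mulVec_eq_smul_iff_of_diagonal {K : Type*} [CommRing K] {A : Matrix S S K}
    {B : Matrix H H K} (e : H ⊕ H ≃ S) (h : A.submatrix e e = Matrix.fromBlocks B 0 0 B)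
    (b : S → K) (μ : K) :
    A.mulVec b = μ • b ↔
      B.mulVec (fun i => b (e (Sum.inl i))) = μ • (fun i => b (e (Sum.inl i))) ∧
      B.mulVec (fun i => b (e (Sum.inr i))) = μ • (fun i => b (e (Sum.inr i))) := by
  have h1 := mulVec_submatrix_comp A e b
  rw [h, Matrix.fromBlocks_mulVec] at h1
  have h2 : A.mulVec b = μ • b ↔ A.mulVec b ∘ e = (μ • b) ∘ e :=
    ⟨fun h => by rw [h], fun h => e.surjective.injective_comp_right h⟩
  rw [h2, ← h1]
  simp only [Matrix.zero_mulVec, add_zero, zero_add, funext_iff, Sum.forall, Sum.elim_inl,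
    Sum.elim_inr]
  rfl

theorem mulVec_eq_smul_iff_of_antidiagonal {K : Type*} [CommRing K] {A : Matrix S S K}
    {B : Matrix H H K} (e : H ⊕ H ≃ S) (h : A.submatrix e e = Matrix.fromBlocks 0 B B 0)
    (b : S → K) (μ : K) :
    A.mulVec b = μ • b ↔
      B.mulVec (fun i => b (e (Sum.inr i))) = μ • (fun i => b (e (Sum.inl i))) ∧
      B.mulVec (fun i => b (e (Sum.inl i))) = μ • (fun i => b (e (Sum.inr i))) := by
  have h1 := mulVec_submatrix_comp A e b
  rw [h, Matrix.fromBlocks_mulVec] at h1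
  have h2 : A.mulVec b = μ • b ↔ A.mulVec b ∘ e = (μ • b) ∘ e :=
    ⟨fun h => by rw [h], fun h => e.surjective.injective_comp_right h⟩
  rw [h2, ← h1]
  simp only [Matrix.zero_mulVec, add_zero, zero_add, funext_iff, Sum.forall, Sum.elim_inl,
    Sum.elim_inr]
  rfl

theorem mem_eigenspace_complexEnd {P : Matrix S S ℝ} {μ : ℂ} {x : S → ℂ} :
    x ∈ (complexEnd P).eigenspace μ ↔ (P.map (algebraMap ℝ ℂ)).mulVec x = μ • x := by
  rw [Module.End.mem_eigenspace_iff, complexEnd, Matrix.toLin'_apply]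

theorem even_finrank_eigenspace (e : H ⊕ H ≃ S)
    (h : Q.submatrix e e = Matrix.fromBlocks R 0 0 R) (μ : ℂ) :
    Even (Module.finrank ℂ ((complexEnd Q).eigenspace μ)) := by
  have h' : (Q.map (algebraMap ℝ ℂ)).submatrix e e =
      Matrix.fromBlocks (R.map (algebraMap ℝ ℂ)) 0 0 (R.map (algebraMap ℝ ℂ)) := by
    rw [Matrix.submatrix_map, h, Matrix.fromBlocks_map]
    simp only [Matrix.map_zero _ (map_zero (algebraMap ℝ ℂ))]
  have hmem := mulVec_eq_smul_iff_of_diagonal e h'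
  let E := (complexEnd R).eigenspace μ
  let L : (complexEnd Q).eigenspace μ ≃ₗ[ℂ] E × E :=
    { toFun := fun x =>
        (⟨fun i => x.1 (e (Sum.inl i)),
          mem_eigenspace_complexEnd.mpr ((hmem _ _).mp (mem_eigenspace_complexEnd.mp x.2)).1⟩,
        ⟨fun i => x.1 (e (Sum.inr i)),
          mem_eigenspace_complexEnd.mpr ((hmem _ _).mp (mem_eigenspace_complexEnd.mp x.2)).2⟩)
      map_add' := fun _ _ => rfl
      map_smul' := fun _ _ => rfl
      invFun := fun y => ⟨fun s => Sum.elim y.1.1 y.2.1 (e.symm s),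
        mem_eigenspace_complexEnd.mpr ((hmem _ _).mpr (by
          simp only [Equiv.symm_apply_apply, Sum.elim_inl, Sum.elim_inr]
          exact ⟨mem_eigenspace_complexEnd.mp y.1.2, mem_eigenspace_complexEnd.mp y.2.2⟩))⟩
      left_inv := fun x => by
        apply Subtype.ext
        funext s
        obtain ⟨a | a, rfl⟩ := e.surjective s <;> simp
      right_inv := fun y => by
        refine Prod.ext (Subtype.ext ?_) (Subtype.ext ?_) <;> funext i <;> simp }
  rw [L.finrank_eq, Module.finrank_prod]
  exact ⟨_, rfl⟩

/-- An antidiagonal matrix anticommutes with the sign change σ on one half, so σ maps eigenvectors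
for μ to eigenvectors for `-μ`. -/
theorem finrank_eigenspace_neg_le (e : H ⊕ H ≃ S)
    (h : Q.submatrix e e = Matrix.fromBlocks 0 R R 0) (μ : ℂ) :
    Module.finrank ℂ ((complexEnd Q).eigenspace μ) ≤
      Module.finrank ℂ ((complexEnd Q).eigenspace (-μ)) := by
  have h' : (Q.map (algebraMap ℝ ℂ)).submatrix e e =
      Matrix.fromBlocks 0 (R.map (algebraMap ℝ ℂ)) (R.map (algebraMap ℝ ℂ)) 0 := by
    rw [Matrix.submatrix_map, h, Matrix.fromBlocks_map]
    simp only [Matrix.map_zero _ (map_zero (algebraMap ℝ ℂ))]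
  have hmem := mulVec_eq_smul_iff_of_antidiagonal e h'
  let σ : S → ℂ := fun s => Sum.elim (fun _ => 1) (fun _ => -1) (e.symm s)
  have hσ : ∀ s, σ s * σ s = 1 := fun s => by
    obtain ⟨a | a, rfl⟩ := e.surjective s <;> simp [σ]
  let L : (complexEnd Q).eigenspace μ →ₗ[ℂ] (complexEnd Q).eigenspace (-μ) :=
    { toFun := fun x => ⟨fun s => σ s * x.1 s, mem_eigenspace_complexEnd.mpr ((hmem _ _).mpr (by
          obtain ⟨h1, h2⟩ := (hmem _ _).mp (mem_eigenspace_complexEnd.mp x.2)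
          simp only [σ, Equiv.symm_apply_apply, Sum.elim_inl, Sum.elim_inr, one_mul, neg_mul]
          constructor
          · rw [neg_smul, ← h1]
            exact Matrix.mulVec_neg _ _
          · rw [h2]
            funext i
            simp))⟩
      map_add' := fun x y => by
        apply Subtype.ext
        funext s
        exact mul_add _ _ _
      map_smul' := fun c x => by
        apply Subtype.ext
        funext s
        exact mul_left_comm _ _ _ }
  refine LinearMap.finrank_le_finrank_of_injective (f := L) fun x y hxy => ?_
  apply Subtype.ext
  funext s
  have h1 : σ s * x.1 s = σ s * y.1 s := congrFun (congrArg Subtype.val hxy) s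
  rw [← one_mul (x.1 s), ← one_mul (y.1 s), ← hσ s, mul_assoc, h1, mul_assoc]

theorem finrank_eigenspace_neg (e : H ⊕ H ≃ S)
    (h : Q.submatrix e e = Matrix.fromBlocks 0 R R 0) (μ : ℂ) :
    Module.finrank ℂ ((complexEnd Q).eigenspace (-μ)) =
      Module.finrank ℂ ((complexEnd Q).eigenspace μ) := by
  refine le_antisymm ?_ (finrank_eigenspace_neg_le e h μ)
  have := finrank_eigenspace_neg_le e h (-μ)
  rwa [neg_neg] at this

/-- Real eigenvectors of `R` whose eigenvalue exceeds `r` in absolute value are constant, of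
eigenvalue `1`. -/
def HasSpectralGap (R : Matrix H H ℝ) (r : ℝ) : Prop :=
  ∀ (f : H → ℝ) (μ : ℝ), R.mulVec f = μ • f → r < |μ| → f = 0 ∨ μ = 1 ∧ ∃ a, f = fun _ => a

theorem HasSpectralGap.eq_const {r : ℝ} (hR : HasSpectralGap R r) {f : H → ℝ} {μ : ℝ}
    (hf : R.mulVec f = μ • f) (hμ : r < |μ|) : ∃ a, f = fun _ => a := by
  rcases hR f μ hf hμ with rfl | ⟨_, h⟩
  · exact ⟨0, rfl⟩
  · exact h

theorem HasSpectralGap.const_on_blocks_of_diagonal {r : ℝ} (hR : HasSpectralGap R r)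
    (e : H ⊕ H ≃ S) (h : Q.submatrix e e = Matrix.fromBlocks R 0 0 R) {b : S → ℝ} {μ : ℝ}
    (hb : Q.mulVec b = μ • b) (hμ : r < |μ|) :
    ∃ a c, (∀ i, b (e (Sum.inl i)) = a) ∧ ∀ i, b (e (Sum.inr i)) = c := by
  obtain ⟨h1, h2⟩ := (mulVec_eq_smul_iff_of_diagonal e h b μ).mp hb
  obtain ⟨a, ha⟩ := hR.eq_const h1 hμ
  obtain ⟨c, hc⟩ := hR.eq_const h2 hμ
  exact ⟨a, c, congrFun ha, congrFun hc⟩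

/-- The sum of the two halves of an eigenvector is an eigenvector of `R` for μ and the difference
one for `-μ`. Both are constant by the gap. -/
theorem HasSpectralGap.const_on_blocks_of_antidiagonal {r : ℝ} (hR : HasSpectralGap R r)
    (e : H ⊕ H ≃ S) (h : Q.submatrix e e = Matrix.fromBlocks 0 R R 0) {b : S → ℝ} {μ : ℝ}
    (hb : Q.mulVec b = μ • b) (hμ : r < |μ|) :
    ∃ a c, (∀ i, b (e (Sum.inl i)) = a) ∧ ∀ i, b (e (Sum.inr i)) = c := by
  obtain ⟨h1, h2⟩ := (mulVec_eq_smul_iff_of_antidiagonal e h b μ).mp hb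
  obtain ⟨x, hx⟩ := hR.eq_const (f := (fun i => b (e (Sum.inl i))) + fun i => b (e (Sum.inr i)))
    (μ := μ) (by rw [Matrix.mulVec_add, h1, h2, smul_add, add_comm]) hμ
  obtain ⟨y, hy⟩ := hR.eq_const (f := (fun i => b (e (Sum.inl i))) - fun i => b (e (Sum.inr i)))
    (μ := -μ) (by rw [Matrix.mulVec_sub, h1, h2, neg_smul, smul_sub, neg_sub]) (by rwa [abs_neg])
  refine ⟨(x + y) / 2, (x - y) / 2, fun i => ?_, fun i => ?_⟩ <;>
  · have h3 := congrFun hx i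
    have h4 := congrFun hy i
    simp only [Pi.add_apply, Pi.sub_apply] at h3 h4
    linarith

/-- The lazy walk of an antidiagonal block walk has the same kind of spectral gap. -/
theorem HasSpectralGap.const_of_lazyChain [Nonempty H] {r : ℝ} (hR : HasSpectralGap R r)
    (hr0 : 0 ≤ r) (hrow : ∀ i, ∑ j, R i j = 1)
    (e : H ⊕ H ≃ S) (h : Q.submatrix e e = Matrix.fromBlocks 0 R R 0) {b : S → ℝ} {μ : ℝ}
    (hb : (lazyChain Q).mulVec b = μ • b) (hμ : (1 + r) / 2 < |μ|) : ∃ a, b = fun _ => a := by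
  have hb' : Q.mulVec b = (2 * μ - 1) • b := by
    have h1 : (lazyChain Q).mulVec b = (1 / 2 : ℝ) • (Q.mulVec b + b) := by
      rw [lazyChain, Matrix.smul_mulVec, Matrix.add_mulVec, Matrix.one_mulVec]
    rw [h1] at hb
    funext s
    have h2 := congrFun hb s
    simp only [Pi.smul_apply, Pi.add_apply, smul_eq_mul] at h2 ⊢
    linarith
  have hμ' : r < |2 * μ - 1| := by
    have h1 : |2 * μ| ≤ |2 * μ - 1| + |(1 : ℝ)| := by
      simpa using abs_add_le (2 * μ - 1) 1
    rw [abs_mul, abs_one, abs_two] at h1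
    linarith
  obtain ⟨a, c, ha, hc⟩ := hR.const_on_blocks_of_antidiagonal e h hb' hμ'
  obtain ⟨h1, h2⟩ := (mulVec_eq_smul_iff_of_antidiagonal e h b _).mp hb'
  obtain ⟨i⟩ := ‹Nonempty H›
  have h3 := congrFun h1 i
  have h4 := congrFun h2 i
  simp only [ha, hc, Matrix.mulVec, dotProduct, Pi.smul_apply, smul_eq_mul, ← Finset.sum_mul, hrow,
    one_mul] at h3 h4
  have hac : a = c := by
    by_contra hne
    -- The vector with values `a` and `-a` is the eigenvector of `Q` for `-1`. Laziness moves this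
    -- eigenvalue to 0, which `hμ` excludes.
    have h5 : 2 * μ * (a - c) = 0 := by linear_combination h4 - h3
    have h6 : μ = 0 := by
      rcases mul_eq_zero.mp h5 with h6 | h6
      · linarith
      · exact absurd (sub_eq_zero.mp h6) hne
    rw [h6, abs_zero] at hμ
    linarith
  refine ⟨a, ?_⟩
  funext s
  obtain ⟨x | x, rfl⟩ := e.surjective s
  · exact ha x
  · rw [hac]
    exact hc x

end Blocks

/-- Laziness halves the gap `1 - r` and so doubles the bound, which is why half the lazy mixing time
appears. -/
theorem mixBound_lazy {r ε m : ℝ} (hr : r < 1) :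
    mixBound ((1 + r) / 2) ε m = 2 * mixBound r ε m := by
  have h : 1 - r ≠ 0 := by linarith
  have h1 : 1 - (1 + r) / 2 = (1 - r) / 2 := by ring
  rw [mixBound, mixBound, h1]
  field_simp

/-- Transport of reversibility along a bijection of the state spaces. -/
theorem IsReversibleChain.submatrix {S H : Type} [Fintype S] [Fintype H] {P : Matrix S S ℝ}
    {π : S → ℝ} (h : IsReversibleChain P π) (e : H ≃ S) :
    IsReversibleChain (P.submatrix e e) fun i => π (e i) where
  nonneg i j := h.nonneg _ _
  sum_row i := by
    simp only [Matrix.submatrix_apply]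
    rw [Equiv.sum_comp e fun j => P (e i) j, h.sum_row]
  pos i := h.pos _
  sum_dist := by rw [Equiv.sum_comp e π, h.sum_dist]
  balance i j := h.balance _ _

/-- Transport of irreducibility along a bijection of the state spaces. -/
theorem Matrix.IsIrreducible.submatrix_equiv {S H : Type} [Fintype S] [DecidableEq S] [Fintype H]
    [DecidableEq H] {P : Matrix S S ℝ} (h : P.IsIrreducible) (e : H ≃ S) :
    (P.submatrix e e).IsIrreducible := by
  rw [Matrix.isIrreducible_iff_exists_pow_pos (A := P.submatrix e e) fun i j => h.nonneg _ _]
  intro i j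
  obtain ⟨t, ht, hpos⟩ := (Matrix.isIrreducible_iff_exists_pow_pos h.nonneg).mp h (e i) (e j)
  refine ⟨t, ht, ?_⟩
  have h1 : P.submatrix e e ^ t = (P ^ t).submatrix e e :=
    (map_pow (Matrix.reindexRingEquiv ℝ e.symm) P t).symm
  rw [h1]
  exact hpos

/-- Mixing of a copy of a chain with a spectral gap. -/
theorem HasSpectralGap.exists_isMixingTime_submatrix {S H : Type} [Fintype S] [DecidableEq S]
    [Fintype H] [DecidableEq H] [Nontrivial H] {R : Matrix H H ℝ} {ρ : H → ℝ} {r ε : ℝ}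
    (hR : HasSpectralGap R r) (h : IsReversibleChain R ρ) (hr0 : 0 ≤ r) (hr1 : r < 1)
    (hε : 0 < ε) (hε1 : ε ≤ 1) (e : S ≃ H) :
    ∃ t : ℕ, IsMixingTime (R.submatrix e e) (fun i => ρ (e i)) ε t ∧
      (t : ℝ) ≤ mixBound r ε (⨅ i, ρ (e i)) := by
  have := e.nontrivial
  refine (h.submatrix e).exists_isMixingTime hr0 hr1 hε hε1 fun b μ hb hμ => ?_
  have hb' : b = (b ∘ e.symm) ∘ e := by
    funext s
    simp
  rw [hb', mulVec_submatrix_comp] at hb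
  obtain ⟨a, ha⟩ := hR.eq_const (f := b ∘ e.symm) (μ := μ) (by
    exact e.surjective.injective_comp_right hb) hμ
  exact ⟨a, by rw [hb', ha]; rfl⟩

/-! ### Mixing of the fusion walk, its subchains and its lazy version -/

section FusionMixing

variable {p n : ℕ} {v : State p → ℝ}

theorem oddChain_fusionWalk (hp : Odd p) (hn : Odd n) :
    oddChain (fusionWalk p v n) =
      (fusionBar p v n).submatrix (halfEquivOdd hp).symm (halfEquivOdd hp).symm := by
  ext i j
  obtain ⟨i, rfl⟩ := (halfEquivOdd hp).surjective i
  obtain ⟨j, rfl⟩ := (halfEquivOdd hp).surjective j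
  simp only [Matrix.submatrix_apply, Equiv.symm_apply_apply, oddChain, fusionBar, Matrix.of_apply,
    if_pos hn]
  rfl

theorem evenChain_fusionWalk (hp : Odd p) (hsymm : ∀ i, v (flipState p i) = v i)
    (hn : Odd n) :
    evenChain (fusionWalk p v n) =
      (fusionBar p v n).submatrix (halfEquivEven hp).symm (halfEquivEven hp).symm := by
  ext i j
  obtain ⟨i, rfl⟩ := (halfEquivEven hp).surjective i
  obtain ⟨j, rfl⟩ := (halfEquivEven hp).surjective j
  simp only [Matrix.submatrix_apply, Equiv.symm_apply_apply, evenChain, fusionBar, Matrix.of_apply,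
    if_pos hn]
  change fusionWalk p v n (coState i) (coState j) = _
  rw [← fusionWalk_flipState hsymm, flipState_coState, flipState_coState]

theorem fusionDist_odd (hp : Odd p) (i : OddStates p) :
    fusionDist p v n (oddState ((halfEquivOdd hp).symm i)) = fusionDist p v n i := by
  obtain ⟨i, rfl⟩ := (halfEquivOdd hp).surjective i
  rw [Equiv.symm_apply_apply]
  rfl

theorem fusionDist_even (hp : Odd p) (hsymm : ∀ i, v (flipState p i) = v i)
    (i : EvenStates p) :
    fusionDist p v n (oddState ((halfEquivEven hp).symm i)) = fusionDist p v n i := by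
  obtain ⟨i, rfl⟩ := (halfEquivEven hp).surjective i
  rw [Equiv.symm_apply_apply, ← fusionDist_flipState hsymm, flipState_oddState]
  rfl

theorem IsBalanced.sum_halves (hp : Odd p) {ν : State p → ℝ} (hν : IsBalanced ν) :
    ∑ i : HalfIdx p, ν (oddState i) = 1 / 2 ∧ ∑ i : HalfIdx p, ν (coState i) = 1 / 2 := by
  have h1 : ∑ i : HalfIdx p, ν (oddState i) = 1 / 2 := by
    rw [← hν.2, ← Equiv.sum_comp (halfEquivOdd hp)]
    rfl
  refine ⟨h1, ?_⟩
  have h2 := hν.1.2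
  rw [sum_state hp] at h2
  linarith

theorem isBalanced_fusionDist (hp : Odd p) (hn : 1 ≤ n) (hnp : n < p) (hv : ∀ i, 0 < v i)
    (hsymm : ∀ i, v (flipState p i) = v i) : IsBalanced (fusionDist p v n) := by
  refine ⟨(isReversibleChain_fusionWalk hn hnp hv).isStationaryDist.1, ?_⟩
  rw [← sum_fusionDist_oddState hp hn hnp hv hsymm, ← Equiv.sum_comp (halfEquivOdd hp)]
  rfl

/-- An eigenvector beyond the gap takes one value `a` on odd and one value `c` on even states. Its
mean is `(a + c) / 2` under every balanced distribution, and `fusionDist` is balanced, so the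
spectral hypothesis holds although `Q` also has 1 (n odd) or `-1` (n even) as a second eigenvalue of
modulus 1. -/
theorem exists_isBalancedMixingTime_fusionWalk (hp : Odd p) (hn : 1 ≤ n) (hnp : n < p)
    (hv : ∀ i, 0 < v i) (hsymm : ∀ i, v (flipState p i) = v i) {r ε : ℝ}
    (hgap : HasSpectralGap (fusionBar p v n) r) (hr0 : 0 ≤ r) (hr1 : r < 1) (hε : 0 < ε)
    (hε1 : ε ≤ 1) :
    ∃ t : ℕ, IsBalancedMixingTime (fusionWalk p v n) (fusionDist p v n) ε t ∧
      (t : ℝ) ≤ mixBound r ε (⨅ i, fusionDist p v n i) := by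
  have hrev := isReversibleChain_fusionWalk hn hnp hv
  have hp3 : 3 ≤ p := by
    rw [Nat.odd_iff] at hp
    omega
  have := nontrivial_state hp3
  refine exists_isLeast_le_of_floor
    (mixBound_nonneg hr1 hε hε1 hrev.iInf_pos hrev.iInf_le_half) fun ν hν => ?_
  refine hrev.tvDist_floor_mixBound_le hr0 hr1 hε hν.1 fun b μ hb hμ => ?_
  obtain ⟨a, c, ha, hc⟩ : ∃ a c, (∀ i, b (halfSumEquiv hp (Sum.inl i)) = a) ∧
      ∀ i, b (halfSumEquiv hp (Sum.inr i)) = c := by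
    rcases Nat.even_or_odd n with h | h
    · exact hgap.const_on_blocks_of_antidiagonal _
        (fusionWalk_submatrix_of_even hp hsymm h) hb hμ
    · exact hgap.const_on_blocks_of_diagonal _
        (fusionWalk_submatrix_of_odd hp hsymm h) hb hμ
  simp only [halfSumEquiv_inl, halfSumEquiv_inr] at ha hc
  have key : ∀ ν : State p → ℝ, IsBalanced ν → ∑ i, b i * ν i = (a + c) / 2 := by
    intro ν hν
    obtain ⟨h1, h2⟩ := hν.sum_halves hp
    rw [sum_state hp]
    simp only [ha, hc, ← Finset.mul_sum, h1, h2]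
    ring
  rw [key ν hν, key _ (isBalanced_fusionDist hp hn hnp hv hsymm)]

theorem exists_isMixingTime_lazyChain_fusionWalk (hp : Odd p) (hn : 1 ≤ n) (hnp : n < p)
    (hv : ∀ i, 0 < v i) (hsymm : ∀ i, v (flipState p i) = v i) {r ε : ℝ}
    (hgap : HasSpectralGap (fusionBar p v n) r) (hr0 : 0 ≤ r) (hr1 : r < 1) (hε : 0 < ε)
    (hε1 : ε ≤ 1) (hneven : Even n) :
    ∃ t : ℕ, IsMixingTime (lazyChain (fusionWalk p v n)) (fusionDist p v n) ε t ∧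
      (t : ℝ) / 2 ≤ mixBound r ε (⨅ i, fusionDist p v n i) := by
  have hrev := isReversibleChain_fusionWalk hn hnp hv
  have hp3 : 3 ≤ p := by
    rw [Nat.odd_iff] at hp
    omega
  have := nontrivial_state hp3
  have : Nonempty (HalfIdx p) := ⟨⟨1, Finset.mem_Icc.mpr (by omega)⟩⟩
  obtain ⟨t, ht, hle⟩ := hrev.lazy.exists_isMixingTime (r := (1 + r) / 2) (ε := ε) (by linarith)
    (by linarith) hε hε1 fun b μ hb hμ =>
      hgap.const_of_lazyChain hr0 (isReversibleChain_fusionBar hp hn hnp hv hsymm).sum_row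
        (halfSumEquiv hp) (fusionWalk_submatrix_of_even hp hsymm hneven) hb hμ
  refine ⟨t, ht, ?_⟩
  rw [mixBound_lazy hr1] at hle
  linarith

end FusionMixing

/-! ### From modules to fusion rules -/

section TransMatrix

variable {k : Type u} [Field k] {p : ℕ} [Fact p.Prime] [CharP k p]

theorem transMatrix_eq_fusionWalk (w : ModClass k p → ℝ) {n : ℕ} (hn : 1 ≤ n) (hnp : n < p) :
    transMatrix w n = fusionWalk p (fun i => weightOf w i) n := by
  ext i j
  rw [transMatrix_apply w hn hnp]
  rfl

theorem walkDist_eq_fusionDist (w : ModClass k p → ℝ) {n : ℕ} (hn : 1 ≤ n) (hnp : n < p) :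
    walkDist w n = fusionDist p (fun i => weightOf w i) n := by
  funext i
  simp only [walkDist, multMatrix_apply hn hnp]
  rfl

theorem transBar_eq_fusionBar (w : ModClass k p → ℝ) {n : ℕ} (hn : 1 ≤ n) (hnp : n < p) :
    transBar w n = fusionBar p (fun i => weightOf w i) n := by
  ext i j
  rw [transBar, transMatrix_eq_fusionWalk w hn hnp]
  rfl

end TransMatrix

end

theorem proposition5p6 {k : Type*} [Field k] [IsAlgClosed k] {p : ℕ} [Fact p.Prime] [CharP k p]
    (n : ℕ) (hn : 2 ≤ n) (hnp : n + 2 ≤ p)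
    (w : ModClass k p → ℝ) (hw : IsWeight w)
    (hsymm : ∀ i : ℕ, 1 ≤ i → i ≤ p - 1 → weightOf w i = weightOf w (p - i)) :
    -- the walk is a Markov chain on `1, …, p - 1` with stationary distribution `π`
    (transMatrix w n ∈ Matrix.rowStochastic ℝ (State p) ∧
      IsStationaryDist (transMatrix w n) (walkDist w n)) ∧
    -- `Q^(n) = T Q^(p-n) = Q^(p-n) T`
    (transMatrix w n = flipMatrix p * transMatrix w (p - n) ∧
      transMatrix w n = transMatrix w (p - n) * flipMatrix p) ∧
    -- `T Q T = Q`
    flipMatrix p * transMatrix w n * flipMatrix p = transMatrix w n ∧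
    -- invariance of the walk under `i ↦ p - i`
    IsChainIso (transMatrix w n) (transMatrix w n) (flipState p) ∧
    -- `n` odd: the walk splits into two irreducible subchains, which are isomorphic
    (Odd n →
      (∀ i j : State p, Odd ((i : ℕ) + (j : ℕ)) → transMatrix w n i j = 0) ∧
      (oddChain (transMatrix w n)).IsIrreducible ∧
      (evenChain (transMatrix w n)).IsIrreducible ∧
      ∃ e : OddStates p ≃ EvenStates p,
        IsChainIso (oddChain (transMatrix w n)) (evenChain (transMatrix w n)) e) ∧
    -- `Q̄^(p-n) = Q̄^(n)`
    transBar w (p - n) = transBar w n ∧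
    -- `Q = Q̄ ⊗ (0 1; 1 0)^(n+1)` in the ordering `1, 3, …, p - 2, p - 1, …, 4, 2`
    (Function.Bijective (stateOrder p) ∧
      (transMatrix w n).submatrix (stateOrder p) (stateOrder p) =
        Matrix.kronecker (transBar w n) ((!![0, 1; 1, 0] : Matrix (Fin 2) (Fin 2) ℝ) ^ (n + 1))) ∧
    -- `n` odd: all eigenvalues of `Q` have even algebraic and geometric multiplicity
    (Odd n → ∀ μ : ℂ, Even ((complexEigenvalues (transMatrix w n)).count μ) ∧
      Even (Module.finrank ℂ ((complexEnd (transMatrix w n)).eigenspace μ))) ∧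
    -- `n` even: the eigenvalues of `Q` come in pairs `μ, -μ`
    (Even n →
      (∃ S : Multiset ℂ, complexEigenvalues (transMatrix w n) = S + S.map (fun μ => -μ)) ∧
      ∀ μ : ℂ, Module.finrank ℂ ((complexEnd (transMatrix w n)).eigenspace (-μ)) =
        Module.finrank ℂ ((complexEnd (transMatrix w n)).eigenspace μ)) ∧
    -- mixing times
    ∃ lam : ℝ, IsGreatest (nontrivialModuli (transBar w n)) lam ∧ lam < 1 ∧
      ∀ ε : ℝ, 0 < ε → ε ≤ 1 →
        -- the walk, from balanced initial distributions
        (∃ t : ℕ, IsBalancedMixingTime (transMatrix w n) (walkDist w n) ε t ∧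
          (t : ℝ) ≤ mixBound lam ε (⨅ i, walkDist w n i)) ∧
        -- `n` odd: each irreducible subchain, with its own stationary distribution
        (Odd n →
          (IsStationaryDist (oddChain (transMatrix w n))
              (fun i : OddStates p => 2 * walkDist w n i) ∧
            ∃ t : ℕ, IsMixingTime (oddChain (transMatrix w n))
                (fun i : OddStates p => 2 * walkDist w n i) ε t ∧
              (t : ℝ) ≤ mixBound lam ε (⨅ i : OddStates p, 2 * walkDist w n i)) ∧
          (IsStationaryDist (evenChain (transMatrix w n))
              (fun i : EvenStates p => 2 * walkDist w n i) ∧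
            ∃ t : ℕ, IsMixingTime (evenChain (transMatrix w n))
                (fun i : EvenStates p => 2 * walkDist w n i) ε t ∧
              (t : ℝ) ≤ mixBound lam ε (⨅ i : EvenStates p, 2 * walkDist w n i))) ∧
        -- `n` even: half the mixing time of the lazy walk
        (Even n → ∃ t : ℕ, IsMixingTime (lazyChain (transMatrix w n)) (walkDist w n) ε t ∧
          (t : ℝ) / 2 ≤ mixBound lam ε (⨅ i, walkDist w n i)) := by
  -- The bounds on `n` give `p ≥ 4`, and 4 is not prime. From `p ≥ 5` there are at least two indices
  -- in the half, so that an eigenvalue other than 1 exists.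
  obtain ⟨hnp1, hp5⟩ : n < p ∧ 5 ≤ p := by
    refine ⟨by omega, ?_⟩
    by_contra h
    have h4 : p = 4 := by omega
    exact absurd (h4 ▸ Fact.out (p := p.Prime)) (by norm_num)
  have hp : Odd p := (Fact.out : p.Prime).odd_of_ne_two (by omega)
  have hn1 : 1 ≤ n := by omega
  have hn1' : 1 ≤ p - n := by omega
  have hnp' : p - n < p := by omega
  have hv : ∀ i : State p, 0 < weightOf w i := weightOf_pos hw
  have hs : ∀ i : State p, weightOf w (flipState p i) = weightOf w i := fun i => by
    have := Finset.mem_Icc.mp i.2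
    rw [coe_flipState, ← hsymm i this.1 this.2]
  rw [transMatrix_eq_fusionWalk w hn1 hnp1, transMatrix_eq_fusionWalk w hn1' hnp',
    transBar_eq_fusionBar w hn1 hnp1, transBar_eq_fusionBar w hn1' hnp',
    walkDist_eq_fusionDist w hn1 hnp1]
  change ∀ i : State p, 0 < (fun i : State p => weightOf w i) i at hv
  change ∀ i : State p, (fun i : State p => weightOf w i) (flipState p i) =
    (fun i : State p => weightOf w i) i at hs
  -- From here on only the positivity and the reflection symmetry of the weights matter; the modules
  -- no longer appear.
  generalize (fun i : State p => weightOf w i) = v at hv hs ⊢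
  have hrev := isReversibleChain_fusionWalk hn1 hnp1 hv
  have hbar := isReversibleChain_fusionBar hp hn1 hnp1 hv hs
  have hconn := fun f => fusionBar_connected (f := f) hp hn hnp hv hs
  have := nontrivial_halfIdx hp5
  refine ⟨⟨hrev.mem_rowStochastic, hrev.isStationaryDist⟩, ⟨?_, ?_⟩, ?_,
    fun i j => fusionWalk_flipState hs i j, fun hodd => ⟨fun i j hij => ?_, ?_, ?_, ?_⟩,
    fusionBar_sub hp hnp1 hs,
    ⟨stateOrder_bijective hp, fusionWalk_submatrix_stateOrder hp hs⟩,
    fun hodd μ => ?_, fun heven => ?_, ?_⟩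
  · ext i j
    rw [flipMatrix_mul_apply, fusionWalk_sub hnp1 hs, fusionWalk_flipState hs]
  · ext i j
    rw [mul_flipMatrix_apply, fusionWalk_sub hnp1 hs, flipState_flipState]
  · ext i j
    rw [mul_flipMatrix_apply, flipMatrix_mul_apply, fusionWalk_flipState hs]
  · refine fusionWalk_eq_zero ?_
    rw [Nat.odd_iff] at hij hodd
    omega
  · rw [oddChain_fusionWalk hp hodd]
    exact (hbar.isIrreducible hconn).submatrix_equiv _
  · rw [evenChain_fusionWalk hp hs hodd]
    exact (hbar.isIrreducible hconn).submatrix_equiv _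
  · refine ⟨(halfEquivOdd hp).symm.trans (halfEquivEven hp), fun i j => ?_⟩
    rw [oddChain_fusionWalk hp hodd, evenChain_fusionWalk hp hs hodd]
    simp
  · have h := fusionWalk_submatrix_of_odd hp hs hodd
    exact ⟨even_count_complexEigenvalues _ h μ, even_finrank_eigenspace _ h μ⟩
  · have h := fusionWalk_submatrix_of_even hp hs heven
    exact ⟨exists_complexEigenvalues_eq _ h, finrank_eigenspace_neg _ h⟩
  obtain ⟨r, hr, hr0, hr1, hgap⟩ := hbar.exists_isGreatest_nontrivialModuli hconn
  refine ⟨r, hr, hr1, fun ε hε hε1 => ⟨?_, fun hodd => ⟨?_, ?_⟩, fun heven => ?_⟩⟩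
  · exact exists_isBalancedMixingTime_fusionWalk hp hn1 hnp1 hv hs hgap hr0 hr1 hε hε1
  · simp only [oddChain_fusionWalk hp hodd, ← fusionDist_odd hp]
    exact ⟨(hbar.submatrix _).isStationaryDist, HasSpectralGap.exists_isMixingTime_submatrix hgap
      hbar hr0 hr1 hε hε1 _⟩
  · simp only [evenChain_fusionWalk hp hs hodd, ← fusionDist_even hp hs]
    exact ⟨(hbar.submatrix _).isStationaryDist, HasSpectralGap.exists_isMixingTime_submatrix hgap
      hbar hr0 hr1 hε hε1 _⟩
  · exact exists_isMixingTime_lazyChain_fusionWalk hp hn1 hnp1 hv hs hgap hr0 hr1 hε hε1 heven
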